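/- **Setting.** Let $dS^4=\mathbb{R}_t\times\mathbb{S}^3$ carry the de Sitter metric $\mathbf g=-dt^2+\cosh^2(t)\,\mathbf h$, where $\mathbf h$ is the canonical metric of $\mathbb{S}^3$, so that $\mathrm{Ric}=\Lambda\mathbf g$ with $\Lambda=3$. Let $\Sigma=\{t=0\}$ with unit normal $\nu=\partial_t$, and let $V_k$ ($k=0,1,2$) be the bundle of complex symmetric $(0,k)$-tensors with the fiber form $(u|v)_{V_k}=k!\,\mathbf g^{a_1b_1}\cdots\mathbf g^{a_kb_k}\,\overline{u}_{a_1\dots a_k}v_{b_1\dots b_k}$. Put $(du)_{a_1\dots a_{k+1}}=\nabla_{(a_1}u_{a_2\dots a_{k+1})}$ and $(\delta u)_{a_1\dots a_{k-1}}=-k\nabla^au_{aa_1\dots a_{k-1}}$, let $(Iu)_{ab}=u_{ab}-\tfrac12\mathrm{tr}_{\mathbf g}(u)\,\mathbf g_{ab}$ be trace reversal, and set $$K_{21}=I\circ d,\qquad K_{21}^\star=\delta,\qquad K_{20}^\star=-(\mathbf g|\,\cdot\,)_{V_2}=-2\,\mathrm{tr}_{\mathbf g}.$$ Let $D_k=D_{k,L}-2\Lambda$,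 where $D_{1,L}=-\square+\mathrm{Ric}\circ\mathbf g^{-1}$ and $D_{2,L}=-\square+\mathrm{Ric}\circ\mathbf g^{-1}\circ\cdot+\cdot\circ\mathbf g^{-1}\circ\mathrm{Ric}+2\,\mathrm{Riem}$ are the Lichnerowicz operators on $V_1$, $V_2$, with $\mathrm{Riem}(u)_{ab}=R_a{}^{cd}{}_b\,u_{cd}$ and $(\nabla_a\nabla_b-\nabla_b\nabla_a)w_c=R_{abc}{}^d\,w_d$. Let $\varrho_ku=(u|_\Sigma,\ \mathrm i^{-1}\nabla_\nu u|_\Sigma)$ be the Cauchy data map on smooth sections of $V_k$, and for $k=1,2$ let $U_k$ be the map that sends Cauchy data $f\in C^\infty(\Sigma;V_k\otimes\mathbb{C}^2)$ to the smooth solution $u$ on $dS^4$ of $D_ku=0$, $\varrho_ku=f$. Put $$K_{21\Sigma}=\varrho_2K_{21}U_1,\qquad K_{21\Sigma}^\dagger=\varrho_1K_{21}^\star U_2,\qquad K_{20\Sigma}^\dagger=\varrho_0K_{20}^\star U_2,$$ $$\mathcal E_{\rm TT}=\mathrm{Ker}\,K_{21\Sigma}^\dagger\cap\mathrm{Ker}\,K_{20\Sigma}^\dagger,\qquad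 \mathcal F_{\rm TT}=\mathrm{Ran}\,K_{21\Sigma}\cap\mathrm{Ker}\,K_{20\Sigma}^\dagger,$$ as subspaces of $C^\infty(\Sigma;V_2\otimes\mathbb{C}^2)$. The physical charge is the sesquilinear form $\mathbf q_{I,2}=\mathbf q_2\circ I_\Sigma$ on $C^\infty(\Sigma;V_2\otimes\mathbb{C}^2)$, where $I_\Sigma(f_0,f_1)=(If_0,If_1)$ and $$\overline f\cdot\mathbf q_2f'=\int_\Sigma\big((f_0|f_1')_{V_2}+(f_1|f_0')_{V_2}\big)\,d\mathrm{vol}_{\mathbf h}.$$ **Proposition.** The kernel of the restriction of $\mathbf q_{I,2}$ to $\mathcal E_{\rm TT}$ is exactly $\mathcal F_{\rm TT}$: $$\{f\in\mathcal E_{\rm TT}:\ \overline{f'}\cdot\mathbf q_{I,2}f=0\ \text{ for all } f'\in\mathcal E_{\rm TT}\}=\mathcal F_{\rm TT}.$$ Consequently $\overline{[f]}\cdot[\mathbf q_{I,2}][f']=\overline f\cdot\mathbf q_{I,2}f'$ is a well-defined, non-degenerate Hermitian form on the physical phase space $\mathcal E_{\rm TT}/\mathcal F_{\rm TT}$ of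 linearized gravity on global de Sitter space. -/

import Mathlib

noncomputable section

namespace DeSitter

open scoped Manifold ContDiff ComplexConjugate
open MeasureTheory

/-! ### Global de Sitter space `ℝ × 𝕊³` and its smooth functions -/

/-- The Euclidean space containing the three-sphere. -/
abbrev E4 : Type := EuclideanSpace ℝ (Fin 4)

/-- The unit sphere `𝕊³ ⊂ ℝ⁴`, the Cauchy surface `Σ = {t = 0}`. -/
abbrev S3 : Type := Metric.sphere (0 : E4) 1

instance : Fact (Module.finrank ℝ E4 = 3 + 1) := ⟨by simp⟩

/-- The manifold underlying de Sitter space, with points `(t, y)`. -/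
abbrev Spacetime : Type := ℝ × S3

/-- The algebra of smooth complex functions on spacetime. -/
def smoothAlgM : Subalgebra ℂ (Spacetime → ℂ) where
  carrier := {f | ContMDiff (𝓘(ℝ, ℝ).prod (𝓡 3)) 𝓘(ℝ, ℂ) ∞ f}
  mul_mem' hf hg := contDiff_mul.contMDiff.comp (hf.prodMk_space hg)
  add_mem' hf hg := contDiff_add.contMDiff.comp (hf.prodMk_space hg)
  algebraMap_mem' _ := contMDiff_const

/-- The algebra of smooth complex functions on the Cauchy surface. -/
def smoothAlgS : Subalgebra ℂ (S3 → ℂ) where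
  carrier := {f | ContMDiff (𝓡 3) 𝓘(ℝ, ℂ) ∞ f}
  mul_mem' hf hg := contDiff_mul.contMDiff.comp (hf.prodMk_space hg)
  add_mem' hf hg := contDiff_add.contMDiff.comp (hf.prodMk_space hg)
  algebraMap_mem' _ := contMDiff_const

/-- Smooth complex functions on spacetime. -/
def SmoothM : Type := smoothAlgM

instance : CommRing SmoothM := inferInstanceAs (CommRing smoothAlgM)
instance : Algebra ℂ SmoothM := inferInstanceAs (Algebra ℂ smoothAlgM)

/-- Smooth complex functions on the Cauchy surface. -/
def SmoothS : Type := smoothAlgS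

instance : CommRing SmoothS := inferInstanceAs (CommRing smoothAlgS)
instance : Algebra ℂ SmoothS := inferInstanceAs (Algebra ℂ smoothAlgS)

/-- Restriction of smooth functions to `{t = 0}`. -/
def restrict : SmoothM →ₐ[ℂ] SmoothS where
  toFun f := ⟨fun y => f.1 (0, y), f.2.comp (contMDiff_const.prodMk contMDiff_id)⟩
  map_one' := rfl
  map_mul' _ _ := rfl
  map_zero' := rfl
  map_add' _ _ := rfl
  commutes' _ := rfl

/-- A smooth function of the time variable, viewed on spacetime. -/
def ofTime (c : ℝ → ℝ) (hc : ContDiff ℝ ∞ c) : SmoothM :=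
  ⟨fun p => ((c p.1 : ℝ) : ℂ),
    (Complex.ofRealCLM.contDiff.contMDiff.comp (hc.contMDiff.comp contMDiff_fst))⟩

/-! ### The global frame

With `ℝ⁴` identified with the quaternions, `J i` is right multiplication by the `i`-th imaginary
unit, so that `y ↦ J i y` (`i = 0, 1, 2`) are left invariant vector fields on `𝕊³`, orthonormal for
the canonical metric. Together with `∂_t` they give a global frame `e 0 = ∂_t, e 1, e 2, e 3` of the
tangent bundle of `ℝ × 𝕊³`. -/

/-- Right multiplication of quaternions by `i`, `j`, `k`. -/
def J (i : Fin 3) : E4 →L[ℝ] E4 :=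
  Matrix.toEuclideanCLM (n := Fin 4) (𝕜 := ℝ)
    (![!![0, -1, 0, 0; 1, 0, 0, 0; 0, 0, 0, 1; 0, 0, -1, 0],
       !![0, 0, -1, 0; 0, 0, 0, -1; 1, 0, 0, 0; 0, 1, 0, 0],
       !![0, 0, 0, -1; 0, 0, 1, 0; 0, -1, 0, 0; 1, 0, 0, 0]] i)

theorem inner_J_self (i : Fin 3) (y : E4) : inner ℝ y (J i y) = 0 := by
  fin_cases i <;>
    simp [J, PiLp.inner_apply, Fin.sum_univ_four, Matrix.mulVec, dotProduct] <;> ring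

theorem inner_J_J (i j : Fin 3) (y : E4) :
    inner ℝ (J i y) (J j y) = if i = j then ‖y‖ ^ 2 else 0 := by
  fin_cases i <;> fin_cases j <;>
    simp [J, EuclideanSpace.real_norm_sq_eq, PiLp.inner_apply, Fin.sum_univ_four, Matrix.mulVec, dotProduct] <;> ring

/-- The structure constants: `[e a, e b] = ∑ d, bracket a b d • e d`. -/
def bracket (a b d : Fin 4) : ℂ :=
  if (a, b, d) = (1, 2, 3) ∨ (a, b, d) = (2, 3, 1) ∨ (a, b, d) = (3, 1, 2) then 2
  else if (a, b, d) = (2, 1, 3) ∨ (a, b, d) = (3, 2, 1) ∨ (a, b, d) = (1, 3, 2) then -2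
  else 0

/-- The commutators of the linear vector fields `y ↦ J i y`. -/
theorem bracket_J (i j : Fin 3) (y : E4) :
    J j (J i y) - J i (J j y) = ∑ k : Fin 3, (bracket i.succ j.succ k.succ).re • J k y := by
  fin_cases i <;> fin_cases j <;> ext l <;> fin_cases l <;>
    simp [J, bracket, Fin.sum_univ_three, Fin.sum_univ_four, Matrix.mulVec, dotProduct] <;> ring

theorem norm_rot (i : Fin 3) (θ : ℝ) (y : S3) :
    Real.cos θ • (y : E4) + Real.sin θ • J i y ∈ Metric.sphere (0 : E4) 1 := by
  have hy : ‖(y : E4)‖ = 1 := norm_eq_of_mem_sphere y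
  have hJ : ‖J i y‖ ^ 2 = 1 := by
    have h := inner_J_J i i (y : E4)
    rwa [real_inner_self_eq_norm_sq, if_pos rfl, hy, one_pow] at h
  have h : ‖Real.cos θ • (y : E4) + Real.sin θ • J i y‖ ^ 2 = 1 := by
    rw [norm_add_sq_real, inner_smul_left, inner_smul_right, inner_J_self, norm_smul, norm_smul,
      mul_pow, mul_pow, hy, hJ]
    simp
  rw [mem_sphere_zero_iff_norm]
  exact (pow_eq_one_iff_of_nonneg (norm_nonneg _) two_ne_zero).1 h

/-- The flow of the vector field `y ↦ J i y` on the sphere. -/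
def rot (i : Fin 3) (θ : ℝ) (y : S3) : S3 :=
  ⟨Real.cos θ • (y : E4) + Real.sin θ • J i y, norm_rot i θ y⟩

/-- The flow of the frame vector field `e a` on spacetime. -/
def flow (a : Fin 4) (θ : ℝ) (p : Spacetime) : Spacetime :=
  Fin.cases (p.1 + θ, p.2) (fun i => (p.1, rot i θ p.2)) a

theorem contMDiff_flow (a : Fin 4) :
    ContMDiff ((𝓘(ℝ, ℝ).prod (𝓡 3)).prod 𝓘(ℝ, ℝ)) (𝓘(ℝ, ℝ).prod (𝓡 3)) ∞
      (fun q : Spacetime × ℝ => flow a q.2 q.1) := by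
  have h1 : ContMDiff ((𝓘(ℝ, ℝ).prod (𝓡 3)).prod 𝓘(ℝ, ℝ)) 𝓘(ℝ, ℝ) ∞
      (fun q : Spacetime × ℝ => q.1.1) := contMDiff_fst.comp contMDiff_fst
  have h2 : ContMDiff ((𝓘(ℝ, ℝ).prod (𝓡 3)).prod 𝓘(ℝ, ℝ)) (𝓡 3) ∞
      (fun q : Spacetime × ℝ => q.1.2) := contMDiff_snd.comp contMDiff_fst
  have h3 : ContMDiff ((𝓘(ℝ, ℝ).prod (𝓡 3)).prod 𝓘(ℝ, ℝ)) 𝓘(ℝ, ℝ) ∞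
      (fun q : Spacetime × ℝ => q.2) := contMDiff_snd
  refine Fin.cases ?_ (fun i => ?_) a
  · exact ((contDiff_add (𝕜 := ℝ) (F := ℝ)).contMDiff.comp (h1.prodMk_space h3)).prodMk h2
  · refine h1.prodMk ?_
    have h4 : ContMDiff ((𝓘(ℝ, ℝ).prod (𝓡 3)).prod 𝓘(ℝ, ℝ)) 𝓘(ℝ, E4) ∞
        (fun q : Spacetime × ℝ => (q.1.2 : E4)) := contMDiff_coe_sphere.comp h2
    have h5 : ContDiff ℝ ∞ (fun z : E4 × ℝ => Real.cos z.2 • z.1 + Real.sin z.2 • J i z.1) := by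
      fun_prop
    exact ContMDiff.codRestrict_sphere (h5.contMDiff.comp (h4.prodMk_space h3))
      (fun q => norm_rot i q.2 q.1.2)

theorem contMDiff_frame (a : Fin 4) (f : SmoothM) :
    ContMDiff (𝓘(ℝ, ℝ).prod (𝓡 3)) 𝓘(ℝ, ℂ) ∞
      (fun p : Spacetime => deriv (fun θ : ℝ => f.1 (flow a θ p)) 0) := by
  intro p
  have h := (f.2.comp (contMDiff_flow a)).contMDiffAt (x := (p, (0 : ℝ)))
  have h' := ContMDiffAt.mfderiv_apply (I := 𝓘(ℝ, ℝ)) (I' := 𝓘(ℝ, ℂ)) (n := ∞) (m := ∞)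
    (fun (p : Spacetime) (θ : ℝ) => f.1 (flow a θ p)) (fun _ => (0 : ℝ)) id (fun _ => (1 : ℝ))
    h contMDiffAt_const contMDiffAt_id contMDiffAt_const (by rfl)
  simpa only [inTangentCoordinates_model_space, mfderiv_eq_fderiv, fderiv_apply_one_eq_deriv,
    id] using h'

theorem differentiable_flow (a : Fin 4) (f : SmoothM) (p : Spacetime) :
    Differentiable ℝ (fun θ : ℝ => f.1 (flow a θ p)) := by
  have h : ContMDiff 𝓘(ℝ, ℝ) 𝓘(ℝ, ℂ) ∞ (fun θ : ℝ => f.1 (flow a θ p)) :=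
    (f.2.comp (contMDiff_flow a)).comp (contMDiff_const.prodMk contMDiff_id)
  exact h.contDiff.differentiable (by simp)

/-- The frame vector field `e a` as a derivation of smooth functions:
the derivative along its flow. -/
def e (a : Fin 4) : SmoothM →ₗ[ℂ] SmoothM where
  toFun f := ⟨fun p => deriv (fun θ : ℝ => f.1 (flow a θ p)) 0, contMDiff_frame a f⟩
  map_add' f h := by
    refine Subtype.ext (funext fun p => ?_)
    exact deriv_add (differentiable_flow a f p 0) (differentiable_flow a h p 0)
  map_smul' c f := by
    refine Subtype.ext (funext fun p => ?_)
    exact deriv_const_smul c (differentiable_flow a f p 0)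

/-! ### Metric, Levi-Civita connection and curvature in the frame -/

theorem contDiff_coshSq : ContDiff ℝ ∞ (fun t : ℝ => Real.cosh t ^ 2) :=
  Real.contDiff_cosh.pow 2

theorem contDiff_coshSq_inv : ContDiff ℝ ∞ (fun t : ℝ => (Real.cosh t ^ 2)⁻¹) :=
  contDiff_coshSq.inv fun t => pow_ne_zero 2 (Real.cosh_pos t).ne'

/-- The components of the de Sitter metric `g = -dt² + cosh² t h`. -/
def g (a b : Fin 4) : SmoothM :=
  if a = b then (if a = 0 then -1 else ofTime _ contDiff_coshSq) else 0

/-- The components of the inverse metric. -/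
def gInv (a b : Fin 4) : SmoothM :=
  if a = b then (if a = 0 then -1 else ofTime _ contDiff_coshSq_inv) else 0

/-- The connection coefficients `∇_{e a} (e b) = ∑ d, Γ a b d • e d` of the Levi-Civita connection,
given by the Koszul formula. -/
def Γ (a b d : Fin 4) : SmoothM :=
  (1 / 2 : ℂ) • ∑ m, gInv d m *
    (e a (g b m) + e b (g a m) - e m (g a b)
      + ∑ n, (bracket a b n • g n m - bracket a m n • g n b - bracket b m n • g n a))

/-- The Riemann tensor `R_{abc}^d`, with the convention
`(∇_a ∇_b - ∇_b ∇_a) u_c = R_{abc}^d u_d`. -/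
def Riemann (a b c d : Fin 4) : SmoothM :=
  - e a (Γ b c d) + e b (Γ a c d)
    + ∑ m, (Γ a c m * Γ b m d - Γ b c m * Γ a m d + bracket a b m • Γ m c d)

/-- The Ricci tensor `Ric_{ab} = R_{acb}^c`. -/
def Ric (a b : Fin 4) : SmoothM := ∑ c, Riemann a c b c

/-! ### Tensor fields -/

/-- Smooth complex `(0,k)`-tensor fields on spacetime, through their components in the frame. -/
abbrev Tensor (k : ℕ) : Type := (Fin k → Fin 4) → SmoothM

/-- The symmetric tensor fields, i.e. the smooth sections of `V_k`. -/
def symTensor (k : ℕ) : Submodule ℂ (Tensor k) where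
  carrier := {u | ∀ (s : Equiv.Perm (Fin k)) (i : Fin k → Fin 4), u (i ∘ s) = u i}
  add_mem' hu hv s i := by simp only [Pi.add_apply, hu s i, hv s i]
  zero_mem' _ _ := rfl
  smul_mem' c u hu s i := by simp only [Pi.smul_apply, hu s i]

/-- The covariant derivative, `(∇u)_{a i₁ … i_k} = (∇_{e a} u)_{i₁ … i_k}`. -/
def nabla (k : ℕ) : Tensor k →ₗ[ℂ] Tensor (k + 1) where
  toFun u i := e (i 0) (u (Fin.tail i))
    - ∑ l, ∑ d, Γ (i 0) (Fin.tail i l) d * u (Function.update (Fin.tail i) l d)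
  map_add' u v := by
    funext i
    simp only [Pi.add_apply, map_add, mul_add, Finset.sum_add_distrib]
    abel
  map_smul' c u := by
    funext i
    simp only [Pi.smul_apply, map_smul, mul_smul_comm, ← Finset.smul_sum, RingHom.id_apply,
      smul_sub]

/-- Contraction of the first two indices with the inverse metric. -/
def contract (k : ℕ) : Tensor (k + 2) →ₗ[ℂ] Tensor k where
  toFun u i := ∑ a, ∑ b, gInv a b * u (Fin.cons a (Fin.cons b i))
  map_add' u v := by
    funext i
    simp only [Pi.add_apply, mul_add, Finset.sum_add_distrib]
  map_smul' c u := by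
    funext i
    simp only [Pi.smul_apply, mul_smul_comm, ← Finset.smul_sum, RingHom.id_apply]

/-- The rough d'Alembertian `□ u = g^{ab} ∇²_{e_a, e_b} u`. -/
def box (k : ℕ) : Tensor k →ₗ[ℂ] Tensor k :=
  contract k ∘ₗ nabla (k + 1) ∘ₗ nabla k

/-- The symmetrized differential `(du)_{a₁ … a_{k+1}} = ∇_{(a₁} u_{a₂ … a_{k+1})}`. -/
def symD (k : ℕ) : Tensor k →ₗ[ℂ] Tensor (k + 1) where
  toFun u i := (1 / (Nat.factorial (k + 1) : ℂ)) •
    ∑ s : Equiv.Perm (Fin (k + 1)), nabla k u (i ∘ s)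
  map_add' u v := by
    funext i
    simp only [map_add, Pi.add_apply, Finset.sum_add_distrib, smul_add]
  map_smul' c u := by
    funext i
    simp only [map_smul, Pi.smul_apply, ← Finset.smul_sum, RingHom.id_apply]
    rw [smul_comm]

/-- The codifferential `(δu)_{a₁ … a_k} = -(k+1) ∇^a u_{a a₁ … a_k}` of a `(k+1)`-tensor. -/
def codiff (k : ℕ) : Tensor (k + 1) →ₗ[ℂ] Tensor k :=
  (-((k : ℂ) + 1)) • (contract k ∘ₗ nabla (k + 1))

/-- The trace `tr_g u = g^{ab} u_{ab}` in the algebra of coefficients `A`. -/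
def trace {A : Type} [CommRing A] [Algebra ℂ A] (ginv : Fin 4 → Fin 4 → A) :
    ((Fin 2 → Fin 4) → A) →ₗ[ℂ] A where
  toFun u := ∑ a, ∑ b, ginv a b * u ![a, b]
  map_add' u v := by simp only [Pi.add_apply, mul_add, Finset.sum_add_distrib]
  map_smul' c u := by
    simp only [Pi.smul_apply, mul_smul_comm, ← Finset.smul_sum, RingHom.id_apply]

/-- Trace reversal `(I u)_{ab} = u_{ab} - ½ tr_g(u) g_{ab}`. -/
def traceReversal {A : Type} [CommRing A] [Algebra ℂ A] (gm ginv : Fin 4 → Fin 4 → A) :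
    ((Fin 2 → Fin 4) → A) →ₗ[ℂ] ((Fin 2 → Fin 4) → A) where
  toFun u i := u i - (1 / 2 : ℂ) • (trace ginv u * gm (i 0) (i 1))
  map_add' u v := by
    funext i
    simp only [map_add, Pi.add_apply, add_mul, smul_add]
    abel
  map_smul' c u := by
    funext i
    simp only [map_smul, Pi.smul_apply, smul_mul_assoc, RingHom.id_apply, smul_sub]
    rw [smul_comm]

/-! ### The hyperbolic operators `D_k = D_{k,L} - 2Λ` -/

/-- The cosmological constant of de Sitter space, `Ric = Λ g`. -/
def Λ : ℂ := 3

/-- The action `(Ric ∘ g⁻¹) w` on `1`-tensors, `Ric_a^b w_b`. -/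
def ricciOne : Tensor 1 →ₗ[ℂ] Tensor 1 where
  toFun w i := ∑ b, ∑ c, Ric (i 0) b * gInv b c * w ![c]
  map_add' u v := by
    funext i
    simp only [Pi.add_apply, mul_add, Finset.sum_add_distrib]
  map_smul' c u := by
    funext i
    simp only [Pi.smul_apply, mul_smul_comm, ← Finset.smul_sum, RingHom.id_apply]

/-- The action `Ric ∘ g⁻¹ ∘ u + u ∘ g⁻¹ ∘ Ric` on `2`-tensors. -/
def ricciTwo : Tensor 2 →ₗ[ℂ] Tensor 2 where
  toFun u i := (∑ b, ∑ c, Ric (i 0) b * gInv b c * u ![c, i 1])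
    + ∑ b, ∑ c, Ric c (i 1) * gInv b c * u ![i 0, b]
  map_add' u v := by
    funext i
    simp only [Pi.add_apply, mul_add, Finset.sum_add_distrib]
    abel
  map_smul' c u := by
    funext i
    simp only [Pi.smul_apply, mul_smul_comm, ← Finset.smul_sum, RingHom.id_apply, smul_add]

/-- The Ricci operator `Riem(u)_{ab} = R_a^{cd}_b u_{cd}`. -/
def riemOp : Tensor 2 →ₗ[ℂ] Tensor 2 where
  toFun u i := ∑ c, ∑ d, (∑ c', ∑ d', ∑ m,
    gInv c c' * gInv d d' * (Riemann (i 0) c' d' m * g m (i 1))) * u ![c, d]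
  map_add' u v := by
    funext i
    simp only [Pi.add_apply, mul_add, Finset.sum_add_distrib]
  map_smul' c u := by
    funext i
    simp only [Pi.smul_apply, mul_smul_comm, ← Finset.smul_sum, RingHom.id_apply]

/-- `D_1 = D_{1,L} - 2Λ` with the Lichnerowicz operator `D_{1,L} = -□ + Ric ∘ g⁻¹`. -/
def D1 : Tensor 1 →ₗ[ℂ] Tensor 1 :=
  -box 1 + ricciOne - (2 * Λ) • LinearMap.id

/-- `D_2 = D_{2,L} - 2Λ` with the Lichnerowicz operator
`D_{2,L} = -□ + Ric ∘ g⁻¹ ∘ · + · ∘ g⁻¹ ∘ Ric + 2 Riem`. -/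
def D2 : Tensor 2 →ₗ[ℂ] Tensor 2 :=
  -box 2 + ricciTwo + (2 : ℂ) • riemOp - (2 * Λ) • LinearMap.id

/-- `K_{21} = I ∘ d`, the infinitesimal gauge transformations. -/
def K21 : Tensor 1 →ₗ[ℂ] Tensor 2 := traceReversal g gInv ∘ₗ symD 1

/-- `K_{21}^⋆ = δ`, the harmonic (de Donder) gauge operator. -/
def K21star : Tensor 2 →ₗ[ℂ] Tensor 1 := codiff 1

/-- `K_{20}^⋆ = -(g| · )_{V_2} = -2 tr_g`. -/
def K20star : Tensor 2 →ₗ[ℂ] Tensor 0 :=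
  LinearMap.pi fun _ => (-2 : ℂ) • trace gInv

/-! ### Cauchy data -/

/-- Smooth sections over `Σ` of the bundle of `(0,k)`-tensors of spacetime. -/
abbrev TensorS (k : ℕ) : Type := (Fin k → Fin 4) → SmoothS

/-- Cauchy data `(f₀, f₁)`. -/
abbrev Data (k : ℕ) : Type := TensorS k × TensorS k

/-- Restriction of tensor fields to `Σ`. -/
def restrictTensor (k : ℕ) : Tensor k →ₗ[ℂ] TensorS k :=
  LinearMap.pi fun i => restrict.toLinearMap ∘ₗ LinearMap.proj i

/-- The covariant derivative `∇_ν` along the future directed unit normal `ν = e 0 = ∂_t`. -/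
def nablaNu (k : ℕ) : Tensor k →ₗ[ℂ] Tensor k :=
  LinearMap.pi fun i => LinearMap.proj (Fin.cons 0 i) ∘ₗ nabla k

/-- The Cauchy data map `ρ_k u = (u|_Σ, i⁻¹ ∇_ν u|_Σ)`. -/
def rho (k : ℕ) : Tensor k →ₗ[ℂ] Data k :=
  (restrictTensor k).prod (Complex.I⁻¹ • (restrictTensor k ∘ₗ nablaNu k))

/-- The Cauchy surface version `ρ_i ∘ K ∘ U_j` of `K`, given by its graph; here `U_j` assigns to
Cauchy data the solution of `D u = 0` with these data, so that the graph consists of the pairs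
`(ρ_j u, ρ_i (K u))` where `u` runs over the smooth sections of `V_j` with `D u = 0`. -/
def cauchyGraph {j i : ℕ} (D : Tensor j →ₗ[ℂ] Tensor j) (K : Tensor j →ₗ[ℂ] Tensor i) :
    Submodule ℂ (Data j × Data i) :=
  (symTensor j ⊓ LinearMap.ker D).map ((rho j).prod (rho i ∘ₗ K))

/-- `K_{21Σ} = ρ_2 K_{21} U_1`. -/
def K21Sigma : Submodule ℂ (Data 1 × Data 2) := cauchyGraph D1 K21

/-- `K_{21Σ}^† = ρ_1 K_{21}^⋆ U_2`. -/
def K21SigmaDag : Submodule ℂ (Data 2 × Data 1) := cauchyGraph D2 K21star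

/-- `K_{20Σ}^† = ρ_0 K_{20}^⋆ U_2`. -/
def K20SigmaDag : Submodule ℂ (Data 2 × Data 0) := cauchyGraph D2 K20star

/-- The kernel of an operator given by its graph. -/
def graphKer {X Y : Type} [AddCommGroup X] [Module ℂ X] [AddCommGroup Y] [Module ℂ Y]
    (R : Submodule ℂ (X × Y)) : Submodule ℂ X := R.comap (LinearMap.inl ℂ X Y)

/-- The range of an operator given by its graph. -/
def graphRange {X Y : Type} [AddCommGroup X] [Module ℂ X] [AddCommGroup Y] [Module ℂ Y]
    (R : Submodule ℂ (X × Y)) : Submodule ℂ Y := R.map (LinearMap.snd ℂ X Y)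

/-- `E_TT = Ker K_{21Σ}^† ∩ Ker K_{20Σ}^†`. -/
def ETT : Submodule ℂ (Data 2) := graphKer K21SigmaDag ⊓ graphKer K20SigmaDag

/-- `F_TT = Ran K_{21Σ} ∩ Ker K_{20Σ}^†`. -/
def FTT : Submodule ℂ (Data 2) := graphRange K21Sigma ⊓ graphKer K20SigmaDag

/-! ### The physical charge -/

/-- Complex conjugation of smooth functions on `Σ`. -/
def conjS (f : SmoothS) : SmoothS :=
  ⟨fun y => conj (f.1 y), Complex.conjCLE.contDiff.contMDiff.comp f.2⟩

theorem integrable_smoothS (f : SmoothS) :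
    Integrable f.1 ((volume : Measure E4).toSphere) :=
  (ContMDiff.continuous f.2).integrable_of_hasCompactSupport
    (HasCompactSupport.of_compactSpace f.1)

/-- Integration over `Σ = 𝕊³` with respect to the canonical surface measure. -/
def integralS : SmoothS →ₗ[ℂ] ℂ where
  toFun f := ∫ y, f.1 y ∂((volume : Measure E4).toSphere)
  map_add' f h := integral_add (integrable_smoothS f) (integrable_smoothS h)
  map_smul' c f := integral_const_mul c f.1

theorem conjS_add (f h : SmoothS) : conjS (f + h) = conjS f + conjS h :=
  Subtype.ext (funext fun y => map_add (starRingEnd ℂ) (f.1 y) (h.1 y))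

theorem conjS_smul (c : ℂ) (f : SmoothS) : conjS (c • f) = conj c • conjS f :=
  Subtype.ext (funext fun y => map_mul (starRingEnd ℂ) c (f.1 y))

/-- The fiber Hermitian form
`(u|v)_{V_k} = k! g^{a₁b₁} ⋯ g^{a_k b_k} conj(u_{a₁ … a_k}) v_{b₁ … b_k}` over `Σ`. -/
def fiberForm (k : ℕ) (u v : TensorS k) : SmoothS :=
  (Nat.factorial k : ℂ) • ∑ i : Fin k → Fin 4, ∑ l : Fin k → Fin 4,
    (∏ n, restrict (gInv (i n) (l n))) * (conjS (u i) * v l)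

theorem fiberForm_add_left (k : ℕ) (u u' v : TensorS k) :
    fiberForm k (u + u') v = fiberForm k u v + fiberForm k u' v := by
  simp only [fiberForm, Pi.add_apply, conjS_add, add_mul, mul_add, Finset.sum_add_distrib, smul_add]

theorem fiberForm_add_right (k : ℕ) (u v v' : TensorS k) :
    fiberForm k u (v + v') = fiberForm k u v + fiberForm k u v' := by
  simp only [fiberForm, Pi.add_apply, mul_add, Finset.sum_add_distrib, smul_add]

theorem fiberForm_smul_left (k : ℕ) (c : ℂ) (u v : TensorS k) :
    fiberForm k (c • u) v = conj c • fiberForm k u v := by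
  simp only [fiberForm, Pi.smul_apply, conjS_smul, smul_mul_assoc, mul_smul_comm,
    ← Finset.smul_sum]
  rw [smul_comm]

theorem fiberForm_smul_right (k : ℕ) (c : ℂ) (u v : TensorS k) :
    fiberForm k u (c • v) = c • fiberForm k u v := by
  simp only [fiberForm, Pi.smul_apply, mul_smul_comm, ← Finset.smul_sum]
  rw [smul_comm]

/-- The charge of `D_k`: the Hermitian form
`conj f · q_k f' = ∫_Σ ((f₀|f'₁)_{V_k} + (f₁|f'₀)_{V_k}) dvol_h` on Cauchy data. -/
def charge (k : ℕ) : Data k →ₗ⋆[ℂ] Data k →ₗ[ℂ] ℂ :=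
  LinearMap.mk₂'ₛₗ (starRingEnd ℂ) (RingHom.id ℂ)
    (fun f f' => integralS (fiberForm k f.1 f'.2 + fiberForm k f.2 f'.1))
    (fun f₁ f₂ f' => by
      simp only [Prod.fst_add, Prod.snd_add, fiberForm_add_left, map_add]; abel)
    (fun c f f' => by
      simp only [Prod.smul_fst, Prod.smul_snd, fiberForm_smul_left, map_add, map_smul, smul_add])
    (fun f f₁ f₂ => by
      simp only [Prod.fst_add, Prod.snd_add, fiberForm_add_right, map_add]; abel)
    (fun c f f' => by
      simp only [Prod.smul_fst, Prod.smul_snd, fiberForm_smul_right, map_add, map_smul, smul_add,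
        RingHom.id_apply])

/-- `I_Σ = ρ_2 I U_2`, which is trace reversal on both components of the Cauchy data. -/
def ISigma : Data 2 →ₗ[ℂ] Data 2 :=
  LinearMap.prodMap
    (traceReversal (fun a b => restrict (g a b)) (fun a b => restrict (gInv a b)))
    (traceReversal (fun a b => restrict (g a b)) (fun a b => restrict (gInv a b)))

/-- The physical charge `q_{I,2} = q_2 ∘ I_Σ`. -/
def physicalCharge : Data 2 →ₗ⋆[ℂ] Data 2 →ₗ[ℂ] ℂ := (charge 2).compl₂ ISigma

/-- The kernel of the restriction to `E` of a sesquilinear form `q`, as a subspace of `E`. -/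
def kerRestrict {X : Type} [AddCommGroup X] [Module ℂ X] (q : X →ₗ⋆[ℂ] X →ₗ[ℂ] ℂ)
    (E : Submodule ℂ X) : Submodule ℂ X where
  carrier := {f | f ∈ E ∧ ∀ f' ∈ E, q f' f = 0}
  add_mem' hf hh := ⟨E.add_mem hf.1 hh.1, fun f' hf' => by
    rw [map_add, hf.2 f' hf', hh.2 f' hf', add_zero]⟩
  zero_mem' := ⟨E.zero_mem, fun _ _ => map_zero _⟩
  smul_mem' c f hf := ⟨E.smul_mem c hf.1, fun f' hf' => by
    rw [map_smul, hf.2 f' hf', smul_zero]⟩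

end DeSitter

end

noncomputable section

namespace DeSitter

open scoped Manifold ContDiff ComplexConjugate
open MeasureTheory

/-! ### Smooth functions and ambient extensions -/

/-! Membership in `ETT` and `FTT` is first turned into a statement about solutions on spacetime. If
`D_2 u = 0`, then the divergence and the trace of `u` satisfy homogeneous wave equations (`d1_div2`,
`tr2_d2`), so once their Cauchy data vanish they vanish identically, by the energy estimate
`wave_unique`. Hence `ETT` is the set of data of transverse traceless solutions (`mem_ETT_iff`), and
`FTT` the set of data of trace-free Lie derivatives `lie w` with `d1 w = 0` (`mem_FTT_iff`). The
operators are graphs and all test solutions are explicit, so no existence theorem for the Cauchy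
problem is needed.

Pure gauge is null: the symplectic current of a transverse traceless solution and `lie w` is the
divergence of an antisymmetric superpotential (`cur_lie`). Its normal component on the closed slice
is a spatial divergence and integrates to zero.

Conversely, let `u` be a transverse traceless solution whose charge against all of `ETT` vanishes.
It is tested on the waves `a(t) p`, where `p` is a transverse traceless eigentensor of the curl of
the three-sphere with eigenvalue `c`. The amplitudes are elementary functions of conformal time, and
two of them have Cauchy data `(0, 1 - c²)` and `(c, 0)`. With `h` the induced metric perturbation
and `K` the perturbed second fundamental form (`sff`), this gives `(c² - 1)⟨p, h⟩ = 0` and `c⟨p, K⟩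
= 0`. Bringing `u` into synchronous gauge shows that `h` and `K` satisfy the linearized Hamiltonian
and momentum constraints. By these constraints the curl of `K`, and a second order expression in
`h`, are themselves transverse traceless. Their pairings with `p` are exactly `c⟨p, K⟩` and `(c² -
1)⟨p, h⟩`, so both vanish by completeness of the eigentensors (`tt_complete`), and nothing has to be
known about the spectrum. Completeness comes from spherical polynomials: those of bounded degree
form finite dimensional spaces invariant under the frame, and together they are dense.

A curl-free `K` is `Hess f + f g` (`exists_hessian`), and vanishing of the expression in `h` makes
`h` a symmetrized gradient of some `x` (`exists_killing_potential`). Both are integrated by the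
Poincaré lemma `exists_potential` on the three-sphere. The potentials `f` and `x` are initial data
for a vector field `w` such that `u - lie w` is synchronous with vanishing Cauchy data. The field
equations then force this remainder to vanish and `d1 w = 0` (`IsSyncGauge.eq_lie`), so `u` is pure
gauge.

Since the charge is Hermitian on `ETT`, nullity in one argument is nullity in the other, and the
form descends to a nondegenerate form on the quotient. -/

@[ext] theorem SmoothM.ext {f h : SmoothM} (H : ∀ p, f.1 p = h.1 p) : f = h :=
  Subtype.ext (funext H)

@[ext] theorem SmoothS.ext {f h : SmoothS} (H : ∀ p, f.1 p = h.1 p) : f = h :=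
  Subtype.ext (funext H)

@[simp] theorem SmoothM.add_apply (f h : SmoothM) (p : Spacetime) : (f + h).1 p = f.1 p + h.1 p := rfl
@[simp] theorem SmoothM.sub_apply (f h : SmoothM) (p : Spacetime) : (f - h).1 p = f.1 p - h.1 p := rfl
@[simp] theorem SmoothM.neg_apply (f : SmoothM) (p : Spacetime) : (-f).1 p = -f.1 p := rfl
@[simp] theorem SmoothM.mul_apply (f h : SmoothM) (p : Spacetime) : (f * h).1 p = f.1 p * h.1 p := rfl
@[simp] theorem SmoothM.smul_apply (c : ℂ) (h : SmoothM) (p : Spacetime) :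
    (c • h).1 p = c * h.1 p := rfl
@[simp] theorem SmoothM.zero_apply (p : Spacetime) : (0 : SmoothM).1 p = 0 := rfl
@[simp] theorem SmoothM.one_apply (p : Spacetime) : (1 : SmoothM).1 p = 1 := rfl
@[simp] theorem SmoothS.add_apply (f h : SmoothS) (p : S3) : (f + h).1 p = f.1 p + h.1 p := rfl
@[simp] theorem SmoothS.sub_apply (f h : SmoothS) (p : S3) : (f - h).1 p = f.1 p - h.1 p := rfl
@[simp] theorem SmoothS.neg_apply (f : SmoothS) (p : S3) : (-f).1 p = -f.1 p := rfl
@[simp] theorem SmoothS.mul_apply (f h : SmoothS) (p : S3) : (f * h).1 p = f.1 p * h.1 p := rfl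
@[simp] theorem SmoothS.smul_apply (c : ℂ) (h : SmoothS) (p : S3) :
    (c • h).1 p = c * h.1 p := rfl
@[simp] theorem SmoothS.zero_apply (p : S3) : (0 : SmoothS).1 p = 0 := rfl
@[simp] theorem SmoothS.one_apply (p : S3) : (1 : SmoothS).1 p = 1 := rfl
@[simp] theorem restrict_apply (f : SmoothM) (y : S3) : (restrict f).1 y = f.1 (0, y) := rfl

/-- The smooth function on spacetime induced by an ambient smooth function. -/
def ofExt (F : ℝ × E4 → ℂ) (hF : ContDiff ℝ ∞ F) : SmoothM :=
  ⟨fun p => F (p.1, p.2), hF.contMDiff.comp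
    (contMDiff_fst.prodMk_space (contMDiff_coe_sphere.comp contMDiff_snd))⟩

@[simp] theorem ofExt_apply (F : ℝ × E4 → ℂ) (hF : ContDiff ℝ ∞ F) (p : Spacetime) :
    (ofExt F hF).1 p = F (p.1, p.2) := rfl

/-- Composing with the radial projection `y ↦ y/‖y‖` extends `f` smoothly off the axis `y = 0`, and
a radial cutoff removes the axis. Frame derivatives thereby become ordinary Fréchet derivatives
along linear vector fields. -/
theorem exists_ofExt (f : SmoothM) : ∃ F hF, f = ofExt F hF := by
  classical
  let U : TopologicalSpace.Opens (ℝ × E4) := ⟨{p | p.2 ≠ 0}, isOpen_ne.preimage continuous_snd⟩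
  have hn : ∀ p : U, ‖p.1.2‖⁻¹ • p.1.2 ∈ Metric.sphere (0 : E4) 1 := fun p => by
    have : ‖p.1.2‖ ≠ 0 := norm_ne_zero_iff.2 p.2
    rw [mem_sphere_zero_iff_norm, norm_smul, norm_inv, norm_norm, inv_mul_cancel₀ this]
  have hs : ContMDiff 𝓘(ℝ, ℝ × E4) 𝓘(ℝ, E4) ∞ (fun p : U => ‖p.1.2‖⁻¹ • p.1.2) := by
    intro p
    refine (contMDiffAt_subtype_iff (f := fun p : ℝ × E4 => ‖p.2‖⁻¹ • p.2)).2 ?_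
    refine ContDiffAt.contMDiffAt ?_
    have h0 : ContDiffAt ℝ ∞ (fun p : ℝ × E4 => ‖p.2‖) p.1 :=
      ContDiffAt.norm ℝ contDiffAt_snd p.2
    exact (h0.inv (norm_ne_zero_iff.2 p.2)).smul contDiffAt_snd
  have hs' := ContMDiff.codRestrict_sphere (n := 3) hs hn
  have ht : ContMDiff 𝓘(ℝ, ℝ × E4) 𝓘(ℝ, ℝ) ∞ (fun p : U => p.1.1) := fun p =>
    (contMDiffAt_subtype_iff (f := fun p : ℝ × E4 => p.1)).2 contDiffAt_fst.contMDiffAt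
  have hG := f.2.comp (ht.prodMk hs')
  let G : ℝ × E4 → ℂ := fun p => if h : p.2 ≠ 0 then f.1 (p.1, ⟨‖p.2‖⁻¹ • p.2, hn ⟨p, h⟩⟩) else 0
  have hG' : ∀ p : ℝ × E4, p.2 ≠ 0 → ContDiffAt ℝ ∞ G p := fun p hp => by
    rw [← contMDiffAt_iff_contDiffAt]
    refine (contMDiffAt_subtype_iff (U := U) (x := ⟨p, hp⟩) (f := G)).1 ?_
    convert hG ⟨p, hp⟩ using 2 with q
    simp only [G, Function.comp]
    exact dif_pos q.2
  -- This cutoff is 1 on the unit sphere and vanishes where `‖y‖² ≤ 1/2`.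
  let ψ : ℝ × E4 → ℝ := fun p => Real.smoothTransition (2 * ‖p.2‖ ^ 2 - 1)
  have hψ : ContDiff ℝ ∞ ψ := Real.smoothTransition.contDiff.comp
    ((contDiff_const.mul (contDiff_snd.norm_sq ℝ)).sub contDiff_const)
  refine ⟨fun p => (ψ p : ℂ) * G p, ?_, ?_⟩
  · rw [contDiff_iff_contDiffAt]
    intro p
    by_cases hp : p.2 = 0
    · have : (fun p => (ψ p : ℂ) * G p) =ᶠ[nhds p] fun _ => 0 := by
        have hc : Continuous fun p : ℝ × E4 => 2 * ‖p.2‖ ^ 2 - 1 := by fun_prop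
        have : ∀ᶠ q in nhds p, 2 * ‖q.2‖ ^ 2 - 1 < 0 :=
          hc.continuousAt.eventually_lt_const (by simp [hp])
        filter_upwards [this] with q hq
        simp [ψ, Real.smoothTransition.zero_of_nonpos hq.le]
      exact contDiffAt_const.congr_of_eventuallyEq this
    · exact (Complex.ofRealCLM.contDiff.comp hψ).contDiffAt.mul (hG' p hp)
  · ext p
    have h1 : ‖(p.2 : E4)‖ = 1 := norm_eq_of_mem_sphere p.2
    have h0 : (p.2 : E4) ≠ 0 := fun h => by simp [h] at h1
    have h2 : ψ (p.1, p.2) = 1 := by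
      simp only [ψ, h1]; norm_num
    simp [h2, G, h0, h1]

/-- The frame vector fields as linear vector fields on the ambient space. -/
def fvec (a : Fin 4) (y : E4) : ℝ × E4 := Fin.cases (1, 0) (fun i => (0, J i y)) a

theorem hasDerivAt_flow (a : Fin 4) (p : Spacetime) :
    HasDerivAt (fun θ : ℝ => (((flow a θ p).1, ((flow a θ p).2 : E4)) : ℝ × E4))
      (fvec a p.2) 0 := by
  refine Fin.cases ?_ (fun i => ?_) a
  · exact ((hasDerivAt_id (0 : ℝ)).const_add p.1).prodMk (hasDerivAt_const _ (p.2 : E4))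
  · refine (hasDerivAt_const _ _).prodMk ?_
    have h := ((Real.hasDerivAt_cos 0).smul_const (p.2 : E4)).add
      ((Real.hasDerivAt_sin 0).smul_const (J i (p.2 : E4)))
    have h' : HasDerivAt (fun θ : ℝ => Real.cos θ • (p.2 : E4) + Real.sin θ • J i (p.2 : E4))
        (J i (p.2 : E4)) 0 := h.congr_deriv (by simp)
    exact h'

theorem flow_zero (a : Fin 4) (p : Spacetime) : flow a 0 p = p := by
  refine Fin.cases ?_ (fun i => ?_) a
  · exact Prod.ext (add_zero _) rfl
  · refine Prod.ext rfl (Subtype.ext ?_)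
    simp [flow, rot]

theorem e_ofExt_apply (a : Fin 4) (F : ℝ × E4 → ℂ) (hF : ContDiff ℝ ∞ F) (p : Spacetime) :
    (e a (ofExt F hF)).1 p = fderiv ℝ F (p.1, p.2) (fvec a p.2) := by
  have h1 := hasDerivAt_flow a p
  have h2 : HasFDerivAt F (fderiv ℝ F (p.1, p.2)) ((flow a 0 p).1, ((flow a 0 p).2 : E4)) := by
    rw [flow_zero]
    exact (hF.differentiable (by simp) _).hasFDerivAt
  exact (h2.comp_hasDerivAt (0 : ℝ) h1).deriv

theorem contDiff_fvec (a : Fin 4) : ContDiff ℝ ∞ (fun x : ℝ × E4 => fvec a x.2) := by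
  refine Fin.cases ?_ (fun i => ?_) a
  · exact contDiff_const
  · exact contDiff_const.prodMk ((J i).contDiff.comp contDiff_snd)

theorem contDiff_frame (a : Fin 4) {F : ℝ × E4 → ℂ} (hF : ContDiff ℝ ∞ F) :
    ContDiff ℝ ∞ (fun x : ℝ × E4 => fderiv ℝ F x (fvec a x.2)) :=
  (hF.fderiv_right (by simp)).clm_apply (contDiff_fvec a)

theorem e_ofExt (a : Fin 4) (F : ℝ × E4 → ℂ) (hF : ContDiff ℝ ∞ F) :
    e a (ofExt F hF) = ofExt _ (contDiff_frame a hF) :=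
  SmoothM.ext fun p => e_ofExt_apply a F hF p

theorem e_mul (a : Fin 4) (f h : SmoothM) : e a (f * h) = e a f * h + f * e a h := by
  ext p
  have h1 := differentiable_flow a f p 0
  have h2 := differentiable_flow a h p 0
  have h3 := deriv_mul h1 h2
  simp only [flow_zero] at h3
  exact h3

theorem e_one (a : Fin 4) : e a 1 = 0 := by
  have := e_mul a 1 1
  simpa using this

/-- The derivative of the frame vector field `e b` along `e a` in the ambient space. -/
def dfvec (a b : Fin 4) (y : E4) : ℝ × E4 :=
  Fin.cases (0, 0) (fun j => (0, J j (fvec a y).2)) b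

theorem hasFDerivAt_fvec (a b : Fin 4) (x : ℝ × E4) :
    fderiv ℝ (fun x : ℝ × E4 => fvec b x.2) x (fvec a x.2) = dfvec a b x.2 := by
  refine Fin.cases ?_ (fun j => ?_) b
  · have : (fun x : ℝ × E4 => fvec 0 x.2) = fun _ => ((1, 0) : ℝ × E4) := rfl
    rw [this, fderiv_const_apply]; rfl
  · have : HasFDerivAt (fun x : ℝ × E4 => fvec j.succ x.2)
      ((0 : ℝ × E4 →L[ℝ] ℝ).prod ((J j).comp (ContinuousLinearMap.snd ℝ ℝ E4))) x :=
      (hasFDerivAt_const _ _).prodMk ((J j).hasFDerivAt.comp x hasFDerivAt_snd)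
    rw [this.fderiv]; rfl

theorem dfvec_comm (a b : Fin 4) (y : E4) :
    dfvec a b y - dfvec b a y = ∑ d, (bracket a b d).re • fvec d y := by
  refine Fin.cases ?_ (fun i => ?_) a <;> refine Fin.cases ?_ (fun j => ?_) b
  · simp [dfvec, bracket]
  · simp [dfvec, bracket, fvec]
  · simp [dfvec, bracket, fvec]
  · have h := bracket_J i j y
    rw [Fin.sum_univ_succ]
    have h0 : bracket i.succ j.succ 0 = 0 := by fin_cases i <;> fin_cases j <;> simp [bracket]
    rw [h0]
    refine Prod.ext ?_ ?_
    · simp [dfvec, fvec, Prod.fst_sum]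
    · simp [dfvec, fvec, Prod.snd_sum, h]

theorem bracket_ofReal (a b d : Fin 4) : ((bracket a b d).re : ℂ) = bracket a b d := by
  unfold bracket; split_ifs <;> simp

/-- The second derivative of an ambient extension is symmetric and cancels. What remains is the
derivative of one linear field along the other, that is, the commutators of the matrices `J i`. -/
theorem e_comm (a b : Fin 4) (f : SmoothM) :
    e a (e b f) - e b (e a f) = ∑ d, bracket a b d • e d f := by
  obtain ⟨F, hF, rfl⟩ := exists_ofExt f
  have hF2 : ContDiff ℝ ∞ (fderiv ℝ F) := hF.fderiv_right (by simp)
  have key : ∀ a b (p : Spacetime), (e a (e b (ofExt F hF))).1 p =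
      fderiv ℝ (fderiv ℝ F) (p.1, p.2) (fvec a p.2) (fvec b p.2)
        + fderiv ℝ F (p.1, p.2) (dfvec a b p.2) := by
    intro a b p
    rw [e_ofExt, e_ofExt_apply]
    rw [fderiv_clm_apply (hF2.differentiable (by simp) _)
      ((contDiff_fvec b).differentiable (by simp) _)]
    have := hasFDerivAt_fvec a b (p.1, p.2)
    simp only at this
    simp [this, add_comm]
  ext p
  have hsymm : IsSymmSndFDerivAt ℝ F (p.1, (p.2 : E4)) :=
    hF.contDiffAt.isSymmSndFDerivAt (by simp [minSmoothness_of_isRCLikeNormedField]; exact WithTop.coe_le_coe.2 (le_top (a := (2 : ℕ∞))))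
  have hs : (∑ d, bracket a b d • e d (ofExt F hF)).1 p
      = ∑ d, bracket a b d * (e d (ofExt F hF)).1 p := by
    simp [Fin.sum_univ_four]
  rw [SmoothM.sub_apply, key, key, hsymm.eq, hs, add_sub_add_left_eq_sub, ← map_sub, dfvec_comm,
    map_sum]
  refine Finset.sum_congr rfl fun d _ => ?_
  rw [e_ofExt_apply, map_smul, Complex.real_smul, bracket_ofReal]

/-! ### Flows, restriction to the Cauchy surface and time integration -/

theorem J_J (i : Fin 3) (y : E4) : J i (J i y) = -y := by
  fin_cases i <;> ext l <;> fin_cases l <;>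
    simp [J, Fin.sum_univ_four, Matrix.mulVec, dotProduct]

theorem rot_add (i : Fin 3) (θ s : ℝ) (y : S3) : rot i (θ + s) y = rot i s (rot i θ y) := by
  refine Subtype.ext ?_
  simp only [rot, map_add, map_smul, J_J, Real.cos_add, Real.sin_add]
  module

theorem flow_add (a : Fin 4) (θ s : ℝ) (p : Spacetime) :
    flow a (θ + s) p = flow a s (flow a θ p) := by
  refine Fin.cases ?_ (fun i => ?_) a
  · exact Prod.ext (add_assoc _ _ _).symm rfl
  · exact Prod.ext rfl (rot_add i θ s p.2)

theorem hasDerivAt_comp_flow (a : Fin 4) (f : SmoothM) (p : Spacetime) (θ : ℝ) :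
    HasDerivAt (fun θ : ℝ => f.1 (flow a θ p)) ((e a f).1 (flow a θ p)) θ := by
  have h := (differentiable_flow a f (flow a θ p) 0).hasDerivAt
  have h3 := HasDerivAt.comp_sub_const (x := θ) (a := θ) (f := fun s : ℝ => f.1 (flow a s (flow a θ p)))
    (f' := (e a f).1 (flow a θ p)) (by rw [sub_self]; exact h)
  refine h3.congr_of_eventuallyEq (Filter.Eventually.of_forall fun s => ?_)
  change f.1 (flow a s p) = f.1 (flow a (s - θ) (flow a θ p))
  rw [← flow_add, add_sub_cancel]

theorem SmoothM.continuous (f : SmoothM) : Continuous f.1 := ContMDiff.continuous f.2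

theorem SmoothS.continuous (f : SmoothS) : Continuous f.1 := ContMDiff.continuous f.2

theorem continuous_flow (a : Fin 4) (t : ℝ) :
    Continuous fun q : ℝ × S3 => flow a q.1 (t, q.2) :=
  (contMDiff_flow a).continuous.comp (f := fun q : ℝ × S3 => (((t, q.2) : Spacetime), q.1))
    (by fun_prop)

/-- The surface measure of the three-sphere. -/
abbrev σ3 : Measure S3 := (volume : Measure E4).toSphere

theorem hasDerivAt_integral_flow (a : Fin 4) (f : SmoothM) (t θ : ℝ) :
    HasDerivAt (fun θ : ℝ => ∫ y, f.1 (flow a θ (t, y)) ∂σ3)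
      (∫ y, (e a f).1 (flow a θ (t, y)) ∂σ3) θ := by
  have hc : ∀ (h : SmoothM) (s : ℝ), Continuous fun y : S3 => h.1 (flow a s (t, y)) := fun h s =>
    (h.continuous.comp (continuous_flow a t)).comp (by fun_prop : Continuous fun y : S3 => (s, y))
  obtain ⟨M, hM⟩ := ((isCompact_Icc (a := θ - 1) (b := θ + 1)).prod
    (isCompact_univ : IsCompact (Set.univ : Set S3))).exists_bound_of_continuousOn
    ((e a f).continuous.comp (continuous_flow a t)).continuousOn
  refine (hasDerivAt_integral_of_dominated_loc_of_deriv_le (bound := fun _ => M)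
    (Icc_mem_nhds (by linarith : θ - 1 < θ) (by linarith : θ < θ + 1))
    (Filter.Eventually.of_forall fun s => (hc f s).aestronglyMeasurable)
    ((hc f θ).integrable_of_hasCompactSupport (HasCompactSupport.of_compactSpace _))
    (hc (e a f) θ).aestronglyMeasurable
    (Filter.Eventually.of_forall fun y s hs => hM (s, y) ⟨hs, trivial⟩)
    (integrable_const M)
    (Filter.Eventually.of_forall fun y s _ => hasDerivAt_comp_flow a f (t, y) s)).2

theorem hasDerivAt_time (f : SmoothM) (y : S3) (t : ℝ) :
    HasDerivAt (fun t : ℝ => f.1 (t, y)) ((e 0 f).1 (t, y)) t := by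
  have h := hasDerivAt_comp_flow 0 f (0, y) t
  have hf : ∀ s : ℝ, flow 0 s (0, y) = (s, y) := fun s => Prod.ext (zero_add s) rfl
  simpa only [hf] using h

theorem hasDerivAt_integral_time (f : SmoothM) (t : ℝ) :
    HasDerivAt (fun t : ℝ => ∫ y, f.1 (t, y) ∂σ3) (∫ y, (e 0 f).1 (t, y) ∂σ3) t := by
  have h := hasDerivAt_integral_flow 0 f 0 t
  have hf : ∀ (s : ℝ) (y : S3), flow 0 s (0, y) = (s, y) := fun s y => Prod.ext (zero_add s) rfl
  simpa only [hf] using h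

theorem eq_zero_of_e_zero {f : SmoothM} (h : e 0 f = 0) (h0 : restrict f = 0) : f = 0 := by
  ext ⟨t, y⟩
  have h1 : ∀ s, HasDerivAt (fun t : ℝ => f.1 (t, y)) 0 s := fun s => by
    have := hasDerivAt_time f y s
    rwa [h] at this
  have h2 := is_const_of_deriv_eq_zero (fun s => (h1 s).differentiableAt) (fun s => (h1 s).deriv) t 0
  have h3 : (restrict f).1 y = 0 := by rw [h0]; rfl
  exact h2.trans h3

/-- The linear isometry underlying `rot`. -/
def rotL (i : Fin 3) (θ : ℝ) : E4 ≃ₗᵢ[ℝ] E4 :=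
  LinearIsometry.toLinearIsometryEquiv
    { toLinearMap := Real.cos θ • LinearMap.id + Real.sin θ • (J i : E4 →ₗ[ℝ] E4)
      norm_map' := fun y => by
        have hJ : ‖J i y‖ ^ 2 = ‖y‖ ^ 2 := by
          have h := inner_J_J i i y
          rwa [real_inner_self_eq_norm_sq, if_pos rfl] at h
        have h : ‖Real.cos θ • y + Real.sin θ • J i y‖ ^ 2 = ‖y‖ ^ 2 := by
          rw [norm_add_sq_real, inner_smul_left, inner_smul_right, inner_J_self, norm_smul,
            norm_smul, mul_pow, mul_pow, hJ]
          simp only [Real.norm_eq_abs, sq_abs, mul_zero, add_zero]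
          rw [← add_mul, Real.cos_sq_add_sin_sq, one_mul]
        exact (pow_left_inj₀ (norm_nonneg _) (norm_nonneg _) two_ne_zero).1 h } rfl

theorem continuous_rot (i : Fin 3) (θ : ℝ) : Continuous (rot i θ) :=
  Continuous.subtype_mk (by fun_prop) _

-- The surface measure of a set is defined through the volume of the cone over it, and `rot` is the
-- restriction of a linear isometry, which preserves that volume.
open scoped Pointwise in
theorem measurePreserving_rot (i : Fin 3) (θ : ℝ) : MeasurePreserving (rot i θ) σ3 σ3 := by
  have hm := (continuous_rot i θ).measurable
  refine ⟨hm, Measure.ext fun s hs => ?_⟩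
  rw [Measure.map_apply hm hs, Measure.toSphere_apply' _ hs, Measure.toSphere_apply' _ (hm hs)]
  congr 1
  have h2 := (rotL i θ).measurePreserving
  have h3 : (Set.Ioo (0 : ℝ) 1 • (Subtype.val '' (rot i θ ⁻¹' s)) : Set E4)
      = rotL i θ ⁻¹' (Set.Ioo (0 : ℝ) 1 • (Subtype.val '' s)) := by
    ext x
    simp only [Set.mem_smul, Set.mem_image, Set.mem_preimage]
    constructor
    · rintro ⟨r, hr, _, ⟨y, hy, rfl⟩, rfl⟩
      exact ⟨r, hr, _, ⟨_, hy, rfl⟩, (map_smul (rotL i θ) r (y : E4)).symm⟩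
    · rintro ⟨r, hr, _, ⟨y, hy, rfl⟩, h⟩
      have hy2 : rot i θ (rot i (-θ) y) = y := by
        rw [← rot_add, neg_add_cancel]; exact Subtype.ext (by simp [rot])
      refine ⟨r, hr, _, ⟨rot i (-θ) y, ?_, rfl⟩, ?_⟩
      · change rot i θ (rot i (-θ) y) ∈ s
        rwa [hy2]
      · apply (rotL i θ).injective
        rw [← h, map_smul]
        congr 1
        exact congrArg Subtype.val hy2
  rw [h3]
  exact h2.measure_preimage_emb (rotL i θ).toHomeomorph.measurableEmbedding _

/-! ### Functions on the Cauchy surface and integration by parts -/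

/-- Extension of a function on the Cauchy surface, constant in time. -/
def lift : SmoothS →ₐ[ℂ] SmoothM where
  toFun f := ⟨fun p => f.1 p.2, ContMDiff.comp f.2 contMDiff_snd⟩
  map_one' := rfl
  map_mul' _ _ := rfl
  map_zero' := rfl
  map_add' _ _ := rfl
  commutes' _ := rfl

@[simp] theorem restrict_lift (f : SmoothS) : restrict (lift f) = f := rfl

/-- The left invariant frame of the sphere as derivations of smooth functions. -/
def eS (i : Fin 3) : SmoothS →ₗ[ℂ] SmoothS :=
  restrict.toLinearMap ∘ₗ e i.succ ∘ₗ lift.toLinearMap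

theorem restrict_e (i : Fin 3) (f : SmoothM) : restrict (e i.succ f) = eS i (restrict f) := rfl

theorem e_lift (i : Fin 3) (f : SmoothS) : e i.succ (lift f) = lift (eS i f) := rfl

theorem e_zero_lift (f : SmoothS) : e 0 (lift f) = 0 := by
  ext p
  exact deriv_const (0 : ℝ) (f.1 p.2)

theorem eS_mul (i : Fin 3) (f h : SmoothS) : eS i (f * h) = eS i f * h + f * eS i h := by
  have := congrArg restrict (e_mul i.succ (lift f) (lift h))
  rwa [← map_mul lift] at this

theorem bracket_zero_right (a b : Fin 4) : bracket a b 0 = 0 := by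
  fin_cases a <;> fin_cases b <;> simp [bracket]

theorem eS_comm (i j : Fin 3) (f : SmoothS) :
    eS i (eS j f) - eS j (eS i f) = ∑ k : Fin 3, bracket i.succ j.succ k.succ • eS k f := by
  have := congrArg restrict (e_comm i.succ j.succ (lift f))
  rw [Fin.sum_univ_succ, bracket_zero_right, zero_smul, zero_add, map_sub, map_sum] at this
  exact this

/-- The flow preserves the measure, so the integral of `f` along the flow is constant and its
derivative at zero vanishes. Consequently each frame field is skew-adjoint. -/
theorem integralS_eS (i : Fin 3) (f : SmoothS) : integralS (eS i f) = 0 := by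
  have h1 := hasDerivAt_integral_flow i.succ (lift f) 0 0
  have h2 : (fun θ : ℝ => ∫ y, (lift f).1 (flow i.succ θ (0, y)) ∂σ3)
      = fun _ => ∫ y, f.1 y ∂σ3 := by
    funext θ
    have hm : MeasurableEmbedding (rot i θ) := (Homeomorph.mk (Equiv.mk (rot i θ) (rot i (-θ))
      (fun y => by rw [← rot_add, add_neg_cancel]; exact Subtype.ext (by simp [rot]))
      (fun y => by rw [← rot_add, neg_add_cancel]; exact Subtype.ext (by simp [rot])))
      (continuous_rot i θ) (continuous_rot i (-θ))).measurableEmbedding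
    exact (measurePreserving_rot i θ).integral_comp hm f.1
  rw [h2] at h1
  have h3 := h1.unique (hasDerivAt_const _ _)
  simp only [flow_zero] at h3
  exact h3

theorem integralS_mul_eS (i : Fin 3) (f h : SmoothS) :
    integralS (f * eS i h) = -integralS (eS i f * h) := by
  have := integralS_eS i (f * h)
  rw [eS_mul, map_add] at this
  exact eq_neg_of_add_eq_zero_right this

theorem eq_zero_of_integralS_sq {f : SmoothS} (h : integralS (conjS f * f) = 0) : f = 0 := by
  have h1 : ∀ y, (conjS f * f).1 y = ((‖f.1 y‖ ^ 2 : ℝ) : ℂ) := fun y => by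
    change conj (f.1 y) * f.1 y = _
    rw [Complex.conj_mul']; push_cast; rfl
  have h2 : ∫ y, ‖f.1 y‖ ^ 2 ∂σ3 = 0 := by
    have : integralS (conjS f * f) = ((∫ y, ‖f.1 y‖ ^ 2 ∂σ3 : ℝ) : ℂ) := by
      rw [← integral_complex_ofReal]
      exact integral_congr_ae (Filter.Eventually.of_forall h1)
    rw [h] at this
    exact_mod_cast this.symm
  have hc : Continuous fun y => ‖f.1 y‖ ^ 2 := f.continuous.norm.pow 2
  rw [integral_eq_zero_iff_of_nonneg (fun y => by positivity)
    (hc.integrable_of_hasCompactSupport (HasCompactSupport.of_compactSpace _))] at h2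
  have h3 := (Continuous.ae_eq_iff_eq σ3 hc continuous_const).1 h2
  ext y
  exact norm_eq_zero.1 (pow_eq_zero_iff two_ne_zero |>.1 (congrFun h3 y))

/-! ### Complex conjugation -/

theorem conjS_mul (f h : SmoothS) : conjS (f * h) = conjS f * conjS h := by
  ext y
  exact map_mul (starRingEnd ℂ) (f.1 y) (h.1 y)

theorem conjS_conjS (f : SmoothS) : conjS (conjS f) = f := by
  ext y
  exact Complex.conj_conj (f.1 y)

theorem integralS_conjS (f : SmoothS) : integralS (conjS f) = conj (integralS f) :=
  integral_conj

/-- Complex conjugation of smooth functions on spacetime. -/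
def conjM : SmoothM →+* SmoothM where
  toFun f := ⟨fun y => conj (f.1 y), Complex.conjCLE.contDiff.contMDiff.comp f.2⟩
  map_one' := by ext p; exact map_one (starRingEnd ℂ)
  map_mul' f h := by ext p; exact map_mul (starRingEnd ℂ) (f.1 p) (h.1 p)
  map_zero' := by ext p; exact map_zero (starRingEnd ℂ)
  map_add' f h := by ext p; exact map_add (starRingEnd ℂ) (f.1 p) (h.1 p)

@[simp] theorem conjM_apply (f : SmoothM) (p : Spacetime) : (conjM f).1 p = conj (f.1 p) := rfl

theorem restrict_conjM (f : SmoothM) : restrict (conjM f) = conjS (restrict f) := rfl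

theorem e_conjM (a : Fin 4) (f : SmoothM) : e a (conjM f) = conjM (e a f) := by
  ext p
  have h := (hasDerivAt_comp_flow a f p 0)
  rw [flow_zero] at h
  have h2 := (Complex.conjCLE.toContinuousLinearMap.hasFDerivAt (x := f.1 (flow a 0 p))).comp_hasDerivAt
    (0 : ℝ) h
  exact h2.deriv

theorem eS_conjS (i : Fin 3) (f : SmoothS) : eS i (conjS f) = conjS (eS i f) :=
  congrArg restrict (e_conjM i.succ (lift f))

/-- Differentiating under the integral sign replaces the integrand by its partial derivative, which
takes values in another space. The induction therefore quantifies over the codomain. -/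
theorem contDiff_parametric_integral_nat {P : Type} [NormedAddCommGroup P] [NormedSpace ℝ P]
    [FiniteDimensional ℝ P] (n : ℕ) : ∀ {E' : Type} [NormedAddCommGroup E'] [NormedSpace ℝ E']
    [CompleteSpace E'] (H : P × ℝ → E'), ContDiff ℝ ∞ H →
    ContDiff ℝ n (fun p => ∫ s in (0 : ℝ)..1, H (p, s)) := by
  induction n with
  | zero =>
    intro E' _ _ _ H hH
    rw [Nat.cast_zero, contDiff_zero]
    exact intervalIntegral.continuous_parametric_intervalIntegral_of_continuous'
      (f := fun p s => H (p, s)) hH.continuous 0 1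
  | succ n ih =>
    intro E' _ _ _ H hH
    let H' : P × ℝ → P →L[ℝ] E' := fun q =>
      (fderiv ℝ H q).comp (ContinuousLinearMap.inl ℝ P ℝ)
    have hH' : ContDiff ℝ ∞ H' := (hH.fderiv_right (by simp)).clm_comp contDiff_const
    have hd : ∀ p s, HasFDerivAt (fun p => H (p, s)) (H' (p, s)) p := fun p s =>
      ((hH.differentiable (by simp) (p, s)).hasFDerivAt).comp p (hasFDerivAt_prodMk_left p s)
    have key : ∀ p, HasFDerivAt (fun p => ∫ s in (0 : ℝ)..1, H (p, s))
        (∫ s in (0 : ℝ)..1, H' (p, s)) p := by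
      intro p
      obtain ⟨M, hM⟩ := ((isCompact_closedBall p 1).prod
        (isCompact_Icc (a := (0 : ℝ)) (b := 1))).exists_bound_of_continuousOn
        hH'.continuous.continuousOn
      have hc : ∀ p, Continuous fun s => H (p, s) := fun p => hH.continuous.comp (by fun_prop)
      have hc' : Continuous fun s => H' (p, s) := hH'.continuous.comp (by fun_prop)
      refine intervalIntegral.hasFDerivAt_integral_of_dominated_of_fderiv_le
        (F' := fun p s => H' (p, s)) (bound := fun _ => M)
        (Metric.closedBall_mem_nhds p one_pos)
        (Filter.Eventually.of_forall fun q => (hc q).aestronglyMeasurable)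
        ((hc p).intervalIntegrable 0 1) hc'.aestronglyMeasurable
        (Filter.Eventually.of_forall fun s hs q hq => hM (q, s) ⟨hq, ?_⟩)
        intervalIntegrable_const
        (Filter.Eventually.of_forall fun s _ q _ => hd q s)
      rw [Set.uIoc_of_le zero_le_one] at hs
      exact ⟨hs.1.le, hs.2⟩
    rw [Nat.cast_succ, contDiff_succ_iff_hasFDerivAt]
    exact ⟨_, ih H' hH', key⟩

/-- Integration in time from the Cauchy surface. -/
def tint (f : SmoothM) : SmoothM :=
  ⟨fun p => ∫ s in (0 : ℝ)..p.1, f.1 (s, p.2), by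
    obtain ⟨F, hF, rfl⟩ := exists_ofExt f
    -- The substitution `s ↦ s t` turns the variable upper limit into the fixed interval `[0, 1]`,
    -- where smooth dependence on parameters applies.
    have h : ContDiff ℝ ∞ fun q : ℝ × E4 => ∫ s in (0 : ℝ)..1, q.1 • F (s * q.1, q.2) := by
      rw [contDiff_infty]
      intro n
      exact contDiff_parametric_integral_nat n
        (fun z : (ℝ × E4) × ℝ => z.1.1 • F (z.2 * z.1.1, z.1.2))
        (contDiff_fst.fst.smul (hF.comp ((contDiff_snd.mul contDiff_fst.fst).prodMk
          contDiff_fst.snd)))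
    have h2 := (ofExt _ h).2
    convert h2 using 2 with p
    simp only [ofExt_apply, intervalIntegral.integral_smul]
    have h3 := intervalIntegral.smul_integral_comp_mul_right (a := 0) (b := 1)
      (fun s => F (s, (p.2 : E4))) p.1
    rw [zero_mul, one_mul] at h3
    exact h3.symm⟩

theorem restrict_tint (f : SmoothM) : restrict (tint f) = 0 := by
  ext y
  exact intervalIntegral.integral_same

theorem e_zero_tint (f : SmoothM) : e 0 (tint f) = f := by
  ext ⟨t, y⟩
  have hc : Continuous fun s : ℝ => f.1 (s, y) := f.continuous.comp (by fun_prop)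
  exact (hasDerivAt_time (tint f) y t).unique
    (intervalIntegral.integral_hasDerivAt_right (hc.intervalIntegrable _ _)
      (hc.stronglyMeasurableAtFilter _ _) hc.continuousAt)

/-! ### Uniqueness for wave equations by the energy method -/

theorem gInv_one_apply (p : Spacetime) : (gInv 1 1).1 p = (((Real.cosh p.1 ^ 2)⁻¹ : ℝ) : ℂ) := rfl

theorem e_succ_gInv_one (i : Fin 3) : e i.succ (gInv 1 1) = 0 := by
  ext p
  exact deriv_const (0 : ℝ) (((Real.cosh p.1 ^ 2)⁻¹ : ℝ) : ℂ)

theorem conjM_gInv_one : conjM (gInv 1 1) = gInv 1 1 := by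
  ext p
  exact Complex.conj_ofReal _

theorem e_zero_e_succ (i : Fin 3) (f : SmoothM) : e 0 (e i.succ f) = e i.succ (e 0 f) := by
  have h := e_comm 0 i.succ f
  have h0 : ∀ d, bracket 0 i.succ d = 0 := fun d => by
    fin_cases i <;> fin_cases d <;> simp [bracket]
  simp only [h0, zero_smul, Finset.sum_const_zero] at h
  exact sub_eq_zero.1 h

/-- Grönwall's inequality forward in time, and backward by reflection. The constant may depend on
`T`, because coefficients on spacetime are bounded only on compact slabs. -/
theorem eq_zero_of_norm_deriv_le {E E' : ℝ → ℂ} (hE : ∀ t, HasDerivAt E (E' t) t)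
    (hb : ∀ T : ℝ, ∃ K, ∀ t ∈ Set.Icc (-T) T, ‖E' t‖ ≤ K * ‖E t‖) (h0 : E 0 = 0) (t : ℝ) :
    E t = 0 := by
  obtain ⟨K, hK⟩ := hb |t|
  rcases le_total 0 t with ht | ht
  · rw [abs_of_nonneg ht] at hK
    have := eq_zero_of_abs_deriv_le_mul_abs_self_of_eq_zero_right (f := E) (f' := E') (K := K)
      (a := 0) (b := t)
      (fun s _ => (hE s).continuousAt.continuousWithinAt)
      (fun s _ => (hE s).hasDerivWithinAt) h0
      (fun s hs => hK s ⟨by linarith [hs.1], hs.2.le⟩)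
    exact this t ⟨ht, le_rfl⟩
  · rw [abs_of_nonpos ht] at hK
    have hE2 : ∀ s : ℝ, HasDerivAt (fun s => E (-s)) (-E' (-s)) s := fun s => by
      exact (HasDerivAt.scomp s (hE (-s)) (hasDerivAt_neg s)).congr_deriv (by simp)
    have := eq_zero_of_abs_deriv_le_mul_abs_self_of_eq_zero_right (f := fun s => E (-s))
      (f' := fun s => -E' (-s)) (K := K) (a := 0) (b := -t)
      (fun s _ => (hE2 s).continuousAt.continuousWithinAt)
      (fun s _ => (hE2 s).hasDerivWithinAt) (by simpa using h0)
      (fun s hs => by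
        rw [norm_neg]
        exact hK (-s) ⟨by linarith [hs.2], by linarith [hs.1]⟩)
    have h2 := this (-t) ⟨by linarith, le_rfl⟩
    simpa using h2

theorem exists_bound_slab (T : ℝ) (f : SmoothM) :
    ∃ M, 0 ≤ M ∧ ∀ t ∈ Set.Icc (-T) T, ∀ y, ‖f.1 (t, y)‖ ≤ M := by
  obtain ⟨M, hM⟩ := ((isCompact_Icc (a := -T) (b := T)).prod
    (isCompact_univ : IsCompact (Set.univ : Set S3))).exists_bound_of_continuousOn
    f.continuous.continuousOn
  exact ⟨max M 0, le_max_right _ _, fun t ht y => (hM (t, y) ⟨ht, trivial⟩).trans (le_max_left _ _)⟩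

theorem exists_bound_slab_family {κ : Type} [Fintype κ] (T : ℝ) (f : κ → SmoothM) :
    ∃ M, 0 ≤ M ∧ ∀ k, ∀ t ∈ Set.Icc (-T) T, ∀ y, ‖(f k).1 (t, y)‖ ≤ M := by
  choose M hM0 hM using fun k => exists_bound_slab T (f k)
  exact ⟨∑ k, M k, Finset.sum_nonneg fun k _ => hM0 k, fun k t ht y => (hM k t ht y).trans
    (Finset.single_le_sum (fun k _ => hM0 k) (Finset.mem_univ k))⟩

theorem SmoothM.sum_apply {κ : Type} (s : Finset κ) (f : κ → SmoothM) (p : Spacetime) :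
    (∑ k ∈ s, f k).1 p = ∑ k ∈ s, (f k).1 p := by
  classical
  induction s using Finset.induction_on with
  | empty => simp
  | insert a s ha ih => rw [Finset.sum_insert ha, Finset.sum_insert ha, SmoothM.add_apply, ih]

section Energy

variable {ι : Type} (w : ι → SmoothM)

/-- A family of functions together with its first frame derivatives. -/
def oneJet : ι ⊕ Fin 4 × ι → SmoothM := Sum.elim w fun q => e q.1 (w q.2)

/-- The ideal of expressions of order at most one in a family of functions. -/
def jetIdeal : Ideal SmoothM := Ideal.span (Set.range (oneJet w))

theorem mem_jetIdeal (I : ι) : w I ∈ jetIdeal w := Ideal.subset_span ⟨Sum.inl I, rfl⟩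

theorem e_mem_jetIdeal (a : Fin 4) (I : ι) : e a (w I) ∈ jetIdeal w :=
  Ideal.subset_span ⟨Sum.inr (a, I), rfl⟩

variable [Fintype ι]

/-- The energy density of a family of functions. -/
def energyDensity : SmoothM := ∑ I, (conjM (w I) * w I + conjM (e 0 (w I)) * e 0 (w I)
  + gInv 1 1 * ∑ i : Fin 3, conjM (e i.succ (w I)) * e i.succ (w I))

/-- The energy density as a real function. -/
def energyReal (p : Spacetime) : ℝ := ∑ I, (‖(w I).1 p‖ ^ 2 + ‖(e 0 (w I)).1 p‖ ^ 2
  + (Real.cosh p.1 ^ 2)⁻¹ * ∑ i : Fin 3, ‖(e i.succ (w I)).1 p‖ ^ 2)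

theorem energyDensity_apply (p : Spacetime) : (energyDensity w).1 p = (energyReal w p : ℂ) := by
  have hc : ∀ f : SmoothM, (conjM f * f).1 p = ((‖f.1 p‖ ^ 2 : ℝ) : ℂ) := fun f => by
    rw [SmoothM.mul_apply, conjM_apply, Complex.conj_mul']; push_cast; rfl
  rw [energyDensity, SmoothM.sum_apply, energyReal, Complex.ofReal_sum]
  refine Finset.sum_congr rfl fun I _ => ?_
  rw [SmoothM.add_apply, SmoothM.add_apply, SmoothM.mul_apply (gInv 1 1), SmoothM.sum_apply, hc, hc,
    gInv_one_apply, Finset.sum_congr rfl fun i _ => hc _]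
  push_cast
  rfl

theorem energyReal_nonneg (p : Spacetime) : 0 ≤ energyReal w p :=
  Finset.sum_nonneg fun I _ => by positivity

/-- On the slab the weight `1/cosh² t` of the spatial derivatives stays above `1/cosh² T`, so the
energy controls all first derivatives uniformly. -/
theorem jet_le_energyReal (T : ℝ) (t : ℝ) (ht : t ∈ Set.Icc (-T) T) (y : S3) :
    (Real.cosh T ^ 2)⁻¹ * ∑ k, ‖(oneJet w k).1 (t, y)‖ ^ 2 ≤ energyReal w (t, y) := by
  have h1 : Real.cosh t ≤ Real.cosh T := by
    rw [Real.cosh_le_cosh, abs_le]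
    have : T ≤ |T| := le_abs_self T
    exact ⟨by linarith [ht.1], by linarith [ht.2]⟩
  have h0 : 0 < Real.cosh t := Real.cosh_pos t
  have h2 : (Real.cosh T ^ 2)⁻¹ ≤ (Real.cosh t ^ 2)⁻¹ := by gcongr
  have h3 : (Real.cosh T ^ 2)⁻¹ ≤ 1 := inv_le_one_of_one_le₀ (one_le_pow₀ (Real.one_le_cosh T))
  have h4 : 0 < (Real.cosh T ^ 2)⁻¹ := by positivity
  rw [Fintype.sum_sum_type, Fintype.sum_prod_type_right, ← Finset.sum_add_distrib, Finset.mul_sum,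
    energyReal]
  refine Finset.sum_le_sum fun I _ => ?_
  simp only [oneJet, Sum.elim_inl, Sum.elim_inr]
  rw [Fin.sum_univ_succ, mul_add, mul_add, ← add_assoc]
  have h5 : 0 ≤ ∑ i : Fin 3, ‖(e i.succ (w I)).1 (t, y)‖ ^ 2 := by positivity
  refine add_le_add (add_le_add ?_ ?_) ?_
  · exact mul_le_of_le_one_left (by positivity) h3
  · exact mul_le_of_le_one_left (by positivity) h3
  · exact mul_le_mul_of_nonneg_right h2 h5

/-- If `w` satisfies a linear system of wave equations with smooth coefficients and has vanishing
Cauchy data, then `w` vanishes. -/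
theorem wave_unique
    (hw : ∀ I, e 0 (e 0 (w I)) - gInv 1 1 * ∑ i : Fin 3, e i.succ (e i.succ (w I)) ∈ jetIdeal w)
    (h0 : ∀ I, restrict (w I) = 0) (h1 : ∀ I, restrict (e 0 (w I)) = 0) (I : ι) : w I = 0 := by
  -- Membership in `jetIdeal` supplies smooth coefficients for the lower order terms. These are all
  -- the estimate has to bound.
  choose c hc using fun I => (Ideal.mem_span_range_iff_exists_fun (R := SmoothM)).1 (hw I)
  let r : ι → SmoothM := fun I => ∑ k, c I k * oneJet w k
  -- The time derivative of the energy density is a spatial divergence, with flux `V`, plus `D`. The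
  -- flux integrates to zero over the sphere, and `D` is quadratic in the first order jet.
  let D : SmoothM := ∑ I, (conjM (w I) * e 0 (w I) + w I * conjM (e 0 (w I))
    + (conjM (e 0 (w I)) * r I + e 0 (w I) * conjM (r I))
    + e 0 (gInv 1 1) * ∑ i : Fin 3, conjM (e i.succ (w I)) * e i.succ (w I))
  let V : Fin 3 → SmoothM := fun i => ∑ I, gInv 1 1 *
    (conjM (e 0 (w I)) * e i.succ (w I) + e 0 (w I) * conjM (e i.succ (w I)))
  have hr : ∀ I, e 0 (e 0 (w I)) = gInv 1 1 * ∑ i : Fin 3, e i.succ (e i.succ (w I)) + r I :=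
    fun I => by rw [← sub_eq_iff_eq_add']; exact (hc I).symm
  have hdiv : e 0 (energyDensity w) = D + ∑ i, e i.succ (V i) := by
    simp only [energyDensity, D, V, map_sum, Fin.sum_univ_three, ← Finset.sum_add_distrib]
    refine Finset.sum_congr rfl fun I _ => ?_
    simp only [map_add, e_mul, e_conjM, e_zero_e_succ, e_succ_gInv_one, hr, Fin.sum_univ_three,
      map_mul, conjM_gInv_one]
    ring
  have hE : ∀ t, HasDerivAt (fun t => ∫ y, (energyDensity w).1 (t, y) ∂σ3)
      (∫ y, D.1 (t, y) ∂σ3) t := fun t => by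
    have h := hasDerivAt_integral_time (energyDensity w) t
    have hi : ∀ f : SmoothM, Integrable (fun y => f.1 (t, y)) σ3 := fun f =>
      (f.continuous.comp (by fun_prop : Continuous fun y : S3 => (t, y))).integrable_of_hasCompactSupport
        (HasCompactSupport.of_compactSpace _)
    have hz : ∀ (i : Fin 3) (f : SmoothM), ∫ y, (e i.succ f).1 (t, y) ∂σ3 = 0 := fun i f => by
      let ft : SmoothS := ⟨fun y => f.1 (t, y), ContMDiff.comp f.2 (contMDiff_const.prodMk contMDiff_id)⟩
      exact integralS_eS i ft
    rw [hdiv] at h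
    have h2 : ∫ y, (D + ∑ i, e i.succ (V i)).1 (t, y) ∂σ3 = ∫ y, D.1 (t, y) ∂σ3 := by
      simp only [SmoothM.add_apply, SmoothM.sum_apply]
      rw [integral_add (hi D) (integrable_finsetSum _ fun i _ => hi _),
        integral_finsetSum _ fun i _ => hi _]
      simp [hz]
    rwa [h2] at h
  have hci : ∀ t, Integrable (fun y => energyReal w (t, y)) σ3 := fun t => by
    have h := ((Complex.continuous_re.comp (energyDensity w).continuous).comp
      (by fun_prop : Continuous fun y : S3 => (t, y))).integrable_of_hasCompactSupport (μ := σ3)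
        (HasCompactSupport.of_compactSpace _)
    convert h using 2 with y
    simp [energyDensity_apply]
  have hEr : ∀ t, ∫ y, (energyDensity w).1 (t, y) ∂σ3 = ((∫ y, energyReal w (t, y) ∂σ3 : ℝ) : ℂ) :=
    fun t => by simp only [energyDensity_apply]; exact integral_complex_ofReal
  have hb : ∀ T : ℝ, ∃ K, ∀ t ∈ Set.Icc (-T) T, ‖∫ y, D.1 (t, y) ∂σ3‖
      ≤ K * ‖∫ y, (energyDensity w).1 (t, y) ∂σ3‖ := by
    intro T
    obtain ⟨M, hM0, hM⟩ := exists_bound_slab_family T (fun q : ι × (ι ⊕ Fin 4 × ι) => c q.1 q.2)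
    obtain ⟨M', hM0', hM'⟩ := exists_bound_slab T (e 0 (gInv 1 1))
    let n : ℝ := Fintype.card (ι ⊕ Fin 4 × ι)
    -- Per component: 2 from differentiating `|w|²`, `2 M n` from the remainder `r`, and `3 M'` from
    -- the time derivative of the inverse metric in the three spatial directions.
    let K : ℝ := Fintype.card ι * (2 + 2 * (M * n) + M' * 3)
    refine ⟨K * Real.cosh T ^ 2, fun t ht => ?_⟩
    have hpt : ∀ y, ‖D.1 (t, y)‖ ≤ K * Real.cosh T ^ 2 * energyReal w (t, y) := by
      intro y
      let S : ℝ := ∑ k, ‖(oneJet w k).1 (t, y)‖ ^ 2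
      have hS : ∀ k l, ‖(oneJet w k).1 (t, y)‖ * ‖(oneJet w l).1 (t, y)‖ ≤ S := fun k l => by
        have hk : ∀ k, ‖(oneJet w k).1 (t, y)‖ ^ 2 ≤ S := fun k =>
          Finset.single_le_sum (f := fun k => ‖(oneJet w k).1 (t, y)‖ ^ 2)
            (fun k _ => by positivity) (Finset.mem_univ k)
        nlinarith [hk k, hk l, sq_nonneg (‖(oneJet w k).1 (t, y)‖ - ‖(oneJet w l).1 (t, y)‖)]
      have hrI : ∀ I k, ‖(oneJet w k).1 (t, y)‖ * ‖(r I).1 (t, y)‖ ≤ M * n * S := fun I k => by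
        have : ‖(r I).1 (t, y)‖ ≤ ∑ l, M * ‖(oneJet w l).1 (t, y)‖ := by
          simp only [r, SmoothM.sum_apply]
          refine norm_sum_le_of_le _ fun l _ => ?_
          rw [SmoothM.mul_apply, norm_mul]
          exact mul_le_mul_of_nonneg_right (hM (I, l) t ht y) (norm_nonneg _)
        calc _ ≤ ‖(oneJet w k).1 (t, y)‖ * ∑ l, M * ‖(oneJet w l).1 (t, y)‖ :=
              mul_le_mul_of_nonneg_left this (norm_nonneg _)
          _ = ∑ l, M * (‖(oneJet w k).1 (t, y)‖ * ‖(oneJet w l).1 (t, y)‖) := by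
              rw [Finset.mul_sum]; exact Finset.sum_congr rfl fun l _ => by ring
          _ ≤ ∑ l : ι ⊕ Fin 4 × ι, M * S :=
              Finset.sum_le_sum fun l _ => mul_le_mul_of_nonneg_left (hS k l) hM0
          _ = M * n * S := by
              rw [Finset.sum_const, nsmul_eq_mul, Finset.card_univ]; ring
      have hD : ‖D.1 (t, y)‖ ≤ K * S := by
        have h2 : ∀ I ∈ Finset.univ, ‖(conjM (w I) * e 0 (w I) + w I * conjM (e 0 (w I))
            + (conjM (e 0 (w I)) * r I + e 0 (w I) * conjM (r I))
            + e 0 (gInv 1 1) * ∑ i : Fin 3, conjM (e i.succ (w I)) * e i.succ (w I)).1 (t, y)‖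
            ≤ (2 + 2 * (M * n) + M' * 3) * S := by
          intro I _
          have hz := hS (Sum.inl I) (Sum.inr (0, I))
          have hq := hrI I (Sum.inr (0, I))
          have h3 : ∀ i : Fin 3, _ := fun i => hS (Sum.inr (i.succ, I)) (Sum.inr (i.succ, I))
          simp only [oneJet, Sum.elim_inl, Sum.elim_inr] at hz hq h3
          have h4 : ‖∑ i : Fin 3, (conjM (e i.succ (w I)) * e i.succ (w I)).1 (t, y)‖ ≤ 3 * S := by
            refine (norm_sum_le_of_le _ (f := fun i : Fin 3 =>
              (conjM (e i.succ (w I)) * e i.succ (w I)).1 (t, y)) (n := fun _ => S)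
              fun i _ => ?_).trans (by simp)
            simpa [SmoothM.mul_apply] using h3 i
          have h5 := mul_le_mul (hM' t ht y) h4 (norm_nonneg _) hM0'
          simp only [SmoothM.add_apply]
          refine (norm_add₃_le).trans ?_
          refine (add_le_add (add_le_add (norm_add_le _ _) (norm_add_le _ _)) le_rfl).trans ?_
          simp only [SmoothM.mul_apply, conjM_apply, norm_mul, RCLike.norm_conj, SmoothM.sum_apply] at h5 ⊢
          nlinarith
        simp only [D, SmoothM.sum_apply]
        refine (norm_sum_le_of_le _ h2).trans_eq ?_
        rw [Finset.sum_const, nsmul_eq_mul, Finset.card_univ]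
        simp only [K]; ring
      have hj := jet_le_energyReal w T t ht y
      have hT : 0 < Real.cosh T ^ 2 := pow_pos (Real.cosh_pos T) 2
      rw [inv_mul_le_iff₀ hT] at hj
      have hK : 0 ≤ K := by positivity
      calc _ ≤ K * S := hD
        _ ≤ K * (Real.cosh T ^ 2 * energyReal w (t, y)) := mul_le_mul_of_nonneg_left hj hK
        _ = _ := by ring
    have hn : 0 ≤ ∫ y, energyReal w (t, y) ∂σ3 := integral_nonneg fun y => energyReal_nonneg w _
    rw [hEr, Complex.norm_real, Real.norm_of_nonneg hn, ← integral_const_mul]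
    exact norm_integral_le_of_norm_le ((hci t).const_mul _) (Filter.Eventually.of_forall hpt)
  have hz0 : ∀ y, energyReal w (0, y) = 0 := fun y => by
    refine Finset.sum_eq_zero fun I _ => ?_
    have a1 : (w I).1 (0, y) = 0 := congrArg (fun f : SmoothS => f.1 y) (h0 I)
    have a2 : (e 0 (w I)).1 (0, y) = 0 := congrArg (fun f : SmoothS => f.1 y) (h1 I)
    have a3 : ∀ i : Fin 3, (e i.succ (w I)).1 (0, y) = 0 := fun i => by
      have := restrict_e i (w I)
      rw [h0, map_zero] at this
      exact congrArg (fun f : SmoothS => f.1 y) this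
    simp [a1, a2, a3]
  have hE0 := eq_zero_of_norm_deriv_le hE hb (by simp [hEr, hz0])
  ext ⟨t, y⟩
  have h3 := hE0 t
  simp only [hEr] at h3
  have h4 : ∫ y, energyReal w (t, y) ∂σ3 = 0 := by exact_mod_cast h3
  have hcont : Continuous fun y => energyReal w (t, y) := by
    have h := (Complex.continuous_re.comp (energyDensity w).continuous).comp
      (by fun_prop : Continuous fun y : S3 => (t, y))
    convert h using 2 with y
    simp [energyDensity_apply]
  rw [integral_eq_zero_iff_of_nonneg (fun y => energyReal_nonneg w _) (hci t)] at h4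
  have h5 := congrFun ((Continuous.ae_eq_iff_eq σ3 hcont continuous_const).1 h4) y
  have h6 := (Finset.sum_eq_zero_iff_of_nonneg fun I _ => by positivity).1 h5 I (Finset.mem_univ I)
  have h7 : ‖(w I).1 (t, y)‖ ^ 2 ≤ 0 := by
    rw [← h6, add_assoc]
    exact le_add_of_nonneg_right (by positivity)
  have h8 : ‖(w I).1 (t, y)‖ = 0 := by
    have := norm_nonneg ((w I).1 (t, y))
    nlinarith
  exact norm_eq_zero.1 h8

end Energy

/-! ### The Poincaré lemma on the three-sphere -/

/-- The vectors `y` and `J i y` are orthogonal of equal length. The factor `‖y‖²` makes this a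
polynomial identity valid for every `y`. -/
theorem frame_expansion (y v : E4) :
    ‖y‖ ^ 2 • v = (inner ℝ y v : ℝ) • y + ∑ i : Fin 3, (inner ℝ (J i y) v : ℝ) • J i y := by
  ext l
  fin_cases l <;>
    simp [J, EuclideanSpace.real_norm_sq_eq, PiLp.inner_apply, Fin.sum_univ_three, Fin.sum_univ_four, Matrix.mulVec,
      dotProduct] <;> ring

theorem inner_J_J_J (i j k : Fin 3) (y : E4) :
    inner ℝ (J i (J j y)) (J k y) = -(1 / 2) * (bracket i.succ j.succ k.succ).re * ‖y‖ ^ 2 := by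
  fin_cases i <;> fin_cases j <;> fin_cases k <;>
    simp [J, bracket, EuclideanSpace.real_norm_sq_eq, PiLp.inner_apply, Fin.sum_univ_four,
      Matrix.mulVec, dotProduct] <;> ring

/-- The one-form on the ambient space with given components along the frame. -/
def frameForm (A : Fin 3 → E4 → ℂ) (y : E4) : E4 →L[ℝ] ℂ :=
  ∑ i, (innerSL ℝ (J i y)).smulRight (A i y)

theorem frameForm_apply (A : Fin 3 → E4 → ℂ) (y v : E4) :
    frameForm A y v = ∑ i, ((inner ℝ (J i y) v : ℝ) : ℂ) * A i y := by
  simp [frameForm]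

theorem contDiff_frameForm {A : Fin 3 → E4 → ℂ} (hA : ∀ i, ContDiff ℝ ∞ (A i)) :
    ContDiff ℝ ∞ (frameForm A) :=
  ContDiff.sum fun i _ => (((innerSL ℝ).contDiff.comp (J i).contDiff).smulRight (hA i))

theorem fderiv_frameForm {A : Fin 3 → E4 → ℂ} (hA : ∀ i, ContDiff ℝ ∞ (A i)) (y v v' : E4) :
    fderiv ℝ (frameForm A) y v' v = ∑ i, (((inner ℝ (J i v') v : ℝ) : ℂ) * A i y
      + ((inner ℝ (J i y) v : ℝ) : ℂ) * fderiv ℝ (A i) y v') := by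
  have h1 : HasFDerivAt (frameForm A) (fderiv ℝ (frameForm A) y) y :=
    ((contDiff_frameForm hA).differentiable (by simp) y).hasFDerivAt
  have h2 : HasFDerivAt (fun y => frameForm A y v) _ y := h1.clm_apply (hasFDerivAt_const v y)
  have h3 : ∀ i, HasFDerivAt (fun y => ((inner ℝ (J i y) v : ℝ) : ℂ)) _ y := fun i =>
    Complex.ofRealCLM.hasFDerivAt.comp y (((innerSL ℝ v).comp (J i)).hasFDerivAt.congr_of_eventuallyEq
      (Filter.Eventually.of_forall fun z => real_inner_comm v (J i z)))
  have h4 : HasFDerivAt (fun y => ∑ i, ((inner ℝ (J i y) v : ℝ) : ℂ) * A i y) _ y :=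
    HasFDerivAt.fun_sum (u := Finset.univ) fun i _ =>
      (h3 i).mul ((hA i).differentiable (by simp) y).hasFDerivAt
  simp only [frameForm_apply] at h2
  have h5 := congrArg (fun l : E4 →L[ℝ] ℂ => l v') (h2.unique h4)
  simp only [_root_.sum_apply, _root_.add_apply,
    _root_.smul_apply, ContinuousLinearMap.comp_apply, ContinuousLinearMap.flip_apply,
    _root_.zero_apply, map_zero, zero_add, Complex.ofRealCLM_apply,
    innerSL_apply_apply, smul_eq_mul] at h5
  rw [h5]
  refine Finset.sum_congr rfl fun i _ => ?_
  rw [real_inner_comm v (J i v')]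
  ring

section Potential

variable {α : Fin 3 → SmoothS} {A : Fin 3 → E4 → ℂ}

theorem eq_zero_of_eq_neg {x : E4} (h : x = -x) : x = 0 := by
  have h2 : (2 : ℝ) • x = 0 := by rw [two_smul]; nth_rewrite 2 [h]; exact add_neg_cancel x
  exact (smul_eq_zero.1 h2).resolve_left two_ne_zero

/-- After expansion of the tangent vectors in the frame, the exterior derivative consists of the
differences `eS i (α j) - eS j (α i)` corrected by the commutators of the frame, which the
hypothesis cancels. Only tangent vectors are allowed, since the extension `A` is arbitrary off the
sphere. -/
theorem frameForm_closed (hA : ∀ i, ContDiff ℝ ∞ (A i)) (hα : ∀ i (y : S3), A i y = (α i).1 y)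
    (hd : ∀ i j (y : S3), fderiv ℝ (A i) y (J j y) = (eS j (α i)).1 y)
    (h : ∀ i j, eS i (α j) - eS j (α i) = ∑ k : Fin 3, bracket i.succ j.succ k.succ • α k)
    (y : S3) {v v' : E4} (hv : inner ℝ (y : E4) v = 0) (hv' : inner ℝ (y : E4) v' = 0) :
    fderiv ℝ (frameForm A) y v' v = fderiv ℝ (frameForm A) y v v' := by
  have hy : ‖(y : E4)‖ = 1 := norm_eq_of_mem_sphere y
  have e1 := frame_expansion y v
  have e2 := frame_expansion y v'
  rw [hy, one_pow, one_smul, hv, zero_smul, zero_add] at e1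
  rw [hy, one_pow, one_smul, hv', zero_smul, zero_add] at e2
  generalize (fun i => inner ℝ (J i (y : E4)) v : Fin 3 → ℝ) = x at e1
  have hx : ∃ x : Fin 3 → ℝ, v = ∑ i, x i • J i (y : E4) := ⟨_, e1⟩
  have hx' : ∃ x : Fin 3 → ℝ, v' = ∑ i, x i • J i (y : E4) := ⟨_, e2⟩
  clear e1 e2 hv hv'
  obtain ⟨x, rfl⟩ := hx
  obtain ⟨x', rfl⟩ := hx'
  have hi : ∀ i j k, inner ℝ (J i (J j (y : E4))) (J k y) = _ := fun i j k => inner_J_J_J i j k y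
  have hi2 : ∀ i j, inner ℝ (J i (y : E4)) (J j y) = _ := fun i j => inner_J_J i j y
  simp only [hy, one_pow, mul_one] at hi hi2
  have hb : ∀ i j, (eS i (α j)).1 y - (eS j (α i)).1 y
      = ∑ k : Fin 3, bracket i.succ j.succ k.succ * (α k).1 y := fun i j => by
    have := congrArg (fun f : SmoothS => f.1 y) (h i j)
    simpa [Fin.sum_univ_three] using this
  have h01 := hb 0 1
  have h02 := hb 0 2
  have h12 := hb 1 2
  rw [fderiv_frameForm hA, fderiv_frameForm hA]
  simp only [map_add, map_smul, inner_add_left, inner_add_right,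
    real_inner_smul_left, real_inner_smul_right, hi, hi2, hα, hd, Fin.sum_univ_three, Complex.real_smul]
  simp [bracket, Fin.sum_univ_three] at h01 h02 h12 ⊢
  linear_combination (x' 0 * x 1 - x' 1 * x 0 : ℂ) * h01 + (x' 0 * x 2 - x' 2 * x 0 : ℂ) * h02
    + (x' 1 * x 2 - x' 2 * x 1 : ℂ) * h12

/-- A function with prescribed frame derivatives on the complement of a point. -/
theorem exists_potential_compl (hA : ∀ i, ContDiff ℝ ∞ (A i))
    (hα : ∀ i (y : S3), A i y = (α i).1 y)
    (hd : ∀ i j (y : S3), fderiv ℝ (A i) y (J j y) = (eS j (α i)).1 y)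
    (h : ∀ i j, eS i (α j) - eS j (α i) = ∑ k : Fin 3, bracket i.succ j.succ k.succ • α k)
    (v : S3) : ∃ G : E4 → ℂ, ∀ y : S3, y ≠ v →
      ContDiffAt ℝ ∞ G y ∧ ∀ i, fderiv ℝ G y (J i y) = (α i).1 y := by
  have hv : ‖(v : E4)‖ = 1 := norm_eq_of_mem_sphere v
  let φ : (ℝ ∙ (v : E4))ᗮ → E4 := fun z => stereoInvFunAux (v : E4) z
  have hφ : ContDiff ℝ ∞ φ := contDiff_stereoInvFunAux.comp (ℝ ∙ (v : E4))ᗮ.subtypeL.contDiff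
  have hφ1 : ∀ z, φ z ∈ Metric.sphere (0 : E4) 1 := fun z => stereoInvFunAux_mem hv z.2
  let η : (ℝ ∙ (v : E4))ᗮ → (ℝ ∙ (v : E4))ᗮ →L[ℝ] ℂ := fun z =>
    (frameForm A (φ z)).comp (fderiv ℝ φ z)
  have hφ' : ContDiff ℝ ∞ (fderiv ℝ φ) := hφ.fderiv_right (by simp)
  have hη : ContDiff ℝ ∞ η := ((contDiff_frameForm hA).comp hφ).clm_comp hφ'
  -- Differentiating `‖φ z‖² = 1` shows that the image of the derivative is tangent to the sphere,
  -- where the form is closed.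
  have htan : ∀ z ζ, inner ℝ (φ z) (fderiv ℝ φ z ζ) = 0 := fun z ζ => by
    have h1 := (hφ.differentiable (by simp) z).hasFDerivAt.inner ℝ
      (hφ.differentiable (by simp) z).hasFDerivAt
    have h2 : (fun z => (inner ℝ (φ z) (φ z) : ℝ)) = fun _ => 1 := by
      funext z
      rw [real_inner_self_eq_norm_sq, norm_eq_of_mem_sphere (⟨φ z, hφ1 z⟩ : S3), one_pow]
    rw [h2] at h1
    have h3 := congrArg (fun l => l ζ) (h1.unique (hasFDerivAt_const _ _))
    simp [fderivInnerCLM_apply] at h3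
    rw [real_inner_comm] at h3
    have h4 := real_inner_comm (φ z) (fderiv ℝ φ z ζ)
    linarith
  -- The pullback by inverse stereographic projection is a closed form on a vector space, hence
  -- exact. In its derivative, the term with the second derivative of `φ` is symmetric and the other
  -- one is symmetric by closedness on the sphere.
  obtain ⟨f, hf⟩ := Convex.exists_forall_hasFDerivWithinAt_of_hasFDerivWithinAt_symmetric
    (s := Set.univ) (dω := fderiv ℝ η) convex_univ
    (fun z _ => (hη.differentiable (by simp) z).hasFDerivAt.hasFDerivWithinAt)
    (fun z _ ζ _ ζ' _ => by
      have e1 : ∀ ζ ζ', fderiv ℝ η z ζ ζ' = frameForm A (φ z) (fderiv ℝ (fderiv ℝ φ) z ζ ζ')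
          + fderiv ℝ (frameForm A) (φ z) (fderiv ℝ φ z ζ) (fderiv ℝ φ z ζ') := fun ζ ζ' => by
        have h1 : HasFDerivAt (fun z => frameForm A (φ z)) _ z :=
          ((contDiff_frameForm hA).differentiable (by simp) (φ z)).hasFDerivAt.comp z
            (hφ.differentiable (by simp) z).hasFDerivAt
        have h2 := h1.clm_comp (hφ'.differentiable (by simp) z).hasFDerivAt
        have h3 : fderiv ℝ η z = _ := h2.fderiv
        rw [h3]
        simp
      have hs : IsSymmSndFDerivAt ℝ φ z := hφ.contDiffAt.isSymmSndFDerivAt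
        (by simp [minSmoothness_of_isRCLikeNormedField]; exact WithTop.coe_le_coe.2 (le_top : (2 : ℕ∞) ≤ ⊤))
      rw [e1, e1, hs.eq]
      congr 1
      exact frameForm_closed hA hα hd h ⟨φ z, hφ1 z⟩ (htan z ζ') (htan z ζ))
  have hf' : ∀ z, HasFDerivAt f (η z) z := fun z => (hf z trivial).hasFDerivAt Filter.univ_mem
  have hfs : ContDiff ℝ ∞ f := by
    have h1 : fderiv ℝ f = η := funext fun z => (hf' z).fderiv
    exact contDiff_infty_iff_fderiv.2 ⟨fun z => (hf' z).differentiableAt, h1 ▸ hη⟩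
  refine ⟨fun x => f (stereoToFun (v : E4) x), fun y hy => ?_⟩
  have hyv : innerSL ℝ (v : E4) (y : E4) ≠ 1 := by
    rw [innerSL_apply_apply]
    intro h1
    exact hy (Subtype.ext ((inner_eq_one_iff_of_norm_eq_one (𝕜 := ℝ) hv (norm_eq_of_mem_sphere y)).1 h1).symm)
  have hs : ContDiffAt ℝ ∞ (stereoToFun (v : E4)) y :=
    contDiffOn_stereoToFun.contDiffAt ((isOpen_ne.preimage (innerSL ℝ (v : E4)).continuous).mem_nhds hyv)
  refine ⟨hfs.contDiffAt.comp (y : E4) hs, fun i => ?_⟩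
  have hfl := hasDerivAt_flow i.succ (0, y)
  have hrot : HasDerivAt (fun θ : ℝ => (rot i θ y : E4)) (J i (y : E4)) 0 := hfl.snd
  have hr0 : rot i 0 y = y := Subtype.ext (by simp [rot])
  have hsd : HasFDerivAt (stereoToFun (v : E4)) (fderiv ℝ (stereoToFun (v : E4)) y)
      (rot i 0 y : E4) := by
    rw [hr0]; exact (hs.differentiableAt (by simp)).hasFDerivAt
  have hc := hsd.comp_hasDerivAt (0 : ℝ) hrot
  have hφc := ((hφ.differentiable (by simp) (stereoToFun (v : E4) (rot i 0 y))).hasFDerivAt).comp_hasDerivAt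
    (0 : ℝ) hc
  have hφe : (φ ∘ stereoToFun (v : E4) ∘ fun θ : ℝ => (rot i θ y : E4)) =ᶠ[nhds 0]
      fun θ : ℝ => (rot i θ y : E4) := by
    have hcont : Continuous fun θ : ℝ => rot i θ y := Continuous.subtype_mk (by fun_prop) _
    have : ∀ᶠ θ in nhds (0 : ℝ), rot i θ y ≠ v :=
      hcont.continuousAt.eventually_ne (by rw [hr0]; exact hy)
    filter_upwards [this] with θ hθ
    exact congrArg Subtype.val (stereo_left_inv hv (x := rot i θ y) fun h => hθ (Subtype.ext h))
  have huniq := (hφc.congr_of_eventuallyEq hφe.symm).unique hrot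
  have hfin := ((hf' (stereoToFun (v : E4) y)).comp (y : E4)
    (hs.differentiableAt (by simp)).hasFDerivAt).fderiv
  rw [hr0] at huniq
  have hφy : φ (stereoToFun (v : E4) y) = y :=
    congrArg Subtype.val (stereo_left_inv hv (x := y) fun h => hy (Subtype.ext h))
  have hfin' : fderiv ℝ (fun x => f (stereoToFun (v : E4) x)) y = _ := hfin
  rw [hfin']
  simp only [η, ContinuousLinearMap.comp_apply]
  rw [huniq, hφy, frameForm_apply]
  have hn : ‖(y : E4)‖ = 1 := norm_eq_of_mem_sphere y
  simp only [inner_J_J, hn, hα]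
  fin_cases i <;> simp [Fin.sum_univ_three]

theorem contMDiffAt_comp_coe {G : E4 → ℂ} {y : S3} (hG : ContDiffAt ℝ ∞ G y) :
    ContMDiffAt (𝓡 3) 𝓘(ℝ, ℂ) ∞ (fun y : S3 => G y) y :=
  ContMDiffAt.comp y hG.contMDiffAt contMDiff_coe_sphere.contMDiffAt

/-- Closed one-forms on the three-sphere are exact. -/
theorem exists_potential (α : Fin 3 → SmoothS)
    (h : ∀ i j, eS i (α j) - eS j (α i) = ∑ k : Fin 3, bracket i.succ j.succ k.succ • α k) :
    ∃ F : SmoothS, ∀ i, eS i F = α i := by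
  classical
  have hex : ∀ i, ∃ A : E4 → ℂ, ContDiff ℝ ∞ A ∧ (∀ y : S3, A y = (α i).1 y) ∧
      ∀ j (y : S3), fderiv ℝ A y (J j y) = (eS j (α i)).1 y := fun i => by
    obtain ⟨F, hF, hF'⟩ := exists_ofExt (lift (α i))
    refine ⟨fun x => F (0, x), hF.comp (contDiff_prodMk_right 0),
      fun y => (congrArg (fun f : SmoothM => f.1 (0, y)) hF').symm, fun j y => ?_⟩
    have h1 : (eS j (α i)).1 y = (e j.succ (ofExt F hF)).1 (0, y) := by rw [← hF']; rfl
    rw [h1, e_ofExt_apply]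
    have h2 := ((hF.differentiable (by simp) ((0 : ℝ), (y : E4))).hasFDerivAt).comp (y : E4)
      (hasFDerivAt_prodMk_right (0 : ℝ) (y : E4))
    have h3 : fderiv ℝ (fun x => F (0, x)) (y : E4) = _ := h2.fderiv
    rw [h3]
    rfl
  choose A hA hα hd using hex
  let v : S3 := ⟨EuclideanSpace.single 0 1, by simp⟩
  obtain ⟨G, hG⟩ := exists_potential_compl hA hα (fun i j => hd i j) h v
  obtain ⟨G', hG'⟩ := exists_potential_compl hA hα (fun i j => hd i j) h (-v)
  have hv : ‖(v : E4)‖ = 1 := norm_eq_of_mem_sphere v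
  let φ : (ℝ ∙ (v : E4))ᗮ → E4 := fun z => stereoInvFunAux (v : E4) z
  have hφ : ContDiff ℝ ∞ φ := contDiff_stereoInvFunAux.comp (ℝ ∙ (v : E4))ᗮ.subtypeL.contDiff
  have hφ1 : ∀ z, φ z ∈ Metric.sphere (0 : E4) 1 := fun z => stereoInvFunAux_mem hv z.2
  have hφv : ∀ z, (⟨φ z, hφ1 z⟩ : S3) ≠ v := fun z => stereoInvFun_ne_north_pole hv z
  have hφ0 : stereoToFun (v : E4) (-v : E4) = 0 := by
    rw [stereoToFun_apply]
    have : (ℝ ∙ (v : E4))ᗮ.orthogonalProjectionOnto (-v : E4) = 0 := by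
      rw [map_neg, neg_eq_zero]
      exact Submodule.orthogonalProjectionOnto_orthogonal_apply_eq_zero
        (Submodule.mem_span_singleton_self _)
    rw [this, smul_zero]
  have hφv' : ∀ z, z ≠ 0 → (⟨φ z, hφ1 z⟩ : S3) ≠ -v := fun z hz hc => hz (by
    have h1 : stereoToFun (v : E4) (φ z) = z := stereo_right_inv hv z
    have h2 : φ z = -v := congrArg Subtype.val hc
    rw [← h1, h2, hφ0])
  have hfr : Module.finrank ℝ (ℝ ∙ (v : E4))ᗮ = 3 :=
    Submodule.finrank_orthogonal_span_singleton (n := 3) (norm_ne_zero_iff.1 (by rw [hv]; simp))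
  -- The two potentials are both defined over the chart punctured at the origin, the image of `-v`.
  -- In dimension three this set is connected, so they differ by a single constant.
  have hrank : 1 < Module.rank ℝ (ℝ ∙ (v : E4))ᗮ := by
    rw [← Module.finrank_eq_rank, hfr]; norm_num
  have hDz : ∀ z ≠ 0, HasFDerivAt (fun z => G (φ z) - G' (φ z)) 0 z := fun z hz => by
    obtain ⟨h1, h2⟩ := hG _ (hφv z)
    obtain ⟨h1', h2'⟩ := hG' _ (hφv' z hz)
    have h3 := (((h1.differentiableAt (by simp)).hasFDerivAt).sub
      ((h1'.differentiableAt (by simp)).hasFDerivAt)).comp z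
      (hφ.differentiable (by simp) z).hasFDerivAt
    refine h3.congr_fderiv (ContinuousLinearMap.ext fun ζ => ?_)
    have h4 := frame_expansion (φ z) (fderiv ℝ φ z ζ)
    have hn : ‖φ z‖ = 1 := norm_eq_of_mem_sphere (⟨φ z, hφ1 z⟩ : S3)
    have htan : inner ℝ (φ z) (fderiv ℝ φ z ζ) = 0 := by
      have h1 := (hφ.differentiable (by simp) z).hasFDerivAt.inner ℝ
        (hφ.differentiable (by simp) z).hasFDerivAt
      have h2 : (fun z => (inner ℝ (φ z) (φ z) : ℝ)) = fun _ => 1 := by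
        funext z
        rw [real_inner_self_eq_norm_sq, norm_eq_of_mem_sphere (⟨φ z, hφ1 z⟩ : S3), one_pow]
      rw [h2] at h1
      have h3 := congrArg (fun l => l ζ) (h1.unique (hasFDerivAt_const _ _))
      simp [fderivInnerCLM_apply] at h3
      rw [real_inner_comm] at h3
      have h4 := real_inner_comm (φ z) (fderiv ℝ φ z ζ)
      linarith
    rw [hn, one_pow, one_smul, htan, zero_smul, zero_add] at h4
    simp only [ContinuousLinearMap.comp_apply, _root_.zero_apply]
    rw [h4, map_sum]
    refine Finset.sum_eq_zero fun i _ => ?_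
    rw [map_smul, _root_.sub_apply]
    have h5 := h2 i
    have h5' := h2' i
    simp only at h5 h5'
    rw [h5, h5', sub_self, smul_zero]
  obtain ⟨c, hc⟩ := (isOpen_compl_singleton (x := (0 : (ℝ ∙ (v : E4))ᗮ))).exists_is_const_of_fderiv_eq_zero
    (isConnected_compl_singleton_of_one_lt_rank hrank 0).isPreconnected
    (fun z hz => (hDz z hz).differentiableAt.differentiableWithinAt)
    (fun z hz => (hDz z hz).fderiv)
  have hconst : ∀ y : S3, y ≠ v → y ≠ -v → G y = G' y + c := fun y hy hy' => by
    have h1 := stereo_left_inv hv (x := y) fun h => hy (Subtype.ext h)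
    have h1' : φ (stereoToFun (v : E4) y) = y := congrArg Subtype.val h1
    have hz : stereoToFun (v : E4) y ≠ 0 := fun hz => hy' (by
      have h2 : stereoInvFun hv (stereoToFun (v : E4) ((-v : S3) : E4)) = -v :=
        stereo_left_inv hv (x := -v) fun h => by
          have h3 : (-v : E4) = v := h
          have h4 : (v : E4) = 0 := eq_zero_of_eq_neg h3.symm
          rw [h4, norm_zero] at hv
          exact zero_ne_one hv
      have h5 : stereoToFun (v : E4) ((-v : S3) : E4) = 0 := hφ0
      rw [h5] at h2
      rw [hz] at h1
      exact h1.symm.trans h2)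
    have h6 := hc _ hz
    rw [h1'] at h6
    rw [← h6]; ring
  -- The first potential is used everywhere except at its pole, where the shifted second one agrees
  -- with it nearby.
  let F : S3 → ℂ := fun y => if y = v then G' y + c else G y
  have hloc1 : ∀ y : S3, y ≠ v → F =ᶠ[nhds y] fun y => G y := fun y hy => by
    filter_upwards [isOpen_ne.mem_nhds hy] with z hz
    exact if_neg hz
  have hvv : v ≠ -v := fun h => by
    have h4 : (v : E4) = 0 := eq_zero_of_eq_neg (congrArg Subtype.val h)
    rw [h4, norm_zero] at hv
    exact zero_ne_one hv
  have hloc2 : F =ᶠ[nhds v] fun y => G' y + c := by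
    filter_upwards [isOpen_ne.mem_nhds hvv] with z hz
    by_cases hzv : z = v
    · exact if_pos hzv
    · exact (if_neg hzv).trans (hconst z hzv hz)
  have hFs : ContMDiff (𝓡 3) 𝓘(ℝ, ℂ) ∞ F := fun y => by
    by_cases hy : y = v
    · subst hy
      refine ContMDiffAt.congr_of_eventuallyEq ?_ hloc2
      exact contMDiffAt_comp_coe (G := fun x => G' x + c) ((hG' _ hvv).1.add contDiffAt_const)
    · exact (contMDiffAt_comp_coe (hG y hy).1).congr_of_eventuallyEq (hloc1 y hy)
  refine ⟨⟨F, hFs⟩, fun i => SmoothS.ext fun y => ?_⟩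
  have hr0 : rot i 0 y = y := Subtype.ext (by simp [rot])
  have hrot : HasDerivAt (fun θ : ℝ => (rot i θ y : E4)) (J i (y : E4)) 0 :=
    (hasDerivAt_flow i.succ (0, y)).snd
  have hcont : Filter.Tendsto (fun θ : ℝ => rot i θ y) (nhds 0) (nhds y) := by
    have : Continuous fun θ : ℝ => rot i θ y := Continuous.subtype_mk (by fun_prop) _
    simpa only [hr0] using this.tendsto 0
  have key : ∀ G : E4 → ℂ, ContDiffAt ℝ ∞ G y → F =ᶠ[nhds y] (fun y => G y) →
      fderiv ℝ G y (J i y) = (α i).1 y → (eS i ⟨F, hFs⟩).1 y = (α i).1 y := by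
    intro G hG1 hG2 hG3
    have h1 : HasFDerivAt G (fderiv ℝ G y) (rot i 0 y : E4) := by
      rw [hr0]; exact (hG1.differentiableAt (by simp)).hasFDerivAt
    have h2 := h1.comp_hasDerivAt (0 : ℝ) hrot
    have h3 := (h2.congr_of_eventuallyEq (hcont.eventually hG2)).deriv
    rw [hG3] at h3
    exact h3
  by_cases hy : y = v
  · subst hy
    refine key (fun x => G' x + c) ((hG' _ hvv).1.add contDiffAt_const) hloc2 ?_
    rw [fderiv_add_const]
    exact (hG' _ hvv).2 i
  · exact key G (hG y hy).1 (hloc1 y hy) ((hG y hy).2 i)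

end Potential

/-! ### Tensor calculus on the three-sphere -/

theorem two_smul' (f : SmoothS) : (2 : ℂ) • f = 2 * f := by
  rw [Algebra.smul_def, map_ofNat]

/-- This rule and the next two put words in the frame fields into increasing order, after which
second order identities are identities of commutative algebra. -/
theorem eS_one_zero (f : SmoothS) : eS 1 (eS 0 f) = eS 0 (eS 1 f) - 2 * eS 2 f := by
  have h := eS_comm 0 1 f
  simp [Fin.sum_univ_three, bracket, two_smul'] at h
  linear_combination -h

theorem eS_two_zero (f : SmoothS) : eS 2 (eS 0 f) = eS 0 (eS 2 f) + 2 * eS 1 f := by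
  have h := eS_comm 0 2 f
  simp [Fin.sum_univ_three, bracket, two_smul'] at h
  linear_combination -h

theorem eS_two_one (f : SmoothS) : eS 2 (eS 1 f) = eS 1 (eS 2 f) - 2 * eS 0 f := by
  have h := eS_comm 1 2 f
  simp [Fin.sum_univ_three, bracket, two_smul'] at h
  linear_combination -h

theorem eS_ofNat_mul (i : Fin 3) (n : ℕ) [n.AtLeastTwo] (f : SmoothS) :
    eS i ((ofNat(n) : SmoothS) * f) = (ofNat(n) : SmoothS) * eS i f := by
  have h := map_nsmul (eS i) (OfNat.ofNat n) f
  simpa [nsmul_eq_mul] using h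

/-- Fields of `3 × 3` matrices on the three-sphere, in the left invariant frame. -/
abbrev MatS : Type := Fin 3 → Fin 3 → SmoothS

/-- The frame curl on the first index. -/
def curlS : MatS →ₗ[ℂ] MatS where
  toFun h m j := ![eS 1 (h 2 j) - eS 2 (h 1 j), eS 2 (h 0 j) - eS 0 (h 2 j),
    eS 0 (h 1 j) - eS 1 (h 0 j)] m
  map_add' h k := by
    funext m j
    fin_cases m <;> simp <;> ring
  map_smul' c h := by
    funext m j
    fin_cases m <;> simp [smul_sub]

theorem curlS_zero (h : MatS) (j : Fin 3) : curlS h 0 j = eS 1 (h 2 j) - eS 2 (h 1 j) := rfl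
theorem curlS_one (h : MatS) (j : Fin 3) : curlS h 1 j = eS 2 (h 0 j) - eS 0 (h 2 j) := rfl
theorem curlS_two (h : MatS) (j : Fin 3) : curlS h 2 j = eS 0 (h 1 j) - eS 1 (h 0 j) := rfl

/-- Transverse traceless symmetric tensors on the three-sphere. -/
structure IsTT (p : MatS) : Prop where
  symm : ∀ i j, p i j = p j i
  trace : p 0 0 + p 1 1 + p 2 2 = 0
  div : ∀ j, eS 0 (p 0 j) + eS 1 (p 1 j) + eS 2 (p 2 j) = 0

/-- The covariant curl of trace-free symmetric tensors. -/
def curlTT : MatS →ₗ[ℂ] MatS := curlS - (3 : ℂ) • LinearMap.id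

theorem three_smul (f : SmoothS) : (3 : ℂ) • f = 3 * f := by
  rw [Algebra.smul_def, map_ofNat]

theorem curlTT_apply (p : MatS) (i j : Fin 3) : curlTT p i j = curlS p i j - 3 * p i j := by
  simp [curlTT, three_smul]

/-- The antisymmetric part of the curl is given by the divergence, its trace vanishes because `p` is
symmetric and trace-free, and the divergence of `curlS p` is twice that of `p` by the commutators,
so that of `curlTT p` is `2 - 3 = -1` times it. -/
theorem IsTT.curlTT {p : MatS} (hp : IsTT p) : IsTT (curlTT p) := by
  have h10 := hp.symm 1 0
  have h20 := hp.symm 2 0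
  have h21 := hp.symm 2 1
  have ht : p 2 2 = -p 0 0 - p 1 1 := by linear_combination hp.trace
  have d0 := hp.div 0
  have d1 := hp.div 1
  have d2 := hp.div 2
  simp only [h10, h20, h21, ht, map_sub, map_neg] at d0 d1 d2
  have h01 : DeSitter.curlTT p 0 1 = DeSitter.curlTT p 1 0 := by
    simp only [curlTT_apply, curlS_zero, curlS_one, h10, h20, h21, ht, map_sub, map_neg]
    linear_combination d2
  have h02 : DeSitter.curlTT p 0 2 = DeSitter.curlTT p 2 0 := by
    simp only [curlTT_apply, curlS_zero, curlS_two, h10, h20, h21, ht, map_sub, map_neg]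
    linear_combination -d1
  have h12 : DeSitter.curlTT p 1 2 = DeSitter.curlTT p 2 1 := by
    simp only [curlTT_apply, curlS_one, curlS_two, h10, h20, h21, ht, map_sub, map_neg]
    linear_combination d0
  refine ⟨fun i j => ?_, ?_, fun j => ?_⟩
  · fin_cases i <;> fin_cases j <;> first | rfl | assumption | (symm; assumption)
  · simp only [curlTT_apply, curlS_zero, curlS_one, curlS_two, h10, h20, h21, ht]
    ring
  · have hd := hp.div j
    simp only [curlTT_apply, curlS_zero, curlS_one, curlS_two, map_sub, eS_one_zero, eS_two_zero,
      eS_two_one, eS_ofNat_mul]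
    linear_combination -hd

/-! ### The `L²` inner products on functions and matrix fields -/

/-- The inner product of smooth functions on the sphere. -/
def ipS (f h : SmoothS) : ℂ := integralS (conjS f * h)

theorem ipS_add_left (f f' h : SmoothS) : ipS (f + f') h = ipS f h + ipS f' h := by
  simp only [ipS, conjS_add, add_mul, map_add]

theorem ipS_add_right (f h h' : SmoothS) : ipS f (h + h') = ipS f h + ipS f h' := by
  simp only [ipS, mul_add, map_add]

theorem ipS_smul_left (c : ℂ) (f h : SmoothS) : ipS (c • f) h = conj c * ipS f h := by
  simp only [ipS, conjS_smul, smul_mul_assoc, map_smul, smul_eq_mul]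

theorem ipS_smul_right (c : ℂ) (f h : SmoothS) : ipS f (c • h) = c * ipS f h := by
  simp only [ipS, mul_smul_comm, map_smul, smul_eq_mul]

theorem ipS_neg_left (f h : SmoothS) : ipS (-f) h = -ipS f h := by
  have := ipS_smul_left (-1) f h
  simpa using this

theorem ipS_neg_right (f h : SmoothS) : ipS f (-h) = -ipS f h := by
  have := ipS_smul_right (-1) f h
  simpa using this

theorem ipS_sub_left (f f' h : SmoothS) : ipS (f - f') h = ipS f h - ipS f' h := by
  rw [sub_eq_add_neg, ipS_add_left, ipS_neg_left, sub_eq_add_neg]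

theorem ipS_sub_right (f h h' : SmoothS) : ipS f (h - h') = ipS f h - ipS f h' := by
  rw [sub_eq_add_neg, ipS_add_right, ipS_neg_right, sub_eq_add_neg]

theorem ipS_zero_left (h : SmoothS) : ipS 0 h = 0 := by
  have := ipS_smul_left 0 0 h
  simpa using this

theorem ipS_zero_right (h : SmoothS) : ipS h 0 = 0 := by
  have := ipS_smul_right 0 h 0
  simpa using this

theorem ipS_eS (i : Fin 3) (f h : SmoothS) : ipS f (eS i h) = -ipS (eS i f) h := by
  rw [ipS, ipS, integralS_mul_eS, eS_conjS]

theorem conj_ipS (f h : SmoothS) : conj (ipS f h) = ipS h f := by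
  rw [ipS, ipS, ← integralS_conjS, conjS_mul, conjS_conjS, mul_comm]

theorem ipS_self_nonneg (f : SmoothS) : 0 ≤ (ipS f f).re := by
  have h1 : ∀ y, (conjS f * f).1 y = ((‖f.1 y‖ ^ 2 : ℝ) : ℂ) := fun y => by
    change conj (f.1 y) * f.1 y = _
    rw [Complex.conj_mul']; push_cast; rfl
  have : ipS f f = ((∫ y, ‖f.1 y‖ ^ 2 ∂σ3 : ℝ) : ℂ) := by
    rw [← integral_complex_ofReal]
    exact integral_congr_ae (Filter.Eventually.of_forall h1)
  rw [this, Complex.ofReal_re]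
  exact integral_nonneg fun y => by positivity

theorem eq_zero_of_ipS_self {f : SmoothS} (h : (ipS f f).re = 0) : f = 0 := by
  refine eq_zero_of_integralS_sq (Complex.ext h ?_)
  exact Complex.conj_eq_iff_im.1 (conj_ipS f f)

/-- The inner product of matrix fields. -/
def ipMat (p q : MatS) : ℂ := ∑ i, ∑ j, ipS (p i j) (q i j)

/-- The frame fields are skew-adjoint and the curl is antisymmetric in its first index pair; the two
signs compensate. -/
theorem ipMat_curlS (p q : MatS) : ipMat (curlS p) q = ipMat p (curlS q) := by
  simp only [ipMat, Fin.sum_univ_three, curlS_zero, curlS_one, curlS_two, ipS_sub_left,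
    ipS_sub_right, ipS_eS]
  ring

theorem ipMat_add_left (p p' q : MatS) : ipMat (p + p') q = ipMat p q + ipMat p' q := by
  simp only [ipMat, Pi.add_apply, ipS_add_left, Finset.sum_add_distrib]

theorem ipMat_sub_left (p p' q : MatS) : ipMat (p - p') q = ipMat p q - ipMat p' q := by
  simp only [ipMat, Pi.sub_apply, ipS_sub_left, Finset.sum_sub_distrib]

theorem ipMat_sub_right (p q q' : MatS) : ipMat p (q - q') = ipMat p q - ipMat p q' := by
  simp only [ipMat, Pi.sub_apply, ipS_sub_right, Finset.sum_sub_distrib]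

theorem ipMat_smul_left (c : ℂ) (p q : MatS) : ipMat (c • p) q = conj c * ipMat p q := by
  simp only [ipMat, Pi.smul_apply, ipS_smul_left, Finset.mul_sum]

theorem ipMat_smul_right (c : ℂ) (p q : MatS) : ipMat p (c • q) = c * ipMat p q := by
  simp only [ipMat, Pi.smul_apply, ipS_smul_right, Finset.mul_sum]

theorem ipMat_curlTT (p q : MatS) : ipMat (curlTT p) q = ipMat p (curlTT q) := by
  simp only [curlTT, LinearMap.sub_apply, LinearMap.smul_apply, LinearMap.id_apply, ipMat_sub_left,
    ipMat_sub_right, ipMat_smul_left, ipMat_smul_right, ipMat_curlS, map_ofNat]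

theorem conj_ipMat (p q : MatS) : conj (ipMat p q) = ipMat q p := by
  simp only [ipMat, map_sum, conj_ipS]

theorem ipMat_self_nonneg (p : MatS) : 0 ≤ (ipMat p p).re := by
  simp only [ipMat, Complex.re_sum]
  exact Finset.sum_nonneg fun i _ => Finset.sum_nonneg fun j _ => ipS_self_nonneg _

theorem eq_zero_of_ipMat_self {p : MatS} (h : (ipMat p p).re = 0) : p = 0 := by
  simp only [ipMat, Complex.re_sum] at h
  funext i j
  have h1 := (Finset.sum_eq_zero_iff_of_nonneg fun i _ =>
    Finset.sum_nonneg fun j _ => ipS_self_nonneg (p i j)).1 h i (Finset.mem_univ i)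
  exact eq_zero_of_ipS_self ((Finset.sum_eq_zero_iff_of_nonneg fun j _ =>
    ipS_self_nonneg (p i j)).1 h1 j (Finset.mem_univ j))

/-- The `L²` inner product on matrix fields. -/
@[reducible] def matCore : InnerProductSpace.Core ℂ MatS where
  inner := ipMat
  conj_inner_symm p q := conj_ipMat q p
  re_inner_nonneg p := ipMat_self_nonneg p
  add_left := ipMat_add_left
  smul_left p q c := ipMat_smul_left c p q
  definite p h := eq_zero_of_ipMat_self (by
    have : ipMat p p = 0 := h
    rw [this]; rfl)

/-! ### Spherical polynomials -/

/-- The coordinate functions of the sphere. -/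
def coordS (A : Fin 4) : SmoothS :=
  ⟨fun y => (((y : E4) A : ℝ) : ℂ),
    ((Complex.ofRealCLM.contDiff.comp (EuclideanSpace.proj A : E4 →L[ℝ] ℝ).contDiff).contMDiff).comp
      contMDiff_coe_sphere⟩

theorem eS_coordS_apply (i : Fin 3) (A : Fin 4) (y : S3) :
    (eS i (coordS A)).1 y = ((J i (y : E4)) A : ℝ) := by
  have h1 : HasDerivAt (fun θ : ℝ => (rot i θ y : E4)) (J i (y : E4)) 0 :=
    (hasDerivAt_flow i.succ (0, y)).snd
  have h2 := (Complex.ofRealCLM.comp (EuclideanSpace.proj A : E4 →L[ℝ] ℝ)).hasFDerivAt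
    (x := (rot i 0 y : E4)) |>.comp_hasDerivAt (0 : ℝ) h1
  exact h2.deriv

/-- The affine functions on the sphere. -/
def affS : Submodule ℂ SmoothS := Submodule.span ℂ (insert 1 (Set.range coordS))

/-- The polynomials of degree at most `N` on the sphere. -/
def polyS (N : ℕ) : Submodule ℂ SmoothS := affS ^ N

theorem one_mem_affS : (1 : SmoothS) ∈ affS := Submodule.subset_span (Set.mem_insert _ _)

theorem coordS_mem_affS (A : Fin 4) : coordS A ∈ affS :=
  Submodule.subset_span (Set.mem_insert_of_mem _ ⟨A, rfl⟩)

theorem eS_coordS_mem (i : Fin 3) (A : Fin 4) : eS i (coordS A) ∈ affS := by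
  have h : ∀ f : SmoothS, (∀ y, (eS i (coordS A)).1 y = f.1 y) → f ∈ affS → eS i (coordS A) ∈ affS :=
    fun f h hf => by rwa [SmoothS.ext h]
  have hJ : ∃ (s : ℝ) (B : Fin 4), ∀ y : E4, J i y A = s * y B := by
    fin_cases i <;> fin_cases A <;> simp [J, Fin.sum_univ_four, Matrix.mulVec, dotProduct]
    all_goals first
      | exact ⟨-1, 1, fun y => by ring1⟩ | exact ⟨1, 0, fun y => by ring1⟩
      | exact ⟨1, 3, fun y => by ring1⟩ | exact ⟨-1, 2, fun y => by ring1⟩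
      | exact ⟨-1, 3, fun y => by ring1⟩ | exact ⟨1, 1, fun y => by ring1⟩
      | exact ⟨1, 2, fun y => by ring1⟩ | exact ⟨-1, 0, fun y => by ring1⟩
  obtain ⟨s, B, hs⟩ := hJ
  refine h ((s : ℂ) • coordS B) (fun y => ?_) (Submodule.smul_mem _ _ (coordS_mem_affS B))
  rw [eS_coordS_apply, hs, SmoothS.smul_apply]
  push_cast
  rfl

theorem eS_one (i : Fin 3) : eS i 1 = 0 := by
  have := eS_mul i 1 1
  simpa using this

theorem eS_mem_affS (i : Fin 3) {f : SmoothS} (hf : f ∈ affS) : eS i f ∈ affS := by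
  induction hf using Submodule.span_induction with
  | mem f hf =>
    rcases hf with rfl | ⟨A, rfl⟩
    · rw [eS_one]; exact Submodule.zero_mem _
    · exact eS_coordS_mem i A
  | zero => rw [map_zero]; exact Submodule.zero_mem _
  | add f h _ _ hf hh => rw [map_add]; exact Submodule.add_mem _ hf hh
  | smul c f _ hf => rw [map_smul]; exact Submodule.smul_mem _ _ hf

/-- A frame field maps coordinates to signed coordinates, so by the Leibniz rule it does not raise
the degree. This provides the finite dimensional invariant spaces. -/
theorem eS_mem_polyS (i : Fin 3) (N : ℕ) : ∀ {f : SmoothS}, f ∈ polyS N → eS i f ∈ polyS N := by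
  induction N with
  | zero =>
    intro f hf
    rw [polyS, pow_zero, Submodule.mem_one] at hf
    obtain ⟨c, rfl⟩ := hf
    rw [Algebra.algebraMap_eq_smul_one, map_smul, eS_one, smul_zero]
    exact Submodule.zero_mem _
  | succ N ih =>
    intro f hf
    rw [polyS, pow_succ] at hf ⊢
    refine Submodule.mul_induction_on hf (fun p hp q hq => ?_) fun p q hp hq => ?_
    · rw [eS_mul]
      exact Submodule.add_mem _ (Submodule.mul_mem_mul (ih hp) hq)
        (Submodule.mul_mem_mul hp (eS_mem_affS i hq))
    · rw [map_add]; exact Submodule.add_mem _ hp hq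

theorem conjS_one : conjS 1 = 1 := by
  ext y
  exact map_one (starRingEnd ℂ)

theorem conjS_mem_affS {f : SmoothS} (hf : f ∈ affS) : conjS f ∈ affS := by
  induction hf using Submodule.span_induction with
  | mem f hf =>
    rcases hf with rfl | ⟨A, rfl⟩
    · rw [conjS_one]; exact one_mem_affS
    · have : conjS (coordS A) = coordS A := SmoothS.ext fun y => Complex.conj_ofReal _
      rw [this]; exact coordS_mem_affS A
  | zero =>
    have : conjS 0 = 0 := SmoothS.ext fun y => map_zero (starRingEnd ℂ)
    rw [this]; exact Submodule.zero_mem _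
  | add f h _ _ hf hh => rw [conjS_add]; exact Submodule.add_mem _ hf hh
  | smul c f _ hf => rw [conjS_smul]; exact Submodule.smul_mem _ _ hf

theorem conjS_mem_polyS (N : ℕ) : ∀ {f : SmoothS}, f ∈ polyS N → conjS f ∈ polyS N := by
  induction N with
  | zero =>
    intro f hf
    rw [polyS, pow_zero, Submodule.mem_one] at hf ⊢
    obtain ⟨c, rfl⟩ := hf
    refine ⟨conj c, ?_⟩
    rw [Algebra.algebraMap_eq_smul_one, Algebra.algebraMap_eq_smul_one, conjS_smul, conjS_one]
  | succ N ih =>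
    intro f hf
    rw [polyS, pow_succ] at hf ⊢
    refine Submodule.mul_induction_on hf (fun p hp q hq => ?_) fun p q hp hq => ?_
    · rw [conjS_mul]
      exact Submodule.mul_mem_mul (ih hp) (conjS_mem_affS hq)
    · rw [conjS_add]; exact Submodule.add_mem _ hp hq

theorem polyS_mono {M N : ℕ} (h : M ≤ N) : polyS M ≤ polyS N :=
  pow_le_pow_right' (Submodule.one_le.2 one_mem_affS) h

theorem finite_polyS (N : ℕ) : (polyS N).FG :=
  Submodule.FG.pow (Submodule.fg_span ((Set.finite_range coordS).insert 1)) N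

/-! ### Density of spherical polynomials and completeness of eigentensors of the curl -/

/-- A smooth function on the sphere as a continuous map. -/
def toC (f : SmoothS) : C(S3, ℂ) := ⟨f.1, f.continuous⟩

/-- The star subalgebra of spherical polynomials. -/
def polyStar : StarSubalgebra ℂ C(S3, ℂ) where
  carrier := {g | ∃ N, ∃ f ∈ polyS N, toC f = g}
  mul_mem' := by
    rintro _ _ ⟨N, f, hf, rfl⟩ ⟨M, h, hh, rfl⟩
    refine ⟨N + M, f * h, ?_, rfl⟩
    rw [polyS, pow_add]
    exact Submodule.mul_mem_mul hf hh
  add_mem' := by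
    rintro _ _ ⟨N, f, hf, rfl⟩ ⟨M, h, hh, rfl⟩
    exact ⟨max N M, f + h, Submodule.add_mem _ (polyS_mono (le_max_left _ _) hf)
      (polyS_mono (le_max_right _ _) hh), rfl⟩
  algebraMap_mem' c := ⟨0, algebraMap ℂ SmoothS c, by
    rw [polyS, pow_zero]; exact Submodule.mem_one.2 ⟨c, rfl⟩, rfl⟩
  star_mem' := by
    rintro _ ⟨N, f, hf, rfl⟩
    exact ⟨N, conjS f, conjS_mem_polyS N hf, rfl⟩

theorem polyStar_dense : polyStar.topologicalClosure = ⊤ := by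
  refine ContinuousMap.starSubalgebra_topologicalClosure_eq_top_of_separatesPoints _ fun y z hyz => ?_
  have : ∃ A, (y : E4) A ≠ (z : E4) A := by
    by_contra! h
    exact hyz (Subtype.ext (PiLp.ext h))
  obtain ⟨A, hA⟩ := this
  refine ⟨_, ⟨toC (coordS A), ⟨1, coordS A, by rw [polyS, pow_one]; exact coordS_mem_affS A, rfl⟩, rfl⟩, ?_⟩
  exact fun h => hA (Complex.ofReal_injective h)

/-- Pairing with `f` is continuous in the supremum norm, so by Stone–Weierstrass it vanishes on all
continuous functions, in particular on `f` itself. -/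
theorem eq_zero_of_orthogonal_polyS {f : SmoothS} (h : ∀ N, ∀ p ∈ polyS N, ipS p f = 0) : f = 0 := by
  let L : C(S3, ℂ) → ℂ := fun g => ∫ y, conj (g y) * f.1 y ∂σ3
  have hL : Continuous L := by
    have hi : ∀ g : C(S3, ℂ), Integrable (fun y => conj (g y) * f.1 y) σ3 := fun g =>
      ((Complex.continuous_conj.comp g.continuous).mul f.continuous).integrable_of_hasCompactSupport
        (HasCompactSupport.of_compactSpace _)
    have hf : Integrable (fun y => ‖f.1 y‖) σ3 :=
      f.continuous.norm.integrable_of_hasCompactSupport (HasCompactSupport.of_compactSpace _)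
    refine (LipschitzWith.of_dist_le_mul (K := ⟨∫ y, ‖f.1 y‖ ∂σ3, integral_nonneg fun _ => norm_nonneg _⟩)
      fun g g' => ?_).continuous
    rw [dist_eq_norm, dist_eq_norm, ← integral_sub (hi g) (hi g'), mul_comm]
    refine (norm_integral_le_of_norm_le (hf.const_mul ‖g - g'‖)
      (Filter.Eventually.of_forall fun y => ?_)).trans_eq (integral_const_mul _ _)
    rw [← sub_mul, ← map_sub, norm_mul, RCLike.norm_conj]
    exact mul_le_mul_of_nonneg_right ((g - g').norm_coe_le_norm y) (norm_nonneg _)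
  have hcl : IsClosed {g | L g = 0} := isClosed_eq hL continuous_const
  have hsub : (polyStar : Set C(S3, ℂ)) ⊆ {g | L g = 0} := by
    rintro _ ⟨N, p, hp, rfl⟩
    exact h N p hp
  have hall : (polyStar.topologicalClosure : Set C(S3, ℂ)) ⊆ {g | L g = 0} := by
    rw [StarSubalgebra.topologicalClosure_coe]
    exact closure_minimal hsub hcl
  have : toC f ∈ (polyStar.topologicalClosure : Set C(S3, ℂ)) := by rw [polyStar_dense]; trivial
  exact eq_zero_of_integralS_sq (hall this)

/-- Matrix fields with polynomial components. -/
def polyMat (N : ℕ) : Submodule ℂ MatS := Submodule.pi Set.univ fun _ => Submodule.pi Set.univ fun _ => polyS N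

theorem mem_polyMat {N : ℕ} {p : MatS} : p ∈ polyMat N ↔ ∀ i j, p i j ∈ polyS N := by
  simp [polyMat, Submodule.mem_pi]

theorem finite_polyMat (N : ℕ) : Module.Finite ℂ (polyMat N) := by
  have : Module.Finite ℂ (polyS N) := Module.Finite.iff_fg.2 (finite_polyS N)
  let φ : polyMat N →ₗ[ℂ] (Fin 3 → Fin 3 → polyS N) :=
    { toFun := fun p i j => ⟨p.1 i j, mem_polyMat.1 p.2 i j⟩
      map_add' := fun _ _ => rfl
      map_smul' := fun _ _ => rfl }
  refine Module.Finite.of_injective φ fun p q h => Subtype.ext (funext fun i => funext fun j => ?_)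
  exact congrArg (fun r : Fin 3 → Fin 3 → polyS N => (r i j : SmoothS)) h

/-- Transverse traceless tensors as a submodule. -/
def ttSub : Submodule ℂ MatS where
  carrier := {p | IsTT p}
  add_mem' {p q} hp hq := ⟨fun i j => by simp [hp.symm i j, hq.symm i j],
    by simp only [Pi.add_apply]; linear_combination hp.trace + hq.trace,
    fun j => by simp only [Pi.add_apply, map_add]; linear_combination hp.div j + hq.div j⟩
  zero_mem' := ⟨fun _ _ => rfl, by simp, fun _ => by simp⟩
  smul_mem' c p hp := ⟨fun i j => by simp [hp.symm i j],
    by simp only [Pi.smul_apply, ← smul_add, hp.trace, smul_zero],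
    fun j => by simp only [Pi.smul_apply, map_smul, ← smul_add, hp.div j, smul_zero]⟩

theorem curlTT_mem_polyMat {N : ℕ} {p : MatS} (hp : p ∈ polyMat N) : curlTT p ∈ polyMat N := by
  rw [mem_polyMat] at hp ⊢
  have h1 : curlS p ∈ polyMat N := by
    refine mem_polyMat.2 fun i j => ?_
    fin_cases i
    · exact Submodule.sub_mem _ (eS_mem_polyS _ _ (hp _ _)) (eS_mem_polyS _ _ (hp _ _))
    · exact Submodule.sub_mem _ (eS_mem_polyS _ _ (hp _ _)) (eS_mem_polyS _ _ (hp _ _))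
    · exact Submodule.sub_mem _ (eS_mem_polyS _ _ (hp _ _)) (eS_mem_polyS _ _ (hp _ _))
  exact fun i j => Submodule.sub_mem _ (mem_polyMat.1 h1 i j) (Submodule.smul_mem _ _ (hp i j))

/-- A matrix field with a single nonzero entry. -/
def singleMat (i j : Fin 3) (f : SmoothS) : MatS := Pi.single i (Pi.single j f)

theorem singleMat_mem {N : ℕ} (i j : Fin 3) {f : SmoothS} (hf : f ∈ polyS N) :
    singleMat i j f ∈ polyMat N := by
  refine mem_polyMat.2 fun k l => ?_
  by_cases hk : k = i
  · subst hk
    by_cases hl : l = j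
    · subst hl; simpa [singleMat] using hf
    · simp [singleMat, hl]
  · simp [singleMat, hk]

theorem ipMat_singleMat (i j : Fin 3) (f : SmoothS) (q : MatS) :
    ipMat (singleMat i j f) q = ipS f (q i j) := by
  rw [ipMat, Finset.sum_eq_single i, Finset.sum_eq_single j]
  · simp [singleMat]
  · intro l _ hl; simp [singleMat, hl, ipS_zero_left]
  · simp
  · intro k _ hk; simp [singleMat, hk, ipS_zero_left]
  · simp

theorem ipS_self_eq_zero {f : SmoothS} (h : ipS f f = 0) : f = 0 :=
  eq_zero_of_ipS_self (by rw [h]; rfl)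

theorem exists_projection {F : Type} [AddCommGroup F] [Module ℂ F] (c : InnerProductSpace.Core ℂ F)
    (K : Submodule ℂ F) [Module.Finite ℂ K] (v : F) : ∃ w ∈ K, ∀ u ∈ K, c.inner u (v - w) = 0 := by
  let _ : NormedAddCommGroup F := c.toNormedAddCommGroup
  let _ : InnerProductSpace ℂ F := InnerProductSpace.ofCore c.toCore
  exact Submodule.HasOrthogonalProjection.exists_orthogonal (K := K) v

/-- The spectral theorem in finite dimension: a symmetric operator has no vector orthogonal to all
its eigenspaces, and its eigenvalues are real, so real `r` suffice. -/
theorem eq_zero_of_orthogonal_eigenvectors {F : Type} [AddCommGroup F] [Module ℂ F]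
    (c : InnerProductSpace.Core ℂ F) (T : Submodule ℂ F) [Module.Finite ℂ T] (C : T →ₗ[ℂ] T)
    (hC : ∀ p q : T, c.inner (C p : F) q = c.inner (p : F) (C q)) (x : T)
    (hx : ∀ (p : T) (r : ℝ), C p = (r : ℂ) • p → c.inner (p : F) x = 0) : x = 0 := by
  let _ : NormedAddCommGroup F := c.toNormedAddCommGroup
  let _ : InnerProductSpace ℂ F := InnerProductSpace.ofCore c.toCore
  have hC' : C.IsSymmetric := hC
  have hxbot : x ∈ (⨆ μ : ℂ, Module.End.eigenspace C μ)ᗮ := by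
    rw [Submodule.mem_orthogonal]
    intro p hp
    induction hp using Submodule.iSup_induction' with
    | zero => exact inner_zero_left _
    | add p q _ _ hp hq => rw [inner_add_left, hp, hq, add_zero]
    | mem μ p hp =>
      by_cases hp0 : p = 0
      · rw [hp0]; exact inner_zero_left _
      have he : Module.End.HasEigenvalue C μ := Module.End.hasEigenvalue_of_hasEigenvector ⟨hp, hp0⟩
      obtain ⟨r, rfl⟩ := Complex.conj_eq_iff_real.1 (hC'.conj_eigenvalue_eq_self he)
      exact hx p r (Module.End.mem_eigenspace_iff.1 hp)
  rwa [hC'.orthogonalComplement_iSup_eigenspaces_eq_bot, Submodule.mem_bot] at hxbot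

/-- A transverse traceless tensor orthogonal to all transverse traceless eigentensors of the curl
vanishes. -/
theorem tt_complete {h : MatS} (hh : IsTT h)
    (H : ∀ (p : MatS) (c : ℝ), IsTT p → curlTT p = (c : ℂ) • p → ipMat p h = 0) : h = 0 := by
  have key : ∀ N, ∀ q ∈ polyMat N, ipMat q h = 0 := by
    intro N
    have := finite_polyMat N
    obtain ⟨x, hx, hxh⟩ := exists_projection matCore (polyMat N) h
    have hx' : ∀ q ∈ polyMat N, ipMat q h = ipMat q x := fun q hq => by
      have : ipMat q (h - x) = 0 := hxh q hq
      rw [ipMat_sub_right] at this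
      exact sub_eq_zero.1 this
    have hs : ∀ i j, ∀ f ∈ polyS N, ipS f (h i j) = ipS f (x i j) := fun i j f hf => by
      have := hx' _ (singleMat_mem i j hf)
      rwa [ipMat_singleMat, ipMat_singleMat] at this
    have hxp := mem_polyMat.1 hx
    -- The projection of `h` is again transverse traceless. Each defect, such as `x i j - x j i`,
    -- lies in `polyS N`, as does its derivative, so in its pairing with itself `x` may be replaced
    -- by `h`, for which the defect is zero.
    have hxT : IsTT x := by
      refine ⟨fun i j => sub_eq_zero.1 (ipS_self_eq_zero ?_), ipS_self_eq_zero ?_,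
        fun j => ipS_self_eq_zero ?_⟩
      · have hm := Submodule.sub_mem _ (hxp i j) (hxp j i)
        rw [ipS_sub_right, ← hs _ _ _ hm, ← hs _ _ _ hm, hh.symm i j, sub_self]
      · have hm := Submodule.add_mem _ (Submodule.add_mem _ (hxp 0 0) (hxp 1 1)) (hxp 2 2)
        rw [ipS_add_right, ipS_add_right, ← hs _ _ _ hm, ← hs _ _ _ hm, ← hs _ _ _ hm,
          ← ipS_add_right, ← ipS_add_right, hh.trace, ipS_zero_right]
      · have hm := Submodule.add_mem _ (Submodule.add_mem _ (eS_mem_polyS 0 N (hxp 0 j))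
          (eS_mem_polyS 1 N (hxp 1 j))) (eS_mem_polyS 2 N (hxp 2 j))
        rw [ipS_add_right, ipS_add_right, ipS_eS, ipS_eS, ipS_eS,
          ← hs _ _ _ (eS_mem_polyS 0 N hm), ← hs _ _ _ (eS_mem_polyS 1 N hm),
          ← hs _ _ _ (eS_mem_polyS 2 N hm), ← ipS_eS, ← ipS_eS, ← ipS_eS,
          ← ipS_add_right, ← ipS_add_right, hh.div, ipS_zero_right]
    -- A finite dimensional space on which the curl is symmetric. Its eigentensors are orthogonal to
    -- `h`, hence to the projection `x`, which lies in this space and so vanishes.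
    let T : Submodule ℂ MatS := polyMat N ⊓ ttSub
    have : FiniteDimensional ℂ T := Submodule.finiteDimensional_inf_left _ _
    let C : T →ₗ[ℂ] T := curlTT.restrict fun p hp => ⟨curlTT_mem_polyMat hp.1, IsTT.curlTT hp.2⟩
    have hx0 := eq_zero_of_orthogonal_eigenvectors matCore T C (fun p q => ipMat_curlTT p q)
      ⟨x, hx, hxT⟩ fun p r hp => by
        have h2 := H p r p.2.2 (congrArg Subtype.val hp)
        rwa [hx' _ p.2.1] at h2
    have hx0 : x = 0 := congrArg Subtype.val hx0
    intro q hq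
    rw [hx' q hq, hx0]
    simp [ipMat, ipS_zero_right]
  funext i j
  refine eq_zero_of_orthogonal_polyS fun N p hp => ?_
  have := key N _ (singleMat_mem i j hp)
  rwa [ipMat_singleMat] at this

/-! ### Potentials for curl-free and linearly flat tensors on the three-sphere -/

theorem exists_potential' {a b c : SmoothS} (h01 : eS 0 b - eS 1 a = 2 * c)
    (h02 : eS 0 c - eS 2 a = -2 * b) (h12 : eS 1 c - eS 2 b = 2 * a) :
    ∃ F : SmoothS, eS 0 F = a ∧ eS 1 F = b ∧ eS 2 F = c := by
  obtain ⟨F, hF⟩ := exists_potential ![a, b, c] fun i j => by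
    fin_cases i <;> fin_cases j <;> simp [Fin.sum_univ_three, bracket, two_smul']
    · exact h01
    · linear_combination h02
    · linear_combination -h01
    · exact h12
    · linear_combination -h02
    · linear_combination -h12
  exact ⟨F, hF 0, hF 1, hF 2⟩

/-- The restriction of a linear form to the sphere. -/
def linS (l : E4 →L[ℝ] ℝ) : SmoothS :=
  ⟨fun y => ((l y : ℝ) : ℂ), ((Complex.ofRealCLM.contDiff.comp l.contDiff).contMDiff).comp
      contMDiff_coe_sphere⟩

theorem linS_apply (l : E4 →L[ℝ] ℝ) (y : S3) : (linS l).1 y = ((l y : ℝ) : ℂ) := rfl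

theorem eS_linS (i : Fin 3) (l : E4 →L[ℝ] ℝ) : eS i (linS l) = linS (l.comp (J i)) := by
  ext y
  have h1 : HasDerivAt (fun θ : ℝ => (rot i θ y : E4)) (J i (y : E4)) 0 :=
    (hasDerivAt_flow i.succ (0, y)).snd
  have h2 := (Complex.ofRealCLM.comp l).hasFDerivAt
    (x := (rot i 0 y : E4)) |>.comp_hasDerivAt (0 : ℝ) h1
  exact h2.deriv

theorem coordS_eq (A : Fin 4) : coordS A = linS (EuclideanSpace.proj A) := rfl

/-- By the quaternion relations `J j ∘ J i` is `-δ` plus half a commutator. In invariant terms, the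
Hessian of a linear function on the unit sphere is minus the function times the metric. -/
theorem eS_eS_linS (i j : Fin 3) (l : E4 →L[ℝ] ℝ) :
    eS i (eS j (linS l)) = (if i = j then -linS l else 0)
      + (1 / 2 : ℂ) • ∑ k : Fin 3, bracket i.succ j.succ k.succ • eS k (linS l) := by
  have h : ∀ y : E4, J j (J i y) = (if i = j then -y else 0)
      + (1 / 2 : ℝ) • ∑ k : Fin 3, (bracket i.succ j.succ k.succ).re • J k y := fun y => by
    fin_cases i <;> fin_cases j <;> ext m <;> fin_cases m <;>
      simp [J, bracket, Fin.sum_univ_three, Fin.sum_univ_four, Matrix.mulVec, dotProduct]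
  simp only [eS_linS]
  ext y
  have h2 := congrArg (fun v => ((l v : ℝ) : ℂ)) (h y)
  simp only [map_add, map_smul, map_sum, smul_eq_mul, Complex.ofReal_add, Complex.ofReal_mul,
    Complex.ofReal_sum, bracket_ofReal] at h2
  have h3 : ((if i = j then -linS l else 0 : SmoothS)).1 y
      = ((l (if i = j then -(y : E4) else 0) : ℝ) : ℂ) := by
    split_ifs
    · rw [map_neg, Complex.ofReal_neg]; rfl
    · rw [map_zero]; rfl
  rw [SmoothS.add_apply, h3]
  refine h2.trans ?_
  congr 1
  simp [Fin.sum_univ_three, linS_apply]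
  ring

theorem proj_eq (A : Fin 4) (y : E4) : (EuclideanSpace.proj A : E4 →L[ℝ] ℝ) y = y A := rfl

theorem sum_coordS_eS (i : Fin 3) : ∑ A, coordS A * eS i (coordS A) = 0 := by
  ext y
  have h := inner_J_self i (y : E4)
  rw [PiLp.inner_apply, Fin.sum_univ_four] at h
  simp only [Fin.sum_univ_four, SmoothS.add_apply, SmoothS.mul_apply, coordS_eq, eS_linS, linS_apply,
    SmoothS.zero_apply, proj_eq, ContinuousLinearMap.comp_apply]
  simp only [RCLike.inner_apply, conj_trivial] at h
  refine Eq.trans ?_ ((congrArg ((↑) : ℝ → ℂ) (by linear_combination h : (y : E4) 0 * J i y 0 + (y : E4) 1 * J i y 1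
    + (y : E4) 2 * J i y 2 + (y : E4) 3 * J i y 3 = 0)).trans Complex.ofReal_zero)
  push_cast
  rfl

theorem sum_eS_coordS (i j : Fin 3) :
    ∑ A, eS i (coordS A) * eS j (coordS A) = if i = j then 1 else 0 := by
  ext y
  have h := inner_J_J i j (y : E4)
  rw [PiLp.inner_apply, Fin.sum_univ_four, norm_eq_of_mem_sphere y, one_pow] at h
  simp only [Fin.sum_univ_four, SmoothS.add_apply, SmoothS.mul_apply, coordS_eq, eS_linS, linS_apply,
    proj_eq, ContinuousLinearMap.comp_apply]
  simp only [RCLike.inner_apply, conj_trivial] at h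
  have h2 : ((if i = j then 1 else 0 : SmoothS)).1 y = ((if i = j then 1 else 0 : ℝ) : ℂ) := by
    split_ifs <;> simp
  rw [h2, ← h]
  push_cast
  ring

/-- The pointwise trace. -/
def trS (h : MatS) : SmoothS := h 0 0 + h 1 1 + h 2 2

/-- Multiples of the identity. -/
def diagS (f : SmoothS) : MatS := fun i j => if i = j then f else 0

theorem ipMat_diagS {p : MatS} (hp : IsTT p) (f : SmoothS) : ipMat p (diagS f) = 0 := by
  have : ipMat p (diagS f) = ipS (p 0 0 + p 1 1 + p 2 2) f := by
    simp [ipMat, diagS, Fin.sum_univ_three, ipS_zero_right, ipS_add_left]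
  rw [this, hp.trace, ipS_zero_left]

theorem ipMat_add_right (p q q' : MatS) : ipMat p (q + q') = ipMat p q + ipMat p q' := by
  simp only [ipMat, Pi.add_apply, ipS_add_right, Finset.sum_add_distrib]

/-- A symmetric tensor with the divergence of its trace, orthogonal to transverse traceless tensors,
is a Hessian plus a multiple of the metric. -/
theorem exists_hessian {K : MatS} (hs : ∀ i j, K i j = K j i)
    (hd : ∀ j, eS 0 (K 0 j) + eS 1 (K 1 j) + eS 2 (K 2 j) = eS j (trS K))
    (H : ∀ (p : MatS) (c : ℝ), IsTT p → curlTT p = (c : ℂ) • p → (c : ℂ) * ipMat p K = 0) :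
    ∃ f : SmoothS, ∀ i j, eS i (eS j f) + eS j (eS i f) = 2 * K i j - 2 * diagS f i j := by
  have h10 := hs 1 0
  have h20 := hs 2 0
  have h21 := hs 2 1
  have d0 := hd 0
  have d1 := hd 1
  have d2 := hd 2
  simp only [trS, h10, h20, h21, map_add] at d0 d1 d2
  -- For a symmetric `K` with trace, this is the full covariant curl. The divergence hypothesis
  -- makes it symmetric, and its pairing with an eigentensor is `c⟨p, K⟩`, so completeness makes `K`
  -- a Codazzi tensor.
  have hB : curlTT K + diagS (trS K) = 0 := by
    refine tt_complete ⟨fun i j => ?_, ?_, fun j => ?_⟩ fun p c hp hc => ?_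
    · have h01 : (curlTT K + diagS (trS K)) 0 1 = (curlTT K + diagS (trS K)) 1 0 := by
        simp only [Pi.add_apply, curlTT_apply, curlS_zero, curlS_one, h10, h20, h21, diagS]
        simp
        linear_combination d2
      have h02 : (curlTT K + diagS (trS K)) 0 2 = (curlTT K + diagS (trS K)) 2 0 := by
        simp only [Pi.add_apply, curlTT_apply, curlS_zero, curlS_two, h10, h20, h21, diagS]
        simp
        linear_combination -d1
      have h12 : (curlTT K + diagS (trS K)) 1 2 = (curlTT K + diagS (trS K)) 2 1 := by
        simp only [Pi.add_apply, curlTT_apply, curlS_one, curlS_two, h10, h20, h21, diagS]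
        simp
        linear_combination d0
      fin_cases i <;> fin_cases j <;> first | rfl | assumption | (symm; assumption)
    · simp only [Pi.add_apply, curlTT_apply, curlS_zero, curlS_one, curlS_two, h10, h20, h21, diagS,
        trS, if_true]
      ring
    · have h := hd j
      simp only [trS, map_add] at h
      have hdg : eS 0 (diagS (trS K) 0 j) + eS 1 (diagS (trS K) 1 j) + eS 2 (diagS (trS K) 2 j)
          = eS j (trS K) := by
        fin_cases j <;> simp [diagS]
      simp only [trS, map_add] at hdg
      simp only [Pi.add_apply, curlTT_apply, curlS_zero, curlS_one, curlS_two, map_sub, map_add,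
        eS_one_zero, eS_two_zero, eS_two_one, eS_ofNat_mul, trS]
      linear_combination -h + hdg
    · rw [ipMat_add_right, ipMat_diagS hp, ← ipMat_curlTT, hc, ipMat_smul_left, Complex.conj_ofReal,
        H p c hp hc, add_zero]
  have hB' : ∀ i j, curlS K i j = 3 * K i j - diagS (trS K) i j := fun i j => by
    have := congrFun (congrFun hB i) j
    rw [Pi.add_apply, Pi.add_apply, curlTT_apply] at this
    linear_combination (norm := (simp only [Pi.zero_apply]; ring)) this
  have e0 := fun j => (curlS_zero K j).symm.trans (hB' 0 j)
  have e1 := fun j => (curlS_one K j).symm.trans (hB' 1 j)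
  have e2 := fun j => (curlS_two K j).symm.trans (hB' 2 j)
  have hYY : ∀ i j A, eS i (eS j (coordS A)) = _ := fun i j A => eS_eS_linS i j (EuclideanSpace.proj A)
  -- For each coordinate `y_A` the one-form `K(·, grad y_A)` is closed: `K` is curl-free, and the
  -- Hessian of `y_A` is proportional to the metric.
  have hF : ∀ A, ∃ F : SmoothS, ∀ i, eS i F = K i 0 * eS 0 (coordS A) + K i 1 * eS 1 (coordS A)
      + K i 2 * eS 2 (coordS A) := fun A => by
    have y00 := hYY 0 0 A
    have y01 := hYY 0 1 A
    have y02 := hYY 0 2 A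
    have y10 := hYY 1 0 A
    have y11 := hYY 1 1 A
    have y12 := hYY 1 2 A
    have y20 := hYY 2 0 A
    have y21 := hYY 2 1 A
    have y22 := hYY 2 2 A
    simp [Fin.sum_univ_three, bracket, smul_smul, ← coordS_eq] at y00 y01 y02 y10 y11 y12 y20 y21 y22
    have a0 := e0 0
    have a1 := e0 1
    have a2 := e0 2
    have b0 := e1 0
    have b1 := e1 1
    have b2 := e1 2
    have c0 := e2 0
    have c1 := e2 1
    have c2 := e2 2
    simp [diagS, trS] at a0 a1 a2 b0 b1 b2 c0 c1 c2
    obtain ⟨F, f0, f1, f2⟩ := exists_potential'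
      (a := K 0 0 * eS 0 (coordS A) + K 0 1 * eS 1 (coordS A) + K 0 2 * eS 2 (coordS A))
      (b := K 1 0 * eS 0 (coordS A) + K 1 1 * eS 1 (coordS A) + K 1 2 * eS 2 (coordS A))
      (c := K 2 0 * eS 0 (coordS A) + K 2 1 * eS 1 (coordS A) + K 2 2 * eS 2 (coordS A))
      (by
        simp only [map_add, eS_mul, y00, y01, y02, y10, y11, y12, y20, y21, y22]
        rw [h10, h20, h21] at *
        linear_combination eS 0 (coordS A) * c0 + eS 1 (coordS A) * c1 + eS 2 (coordS A) * c2)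
      (by
        simp only [map_add, eS_mul, y00, y01, y02, y10, y11, y12, y20, y21, y22]
        rw [h10, h20, h21] at *
        linear_combination -eS 0 (coordS A) * b0 - eS 1 (coordS A) * b1 - eS 2 (coordS A) * b2)
      (by
        simp only [map_add, eS_mul, y00, y01, y02, y10, y11, y12, y20, y21, y22]
        rw [h10, h20, h21] at *
        linear_combination eS 0 (coordS A) * a0 + eS 1 (coordS A) * a1 + eS 2 (coordS A) * a2)
    exact ⟨F, fun i => by fin_cases i <;> assumption⟩
  choose F hF using hF
  -- The terms containing `dF_A` combine to `K(·, grad ½ Σ y_A²)`, which is zero on the unit sphere.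
  -- Hence one more derivative of `Σ F_A y_A` gives `K` minus that function times the metric.
  have hθ : ∀ i, eS i (∑ A, F A * coordS A) = ∑ A, F A * eS i (coordS A) := fun i => by
    have s0 := sum_coordS_eS 0
    have s1 := sum_coordS_eS 1
    have s2 := sum_coordS_eS 2
    simp only [map_add, eS_mul, hF, Fin.sum_univ_four] at s0 s1 s2 ⊢
    linear_combination K i 0 * s0 + K i 1 * s1 + K i 2 * s2
  refine ⟨∑ A, F A * coordS A, fun i j => ?_⟩
  have hsym : ∀ A, eS i (eS j (coordS A)) + eS j (eS i (coordS A))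
      = -2 * (if i = j then coordS A else 0) := fun A => by
    rw [hYY, hYY, ← coordS_eq]
    fin_cases i <;> fin_cases j <;> simp [Fin.sum_univ_three, bracket, smul_smul] <;> ring
  have hKi : ∀ i j, K i 0 * (∑ A, eS 0 (coordS A) * eS j (coordS A))
      + K i 1 * (∑ A, eS 1 (coordS A) * eS j (coordS A))
      + K i 2 * (∑ A, eS 2 (coordS A) * eS j (coordS A)) = K i j := fun i j => by
    simp only [sum_eS_coordS]
    fin_cases j <;> simp
  have k1 := hKi i j
  have k2 := hKi j i
  have g0 := hsym 0
  have g1 := hsym 1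
  have g2 := hsym 2
  have g3 := hsym 3
  have hdg : diagS (∑ A, F A * coordS A) i j = ∑ A, F A * (if i = j then coordS A else 0) := by
    unfold diagS; split_ifs <;> simp
  rw [hdg, hθ, hθ]
  simp only [map_add, eS_mul, hF, Fin.sum_univ_four] at k1 k2 ⊢
  linear_combination k1 + k2 + hs j i + F 0 * g0 + F 1 * g1 + F 2 * g2 + F 3 * g3

/-! ### Killing potentials on the three-sphere -/

theorem div_curlS (b : MatS) (j : Fin 3) :
    eS 0 (curlS b 0 j) + eS 1 (curlS b 1 j) + eS 2 (curlS b 2 j)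
      = 2 * (eS 0 (b 0 j) + eS 1 (b 1 j) + eS 2 (b 2 j)) := by
  simp only [curlS_zero, curlS_one, curlS_two, map_sub, eS_one_zero, eS_two_zero, eS_two_one]
  ring

/-- Left multiplication of quaternions by `i`, `j`, `k`. -/
def leftJ (i : Fin 3) : E4 →L[ℝ] E4 :=
  Matrix.toEuclideanCLM (n := Fin 4) (𝕜 := ℝ)
    (![!![0, -1, 0, 0; 1, 0, 0, 0; 0, 0, 0, -1; 0, 0, 1, 0],
       !![0, 0, -1, 0; 0, 0, 0, 1; 1, 0, 0, 0; 0, -1, 0, 0],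
       !![0, 0, 0, -1; 0, 0, -1, 0; 0, 1, 0, 0; 1, 0, 0, 0]] i)

theorem leftJ_J (i j : Fin 3) (y : E4) : leftJ i (J j y) = J j (leftJ i y) := by
  fin_cases i <;> fin_cases j <;> ext l <;> fin_cases l <;>
    simp [J, leftJ, Fin.sum_univ_four, Matrix.mulVec, dotProduct]

theorem inner_J_left (i : Fin 3) (x y : E4) : inner ℝ (J i x) y = -inner ℝ x (J i y) := by
  fin_cases i <;>
    simp [J, PiLp.inner_apply, Fin.sum_univ_four, Matrix.mulVec, dotProduct] <;> ring

theorem sum_inner_leftJ_J (n k : Fin 3) (y : E4) :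
    ∑ m, inner ℝ (leftJ m y) (J n y) * inner ℝ (leftJ m y) (J k y)
      = if n = k then (‖y‖ ^ 2) ^ 2 else 0 := by
  rw [EuclideanSpace.real_norm_sq_eq]
  fin_cases n <;> fin_cases k <;>
    simp [J, leftJ, PiLp.inner_apply, Fin.sum_univ_three, Fin.sum_univ_four, Matrix.mulVec,
      dotProduct] <;> ring

/-- The matrix relating the right invariant and the left invariant frame of the three-sphere. -/
def adS (m n : Fin 3) : SmoothS :=
  ⟨fun y => ((inner ℝ (leftJ m (y : E4)) (J n y) : ℝ) : ℂ), by
    have h : ContDiff ℝ ∞ fun y : E4 => ((inner ℝ (leftJ m y) (J n y) : ℝ) : ℂ) :=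
      Complex.ofRealCLM.contDiff.comp ((leftJ m).contDiff.inner ℝ (J n).contDiff)
    exact h.contMDiff.comp contMDiff_coe_sphere⟩

theorem SmoothS.sum_apply {ι : Type} (s : Finset ι) (f : ι → SmoothS) (y : S3) :
    (∑ i ∈ s, f i).1 y = ∑ i ∈ s, (f i).1 y := by
  classical
  induction s using Finset.induction_on with
  | empty => rfl
  | insert i s hi ih => rw [Finset.sum_insert hi, Finset.sum_insert hi, SmoothS.add_apply, ih]

/-- Right invariant fields commute with left invariant ones, so only the bracket of the frame
contributes. The rows of `adS` are thus parallel for a flat connection. -/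
theorem eS_adS (j m n : Fin 3) :
    eS j (adS m n) = ∑ k : Fin 3, bracket j.succ n.succ k.succ • adS m k := by
  ext y
  have h1 : HasDerivAt (fun θ : ℝ => (rot j θ y : E4)) (J j (y : E4)) 0 :=
    (hasDerivAt_flow j.succ (0, y)).snd
  have h0 : (rot j 0 y : E4) = y := by simp [rot]
  have h2 := (((leftJ m).hasFDerivAt.comp_hasDerivAt (0 : ℝ) h1).inner ℝ
    ((J n).hasFDerivAt.comp_hasDerivAt (0 : ℝ) h1)).ofReal_comp
  refine h2.deriv.trans ?_
  rw [leftJ_J, inner_J_left]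
  have h3 := congrArg (fun v => ((inner ℝ (leftJ m (y : E4)) v : ℝ) : ℂ)) (bracket_J j n (y : E4))
  simp only [inner_sub_right, inner_sum, inner_smul_right, Complex.ofReal_sum, Complex.ofReal_mul,
    bracket_ofReal] at h3
  rw [SmoothS.sum_apply]
  refine Eq.trans ?_ h3
  simp only [Function.comp_apply, h0]
  push_cast
  ring

theorem sum_adS_mul (n k : Fin 3) : ∑ m, adS m n * adS m k = if n = k then 1 else 0 := by
  ext y
  have h := congrArg ((↑) : ℝ → ℂ) (sum_inner_leftJ_J n k (y : E4))
  rw [norm_eq_of_mem_sphere y] at h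
  rw [SmoothS.sum_apply]
  refine Eq.trans ?_ (h.trans ?_)
  · push_cast; rfl
  · split_ifs <;> simp

/-- Potentials for the flat connection of the right invariant frame. -/
theorem exists_rotation_potential {b : MatS}
    (hG : ∀ i j, curlS b i j = 2 * b i j + 2 * b j i - 2 * diagS (trS b) i j) :
    ∃ z : Fin 3 → SmoothS, ∀ i j, eS i (z j) = b i j
      + ∑ k : Fin 3, bracket i.succ j.succ k.succ • z k := by
  -- Pairing the connection equation with a parallel row of `adS` removes the connection term and
  -- leaves a scalar one-form, closed exactly under `hG`.
  have hF : ∀ m, ∃ F : SmoothS, ∀ i, eS i F = ∑ n, adS m n * b i n := fun m => by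
    have o := fun j n => eS_adS j m n
    have o00 := o 0 0
    have o01 := o 0 1
    have o02 := o 0 2
    have o10 := o 1 0
    have o11 := o 1 1
    have o12 := o 1 2
    have o20 := o 2 0
    have o21 := o 2 1
    have o22 := o 2 2
    simp [Fin.sum_univ_three, bracket, two_smul'] at o00 o01 o02 o10 o11 o12 o20 o21 o22
    have g := hG
    have g0 := fun j => (curlS_zero b j).symm.trans (g 0 j)
    have g1 := fun j => (curlS_one b j).symm.trans (g 1 j)
    have g2 := fun j => (curlS_two b j).symm.trans (g 2 j)
    have a0 := g0 0
    have a1 := g0 1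
    have a2 := g0 2
    have b0 := g1 0
    have b1 := g1 1
    have b2 := g1 2
    have c0 := g2 0
    have c1 := g2 1
    have c2 := g2 2
    simp [diagS, trS] at a0 a1 a2 b0 b1 b2 c0 c1 c2
    obtain ⟨F, f0, f1, f2⟩ := exists_potential'
      (a := ∑ n, adS m n * b 0 n) (b := ∑ n, adS m n * b 1 n) (c := ∑ n, adS m n * b 2 n)
      (by
        simp only [Fin.sum_univ_three, map_add, eS_mul, o00, o01, o02, o10, o11, o12, o20, o21, o22]
        linear_combination adS m 0 * c0 + adS m 1 * c1 + adS m 2 * c2)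
      (by
        simp only [Fin.sum_univ_three, map_add, eS_mul, o00, o01, o02, o10, o11, o12, o20, o21, o22]
        linear_combination -adS m 0 * b0 - adS m 1 * b1 - adS m 2 * b2)
      (by
        simp only [Fin.sum_univ_three, map_add, eS_mul, o00, o01, o02, o10, o11, o12, o20, o21, o22]
        linear_combination adS m 0 * a0 + adS m 1 * a1 + adS m 2 * a2)
    exact ⟨F, fun i => by fin_cases i <;> assumption⟩
  choose F hF using hF
  -- The matrix `adS` is orthogonal, so its transpose recovers the frame components.
  refine ⟨fun n => ∑ m, adS m n * F m, fun i j => ?_⟩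
  have hb : ∑ n, (∑ m, adS m j * adS m n) * b i n = b i j := by
    simp only [sum_adS_mul]
    simp
  have h1 : ∀ m, adS m j * eS i (F m) = ∑ n, adS m j * adS m n * b i n := fun m => by
    rw [hF, Finset.mul_sum]
    exact Finset.sum_congr rfl fun n _ => by ring
  simp only [map_sum, eS_mul, Finset.sum_add_distrib, h1]
  rw [Finset.sum_comm (f := fun m n => adS m j * adS m n * b i n)]
  simp only [← Finset.sum_mul, hb, eS_adS]
  rw [add_comm]
  congr 1
  simp only [Finset.smul_sum, Finset.sum_mul, smul_mul_assoc]
  exact Finset.sum_comm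

/-- A symmetric tensor satisfying the linearized scalar constraint, and orthogonal to the transverse
traceless eigentensors that are not Killing-like, is a symmetrized derivative. -/
theorem exists_killing_potential {h : MatS} (hs : ∀ i j, h i j = h j i)
    (ham : (∑ i, eS i (eS i (trS h))) - (∑ i, ∑ j, eS i (eS j (h i j))) + 2 * trS h = 0)
    (H : ∀ (p : MatS) (c : ℝ), IsTT p → curlTT p = (c : ℂ) • p →
      ((c : ℂ) ^ 2 - 1) * ipMat p h = 0) :
    ∃ x : Fin 3 → SmoothS, ∀ i j, eS i (x j) + eS j (x i) = 2 * h i j := by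
  have h10 := hs 1 0
  have h20 := hs 2 0
  have h21 := hs 2 1
  -- If `h` were the symmetrized gradient of `x`, its infinitesimal rotation `z`, half the frame
  -- curl of `x`, would satisfy `eS i (z j) = b i j + ∑ k, bracket … • z k`. This `b` involves only
  -- `h`.
  obtain ⟨b, hb⟩ : ∃ b : MatS, ∀ j m, b j m = curlS h m j - 2 * h j m + diagS (trS h) j m :=
    ⟨_, fun _ _ => rfl⟩
  have htr : trS b = trS h := by
    simp only [trS, hb, curlS_zero, curlS_one, curlS_two, h10, h20, h21]
    simp [diagS, trS]
    ring
  -- The obstruction to solving for `z`. It is symmetric because the divergence of `b` is the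
  -- gradient of its trace, trace-free by the scalar constraint `ham`, and divergence-free
  -- identically.
  obtain ⟨G, hGd⟩ : ∃ G : MatS, ∀ i j,
      G i j = curlS b i j - 2 * b i j - 2 * b j i + 2 * diagS (trS h) i j := ⟨_, fun _ _ => rfl⟩
  have hdiag : ∀ (f : SmoothS) j,
      eS 0 (diagS f 0 j) + eS 1 (diagS f 1 j) + eS 2 (diagS f 2 j) = eS j f := fun f j => by
    fin_cases j <;> simp [diagS]
  have hdb : ∀ m, eS 0 (b m 0) + eS 1 (b m 1) + eS 2 (b m 2) = eS m (trS h) := fun m => by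
    have h1 := div_curlS h m
    have h2 := hdiag (trS h) m
    have h3 : ∀ i j, diagS (trS h) i j = diagS (trS h) j i := fun i j => by
      simp [diagS, eq_comm]
    simp only [hb, map_add, map_sub, eS_ofNat_mul, hs m, h3 m]
    linear_combination h1 + h2
  have htr' : ∀ i, eS i (b 0 0) + eS i (b 1 1) + eS i (b 2 2) = eS i (trS h) := fun i => by
    rw [← htr, trS, map_add, map_add]
  have hG0 : G = 0 := by
    refine tt_complete ⟨fun i j => ?_, ?_, fun j => ?_⟩ fun p c hp hc => ?_
    · have e0 := hdb 0
      have e1 := hdb 1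
      have e2 := hdb 2
      have f0 := htr' 0
      have f1 := htr' 1
      have f2 := htr' 2
      have h01 : G 0 1 = G 1 0 := by
        simp only [hGd, curlS_zero, curlS_one, diagS]
        simp
        linear_combination e2 - f2
      have h02 : G 0 2 = G 2 0 := by
        simp only [hGd, curlS_zero, curlS_two, diagS]
        simp
        linear_combination f1 - e1
      have h12 : G 1 2 = G 2 1 := by
        simp only [hGd, curlS_one, curlS_two, diagS]
        simp
        linear_combination e0 - f0
      fin_cases i <;> fin_cases j <;> first | rfl | assumption | (symm; assumption)
    · have h3 : G 0 0 + G 1 1 + G 2 2 = trS (curlS b) + 2 * trS h := by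
        simp only [hGd, trS] at htr ⊢
        simp [diagS, trS]
        linear_combination -4 * htr
      rw [h3]
      simp only [trS, Fin.sum_univ_three, h10, h20, h21, map_add, eS_one_zero, eS_two_zero, eS_two_one] at ham
      simp only [trS, curlS_zero, curlS_one, curlS_two, hb, h10, h20, h21, map_sub, map_add,
        eS_one_zero, eS_two_zero, eS_two_one, eS_ofNat_mul, diagS]
      simp
      linear_combination ham
    · have h1 := div_curlS b j
      have h2 := hdiag (trS h) j
      have h3 := hdb j
      simp only [hGd, map_sub, map_add, eS_ofNat_mul]
      linear_combination h1 + 2 * h2 - 2 * h3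
    · have ht : ∀ q : MatS, ipMat p (fun i j => q j i) = ipMat p q := fun q => by
        simp only [ipMat]
        rw [Finset.sum_comm]
        simp only [hp.symm]
      -- Each `curlS` moved onto `p` contributes `c + 3`. The zeroth order terms shift this to `c +
      -- 1` for `b` and `c - 1` for `G`, whence the product `c² - 1`.
      have hcurl : curlS p = (((c + 3 : ℝ)) : ℂ) • p := by
        have : curlS p = curlTT p + (3 : ℂ) • p := by simp [curlTT]
        rw [this, hc, ← add_smul]
        push_cast
        rfl
      have hip : ∀ q, ipMat p (curlS q) = ((c : ℂ) + 3) * ipMat p q := fun q => by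
        rw [← ipMat_curlS, hcurl, ipMat_smul_left, Complex.conj_ofReal]
        push_cast
        rfl
      have hbe : b = (fun i j => curlS h j i) - (2 : ℂ) • h + diagS (trS h) := by
        funext i j
        simp [hb, two_smul']
      have hGe : G = curlS b - (2 : ℂ) • b - (2 : ℂ) • (fun i j => b j i)
          + (2 : ℂ) • diagS (trS h) := by
        funext i j
        simp [hGd, two_smul']
      have htb : ipMat p (fun i j => b j i) = ipMat p b := ht b
      have hth : ipMat p (fun i j => curlS h j i) = ipMat p (curlS h) := ht _
      rw [hGe, ipMat_add_right, ipMat_sub_right, ipMat_sub_right, hip, ipMat_smul_right,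
        ipMat_smul_right, ipMat_smul_right, ipMat_diagS hp, htb, hbe, ipMat_add_right,
        ipMat_sub_right, ipMat_diagS hp, hth, hip, ipMat_smul_right]
      linear_combination H p c hp hc
  -- First integration, for the rotation `z`.
  obtain ⟨z, hz⟩ := exists_rotation_potential (b := b) fun i j => by
    have := congrFun (congrFun hG0 i) j
    rw [hGd] at this
    rw [htr]
    linear_combination (norm := (simp only [Pi.zero_apply]; ring)) this
  have z00 := hz 0 0
  have z01 := hz 0 1
  have z02 := hz 0 2
  have z10 := hz 1 0
  have z11 := hz 1 1
  have z12 := hz 1 2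
  have z20 := hz 2 0
  have z21 := hz 2 1
  have z22 := hz 2 2
  simp only [hb, curlS_zero, curlS_one, curlS_two] at z00 z01 z02 z10 z11 z12 z20 z21 z22
  simp [Fin.sum_univ_three, bracket, two_smul', diagS, trS] at z00 z01 z02 z10 z11 z12 z20 z21 z22
  simp only [h10, h20, h21] at z00 z01 z02 z10 z11 z12 z20 z21 z22
  -- Second integration: the gradient of `x` is `h` plus the antisymmetric matrix of `z`, and the
  -- equations for `z` are its closedness.
  obtain ⟨x0, p0, p1, p2⟩ := exists_potential' (a := h 0 0) (b := h 0 1 + -z 2) (c := h 0 2 + z 1)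
    (by simp only [map_add, map_neg]; linear_combination -z02)
    (by simp only [map_add, map_neg]; linear_combination z01)
    (by simp only [map_add, map_neg]; linear_combination z11 + z22)
  obtain ⟨x1, q0, q1, q2⟩ := exists_potential' (a := h 0 1 + z 2) (b := h 1 1) (c := h 1 2 + -z 0)
    (by simp only [map_add, map_neg]; linear_combination -z12)
    (by simp only [map_add, map_neg]; linear_combination -z00 - z22)
    (by simp only [map_add, map_neg]; linear_combination -z10)
  obtain ⟨x2, r0, r1, r2⟩ := exists_potential' (a := h 0 2 + -z 1) (b := h 1 2 + z 0) (c := h 2 2)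
    (by simp only [map_add, map_neg]; linear_combination z00 + z11)
    (by simp only [map_add, map_neg]; linear_combination z21)
    (by simp only [map_add, map_neg]; linear_combination -z20)
  refine ⟨![x0, x1, x2], fun i j => ?_⟩
  fin_cases i <;> fin_cases j <;>
    simp [p0, p1, p2, q0, q1, q2, r0, r1, r2, h10, h20, h21] <;> ring

/-! ### The Levi-Civita connection of de Sitter space in the frame -/

/-- The Hubble function `tanh t`. -/
def hub : SmoothM := ofTime Real.tanh (by
  have h : Real.tanh = fun t => Real.sinh t / Real.cosh t := funext Real.tanh_eq_sinh_div_cosh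
  rw [h]
  exact Real.contDiff_sinh.div Real.contDiff_cosh fun t => (Real.cosh_pos t).ne')

/-- The square of the scale factor, `cosh² t`. -/
def scl : SmoothM := ofTime _ contDiff_coshSq

/-- The inverse square of the scale factor. -/
def sclInv : SmoothM := ofTime _ contDiff_coshSq_inv

theorem e_zero_ofTime (c : ℝ → ℝ) (hc : ContDiff ℝ ∞ c) (p : Spacetime) :
    (e 0 (ofTime c hc)).1 p = ((deriv c p.1 : ℝ) : ℂ) := by
  have h : HasDerivAt (fun θ : ℝ => c (p.1 + θ)) (deriv c p.1) 0 := by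
    have := (hc.differentiable (by simp) (p.1 + 0)).hasDerivAt.comp_const_add p.1 0
    simpa using this
  exact h.ofReal_comp.deriv

theorem e_succ_ofTime (i : Fin 3) (c : ℝ → ℝ) (hc : ContDiff ℝ ∞ c) : e i.succ (ofTime c hc) = 0 := by
  ext p
  exact deriv_const (0 : ℝ) ((c p.1 : ℝ) : ℂ)

theorem scl_mul_sclInv : scl * sclInv = 1 := by
  ext p
  have h : Real.cosh p.1 ^ 2 * (Real.cosh p.1 ^ 2)⁻¹ = 1 :=
    mul_inv_cancel₀ (pow_ne_zero 2 (Real.cosh_pos _).ne')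
  exact (Complex.ofReal_mul _ _).symm.trans (by rw [h]; simp)

theorem sclInv_eq : sclInv = 1 - hub * hub := by
  ext p
  have h : (Real.cosh p.1 ^ 2)⁻¹ = 1 - Real.tanh p.1 * Real.tanh p.1 := by
    have := Real.cosh_sq p.1
    have h0 := (Real.cosh_pos p.1).ne'
    rw [Real.tanh_eq_sinh_div_cosh]
    field_simp
    linarith
  change (((Real.cosh p.1 ^ 2)⁻¹ : ℝ) : ℂ) = 1 - ((Real.tanh p.1 : ℝ) : ℂ) * ((Real.tanh p.1 : ℝ) : ℂ)
  rw [h]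
  push_cast
  rfl

theorem deriv_tanh' (t : ℝ) : deriv Real.tanh t = 1 - Real.tanh t * Real.tanh t := by
  have h : Real.tanh = fun t => Real.sinh t / Real.cosh t := funext Real.tanh_eq_sinh_div_cosh
  have h0 := (Real.cosh_pos t).ne'
  have h1 := ((Real.hasDerivAt_sinh t).div (Real.hasDerivAt_cosh t) h0).deriv
  rw [h]
  refine h1.trans ?_
  field_simp

@[simp] theorem e_zero_hub : e 0 hub = 1 - hub * hub := by
  ext p
  rw [hub, e_zero_ofTime, deriv_tanh', Complex.ofReal_sub, Complex.ofReal_mul, Complex.ofReal_one]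
  rfl

@[simp] theorem e_zero_scl : e 0 scl = 2 * hub * scl := by
  ext p
  have h1 : deriv (fun t => Real.cosh t ^ 2) p.1 = _ := ((Real.hasDerivAt_cosh p.1).pow 2).deriv
  rw [scl, e_zero_ofTime, h1]
  have h : Real.sinh p.1 = Real.tanh p.1 * Real.cosh p.1 := by
    rw [Real.tanh_eq_sinh_div_cosh, div_mul_cancel₀ _ (Real.cosh_pos _).ne']
  rw [h]
  refine Eq.trans ?_ (show (2 : ℂ) * ((Real.tanh p.1 : ℝ) : ℂ) * ((Real.cosh p.1 ^ 2 : ℝ) : ℂ) = _ from rfl)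
  change _ = (2 : ℂ) * ((Real.tanh p.1 : ℝ) : ℂ) * ((Real.cosh p.1 ^ 2 : ℝ) : ℂ)
  push_cast
  ring

@[simp] theorem e_succ_hub (i : Fin 3) : e i.succ hub = 0 := e_succ_ofTime i _ _
@[simp] theorem e_succ_scl (i : Fin 3) : e i.succ scl = 0 := e_succ_ofTime i _ _
@[simp] theorem e_one_hub : e 1 hub = 0 := e_succ_ofTime 0 _ _
@[simp] theorem e_two_hub : e 2 hub = 0 := e_succ_ofTime 1 _ _
@[simp] theorem e_three_hub : e 3 hub = 0 := e_succ_ofTime 2 _ _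
@[simp] theorem e_one_scl : e 1 scl = 0 := e_succ_ofTime 0 _ _
@[simp] theorem e_two_scl : e 2 scl = 0 := e_succ_ofTime 1 _ _
@[simp] theorem e_three_scl : e 3 scl = 0 := e_succ_ofTime 2 _ _

@[simp] theorem e_zero_sclInv : e 0 sclInv = -2 * hub * sclInv := by
  rw [sclInv_eq, map_sub, e_one, e_mul, e_zero_hub]
  ring

@[simp] theorem e_one_sclInv : e 1 sclInv = 0 := e_succ_ofTime 0 _ _
@[simp] theorem e_two_sclInv : e 2 sclInv = 0 := e_succ_ofTime 1 _ _
@[simp] theorem e_three_sclInv : e 3 sclInv = 0 := e_succ_ofTime 2 _ _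

@[simp] theorem e_one' (a : Fin 4) : e a 1 = 0 := e_one a

/-- The diagonal entries of the metric. -/
def gd : Fin 4 → SmoothM := ![-1, scl, scl, scl]

/-- The diagonal entries of the inverse metric. -/
def gi : Fin 4 → SmoothM := ![-1, sclInv, sclInv, sclInv]

theorem g_eq (a b : Fin 4) : g a b = if a = b then gd a else 0 := by
  fin_cases a <;> fin_cases b <;> rfl

theorem gInv_eq (a b : Fin 4) : gInv a b = if a = b then gi a else 0 := by
  fin_cases a <;> fin_cases b <;> rfl

theorem gd_mul_gi (a : Fin 4) : gd a * gi a = 1 := by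
  fin_cases a <;> simp [gd, gi, scl_mul_sclInv]

/-- The connection coefficients. -/
def Gam : Fin 4 → Fin 4 → Fin 4 → SmoothM :=
  ![![![0, 0, 0, 0], ![0, hub, 0, 0], ![0, 0, hub, 0], ![0, 0, 0, hub]],
    ![![0, hub, 0, 0], ![hub * scl, 0, 0, 0], ![0, 0, 0, 1], ![0, 0, -1, 0]],
    ![![0, 0, hub, 0], ![0, 0, 0, -1], ![hub * scl, 0, 0, 0], ![0, 1, 0, 0]],
    ![![0, 0, 0, hub], ![0, 0, 1, 0], ![0, -1, 0, 0], ![hub * scl, 0, 0, 0]]]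

theorem two_smulM (f : SmoothM) : (2 : ℂ) • f = 2 * f := by
  rw [Algebra.smul_def, map_ofNat]

theorem half_smul_eq {f h : SmoothM} (H : f = 2 * h) : (2⁻¹ : ℂ) • f = h := by
  rw [H, ← two_smulM, smul_smul]
  simp

theorem Γ_eq (a b d : Fin 4) : Γ a b d = Gam a b d := by
  have h := scl_mul_sclInv
  have h' : ∀ x : SmoothM, sclInv * (x * scl) = x := fun x => by linear_combination x * h
  unfold Γ
  simp only [gInv_eq, ite_mul, zero_mul, Finset.sum_ite_eq, Finset.mem_univ, if_true, one_div]
  refine half_smul_eq ?_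
  fin_cases a <;> fin_cases b <;> fin_cases d <;>
    simp [gi, gd, g_eq, Gam, Fin.sum_univ_four, bracket, two_smulM] <;>
    first | done | ring1 | linear_combination hub * 2 * h | linear_combination 2 * h


theorem bracket_swap (a b d : Fin 4) : bracket b a d = -bracket a b d := by
  revert a b d
  simp only [Fin.forall_fin_succ, Fin.forall_fin_zero_pi]
  simp [bracket]

theorem Riemann_swap (a b c d : Fin 4) : Riemann b a c d = -Riemann a b c d := by
  unfold Riemann
  simp only [bracket_swap a b, neg_smul, Finset.sum_add_distrib, Finset.sum_sub_distrib,
    Finset.sum_neg_distrib]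
  ring

set_option maxHeartbeats 1000000 in
theorem Riemann_eq_of_lt {a b : Fin 4} (hab : a < b) (c d : Fin 4) :
    Riemann a b c d = (if b = d then g a c else 0) - if a = d then g b c else 0 := by
  have h := scl_mul_sclInv
  rw [sclInv_eq] at h
  unfold Riemann
  simp only [Γ_eq, g_eq]
  fin_cases a <;> fin_cases b <;> first
    | exact absurd hab (by decide)
    | (clear hab; fin_cases c <;> fin_cases d <;>
        simp [Gam, gd, Fin.sum_univ_four, bracket, e_mul, two_smulM] <;>
        first | done | ring1 | linear_combination h | linear_combination -h)

/-- De Sitter space has constant curvature one. All later commutators of covariant derivatives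
reduce to this formula. -/
theorem Riemann_eq (a b c d : Fin 4) :
    Riemann a b c d = (if b = d then g a c else 0) - if a = d then g b c else 0 := by
  rcases lt_trichotomy a b with hab | rfl | hab
  · exact Riemann_eq_of_lt hab c d
  · have := Riemann_swap a a c d
    have h2 : (2 : ℂ) • Riemann a a c d = 0 := by
      rw [two_smul]
      linear_combination this
    rw [(smul_eq_zero.1 h2).resolve_left two_ne_zero, sub_self]
  · rw [Riemann_swap, Riemann_eq_of_lt hab]
    ring

theorem Ric_eq (a b : Fin 4) : Ric a b = 3 * g a b := by
  unfold Ric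
  simp only [Riemann_eq, if_true, Finset.sum_sub_distrib, Finset.sum_const, Finset.sum_ite_eq,
    Finset.mem_univ, Finset.card_univ, Fintype.card_fin, nsmul_eq_mul]
  push_cast
  ring

theorem torsion (a b d : Fin 4) : Γ a b d - Γ b a d = algebraMap ℂ SmoothM (bracket a b d) := by
  simp only [Γ_eq]
  fin_cases a <;> fin_cases b <;> fin_cases d <;> simp [Gam, bracket] <;>
    first | done | (norm_num; exact (map_ofNat (algebraMap ℂ SmoothM) 2).symm)

theorem metric_compat (a b c : Fin 4) :
    e a (g b c) = Γ a b c * gd c + Γ a c b * gd b := by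
  simp only [Γ_eq, g_eq]
  fin_cases a <;> fin_cases b <;> fin_cases c <;> simp [Gam, gd] <;> ring

theorem metric_compat_inv (a b c : Fin 4) :
    e a (gInv b c) = -(Γ a c b * gi c) - Γ a b c * gi b := by
  have h := scl_mul_sclInv
  simp only [Γ_eq, gInv_eq]
  fin_cases a <;> fin_cases b <;> fin_cases c <;> simp [Gam, gi] <;>
    first | done | ring1 | linear_combination hub * h

/-! ### Covariant derivatives and the Ricci identity -/

/-- The action of a matrix on one slot of a tensor. -/
def slot {k : ℕ} (M : Fin 4 → Fin 4 → SmoothM) (l : Fin k) (u : Tensor k) : Tensor k :=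
  fun i => ∑ d, M (i l) d * u (Function.update i l d)

/-- The covariant derivative along a frame vector field. -/
def covD {k : ℕ} (a : Fin 4) (u : Tensor k) : Tensor k :=
  fun i => e a (u i) - ∑ l, slot (Γ a) l u i

theorem slot_slot_of_ne {k : ℕ} (M N : Fin 4 → Fin 4 → SmoothM) {l l' : Fin k} (h : l ≠ l')
    (u : Tensor k) : slot M l (slot N l' u) = slot N l' (slot M l u) := by
  funext i
  simp only [slot, Finset.mul_sum]
  rw [Finset.sum_comm]
  refine Finset.sum_congr rfl fun d _ => Finset.sum_congr rfl fun d' _ => ?_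
  rw [Function.update_of_ne h.symm, Function.update_of_ne h, Function.update_comm h]
  ring

theorem slot_slot {k : ℕ} (M N : Fin 4 → Fin 4 → SmoothM) (l : Fin k) (u : Tensor k) :
    slot M l (slot N l u) = slot (fun x d => ∑ m, M x m * N m d) l u := by
  funext i
  simp only [slot, Finset.mul_sum, Finset.sum_mul, Function.update_self, Function.update_idem]
  rw [Finset.sum_comm]
  exact Finset.sum_congr rfl fun d _ => Finset.sum_congr rfl fun d' _ => by ring

theorem e_slot {k : ℕ} (a : Fin 4) (M : Fin 4 → Fin 4 → SmoothM) (l : Fin k) (u : Tensor k)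
    (i : Fin k → Fin 4) :
    e a (slot M l u i) = slot (fun x d => e a (M x d)) l u i + slot M l (fun j => e a (u j)) i := by
  simp only [slot, map_sum, e_mul, Finset.sum_add_distrib]

theorem slot_sub {k : ℕ} (M : Fin 4 → Fin 4 → SmoothM) (l : Fin k) (u v : Tensor k)
    (i : Fin k → Fin 4) : slot M l (fun j => u j - v j) i = slot M l u i - slot M l v i := by
  simp only [slot, mul_sub, Finset.sum_sub_distrib]

theorem slot_sum {k : ℕ} (M : Fin 4 → Fin 4 → SmoothM) (l : Fin k) (u : Fin k → Tensor k)
    (i : Fin k → Fin 4) : slot M l (fun j => ∑ m, u m j) i = ∑ m, slot M l (u m) i := by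
  simp only [slot, Finset.mul_sum]
  exact Finset.sum_comm

/-- Matrices acting on different slots commute, so only the diagonal terms of the double sum
survive. -/
theorem sum_slot_comm {k : ℕ} (M N : Fin 4 → Fin 4 → SmoothM) (u : Tensor k) (i : Fin k → Fin 4) :
    (∑ l, ∑ m, slot M l (slot N m u) i) - ∑ l, ∑ m, slot N l (slot M m u) i
      = ∑ l, slot (fun x d => ∑ m, (M x m * N m d - N x m * M m d)) l u i := by
  rw [Finset.sum_comm (f := fun l m => slot N l (slot M m u) i)]
  rw [← Finset.sum_sub_distrib]
  refine Finset.sum_congr rfl fun l _ => ?_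
  rw [← Finset.sum_sub_distrib, Finset.sum_eq_single l]
  · rw [slot_slot, slot_slot]
    simp only [slot, ← Finset.sum_sub_distrib, ← sub_mul]
  · intro m _ hm
    rw [slot_slot_of_ne M N hm.symm, sub_self]
  · exact fun h => absurd (Finset.mem_univ l) h

theorem covD_covD {k : ℕ} (a b : Fin 4) (u : Tensor k) (i : Fin k → Fin 4) :
    covD a (covD b u) i = e a (e b (u i)) - ∑ l, slot (fun x d => e a (Γ b x d)) l u i
      - ∑ l, slot (Γ b) l (fun j => e a (u j)) i - ∑ l, slot (Γ a) l (fun j => e b (u j)) i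
      + ∑ l, ∑ m, slot (Γ a) l (slot (Γ b) m u) i := by
  unfold covD
  simp only [slot_sub, map_sub, map_sum, e_slot, Finset.sum_add_distrib, Finset.sum_sub_distrib,
    slot_sum]
  ring

/-- The second covariant derivative. -/
def hess {k : ℕ} (a b : Fin 4) (u : Tensor k) : Tensor k :=
  fun i => covD a (covD b u) i - ∑ d, Γ a b d * covD d u i

/-- The Ricci identity. -/
theorem hess_sub_hess {k : ℕ} (a b : Fin 4) (u : Tensor k) (i : Fin k → Fin 4) :
    hess a b u i - hess b a u i = ∑ l, slot (Riemann a b) l u i := by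
  have h0 : ∑ d, bracket a b d • ∑ l, slot (Γ d) l u i
      = ∑ l, slot (fun x c => ∑ d, bracket a b d • Γ d x c) l u i := by
    simp only [slot, Finset.smul_sum, Finset.sum_mul, smul_mul_assoc]
    rw [Finset.sum_comm]
    exact Finset.sum_congr rfl fun l _ => Finset.sum_comm
  -- Vanishing torsion: the antisymmetric part of the connection is the bracket, which accounts for
  -- the commutator of the frame fields.
  have h1 : ∑ d, Γ a b d * covD d u i - ∑ d, Γ b a d * covD d u i
      = (e a (e b (u i)) - e b (e a (u i)))
        - ∑ l, slot (fun x c => ∑ d, bracket a b d • Γ d x c) l u i := by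
    rw [e_comm, ← Finset.sum_sub_distrib, ← h0, ← Finset.sum_sub_distrib]
    simp only [← sub_mul, torsion, covD, ← Algebra.smul_def, smul_sub]
  have h2 := sum_slot_comm (Γ a) (Γ b) u i
  have h3 : ∑ l, slot (Riemann a b) l u i = - ∑ l, slot (fun x d => e a (Γ b x d)) l u i
      + ∑ l, slot (fun x d => e b (Γ a x d)) l u i
      + ∑ l, slot (fun x d => ∑ m, (Γ a x m * Γ b m d - Γ b x m * Γ a m d)) l u i
      + ∑ l, slot (fun x c => ∑ d, bracket a b d • Γ d x c) l u i := by
    rw [← Finset.sum_neg_distrib, ← Finset.sum_add_distrib, ← Finset.sum_add_distrib,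
      ← Finset.sum_add_distrib]
    refine Finset.sum_congr rfl fun l _ => ?_
    simp only [slot, Riemann, Finset.sum_add_distrib, add_mul, neg_mul, Finset.sum_neg_distrib]
    ring
  rw [h3]
  unfold hess
  rw [covD_covD, covD_covD]
  linear_combination h2 - h1

theorem slot_Riemann {k : ℕ} (a b : Fin 4) (l : Fin k) (u : Tensor k) (i : Fin k → Fin 4) :
    slot (Riemann a b) l u i = g a (i l) * u (Function.update i l b)
      - g b (i l) * u (Function.update i l a) := by
  simp only [slot, Riemann_eq, sub_mul, Finset.sum_sub_distrib, ite_mul, zero_mul,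
    Finset.sum_ite_eq, Finset.mem_univ, if_true]

/-! ### Covariant derivatives of tensors of low rank -/

/-- The covariant derivative of a covector field. -/
def N1 (w : Fin 4 → SmoothM) (a b : Fin 4) : SmoothM := e a (w b) - ∑ d, Γ a b d * w d

/-- The covariant derivative of a tensor of rank two. -/
def N2 (u : Fin 4 → Fin 4 → SmoothM) (a b c : Fin 4) : SmoothM :=
  e a (u b c) - ∑ d, Γ a b d * u d c - ∑ d, Γ a c d * u b d

/-- The covariant derivative of a tensor of rank three. -/
def N3 (u : Fin 4 → Fin 4 → Fin 4 → SmoothM) (a b c d : Fin 4) : SmoothM :=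
  e a (u b c d) - ∑ m, Γ a b m * u m c d - ∑ m, Γ a c m * u b m d - ∑ m, Γ a d m * u b c m

/-- The covariant derivative of a tensor of rank four. -/
def N4 (u : Fin 4 → Fin 4 → Fin 4 → Fin 4 → SmoothM) (a b c d f : Fin 4) : SmoothM :=
  e a (u b c d f) - ∑ m, Γ a b m * u m c d f - ∑ m, Γ a c m * u b m d f
    - ∑ m, Γ a d m * u b c m f - ∑ m, Γ a f m * u b c d m

/-- A covector field as a tensor. -/
def ten1 (w : Fin 4 → SmoothM) : Tensor 1 := fun i => w (i 0)

/-- A matrix of functions as a tensor of rank two. -/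
def ten2 (u : Fin 4 → Fin 4 → SmoothM) : Tensor 2 := fun i => u (i 0) (i 1)

/-- An array of functions as a tensor of rank three. -/
def ten3 (u : Fin 4 → Fin 4 → Fin 4 → SmoothM) : Tensor 3 := fun i => u (i 0) (i 1) (i 2)

theorem covD_ten1 (a : Fin 4) (w : Fin 4 → SmoothM) : covD a (ten1 w) = ten1 (N1 w a) := by
  funext i
  simp [covD, ten1, N1, slot]

theorem covD_ten2 (a : Fin 4) (u : Fin 4 → Fin 4 → SmoothM) :
    covD a (ten2 u) = ten2 (N2 u a) := by
  funext i
  simp [covD, ten2, N2, slot, Fin.sum_univ_two]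
  ring

theorem covD_ten3 (a : Fin 4) (u : Fin 4 → Fin 4 → Fin 4 → SmoothM) :
    covD a (ten3 u) = ten3 (N3 u a) := by
  funext i
  simp [covD, ten3, N3, slot, Fin.sum_univ_three]
  ring

theorem N2_N1_sub (w : Fin 4 → SmoothM) (a b c : Fin 4) :
    N2 (N1 w) a b c - N2 (N1 w) b a c = g a c * w b - g b c * w a := by
  have h := hess_sub_hess a b (ten1 w) ![c]
  simp only [slot_Riemann, hess, covD_ten1] at h
  simp [ten1] at h
  rw [← h]
  simp only [N2, N1]
  ring

theorem N3_N2_sub (u : Fin 4 → Fin 4 → SmoothM) (a b c d : Fin 4) :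
    N3 (N2 u) a b c d - N3 (N2 u) b a c d
      = g a c * u b d - g b c * u a d + (g a d * u c b - g b d * u c a) := by
  have h := hess_sub_hess a b (ten2 u) ![c, d]
  simp only [slot_Riemann, hess, covD_ten2, Fin.sum_univ_two] at h
  simp [ten2] at h
  rw [← h]
  simp only [N3, N2]
  ring

theorem N4_N3_sub (u : Fin 4 → Fin 4 → Fin 4 → SmoothM) (a b c d f : Fin 4) :
    N4 (N3 u) a b c d f - N4 (N3 u) b a c d f
      = g a c * u b d f - g b c * u a d f + (g a d * u c b f - g b d * u c a f)
        + (g a f * u c d b - g b f * u c d a) := by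
  have h := hess_sub_hess a b (ten3 u) ![c, d, f]
  simp only [slot_Riemann, hess, covD_ten3, Fin.sum_univ_three] at h
  simp [ten3] at h
  rw [← h]
  simp only [N4, N3]
  ring

/-! ### Contractions and commutation of covariant derivatives -/

/-- The trace of a tensor of rank two. -/
def tr2 (u : Fin 4 → Fin 4 → SmoothM) : SmoothM := ∑ m, gi m * u m m

theorem tr2_add (u v : Fin 4 → Fin 4 → SmoothM) :
    tr2 (fun m n => u m n + v m n) = tr2 u + tr2 v := by
  simp only [tr2, mul_add, Finset.sum_add_distrib]

/-- Metric compatibility: the derivative of the inverse metric supplies precisely the connection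
terms of the covariant derivative. -/
theorem e_tr2 (a : Fin 4) (u : Fin 4 → Fin 4 → SmoothM) : e a (tr2 u) = tr2 (N2 u a) := by
  have h : ∑ m, e a (gi m) * u m m
      = -(∑ m, ∑ n, Γ a n m * gi n * u m n) - ∑ m, ∑ n, Γ a m n * gi m * u m n := by
    have h1 : ∑ m, e a (gi m) * u m m = ∑ m, ∑ n, e a (gInv m n) * u m n := by
      refine Finset.sum_congr rfl fun m _ => ?_
      rw [Finset.sum_eq_single m]
      · rw [gInv_eq, if_pos rfl]
      · intro n _ hn
        rw [gInv_eq, if_neg hn.symm, map_zero, zero_mul]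
      · exact fun h => absurd (Finset.mem_univ m) h
    rw [h1]
    simp only [metric_compat_inv, sub_mul, neg_mul, Finset.sum_sub_distrib, Finset.sum_neg_distrib]
  rw [Finset.sum_comm (f := fun m n => Γ a n m * gi n * u m n)] at h
  have h2 : ∀ F : Fin 4 → Fin 4 → SmoothM, ∑ n, ∑ m, Γ a n m * gi n * F n m
      = ∑ n, ∑ m, gi n * (Γ a n m * F n m) := fun F =>
    Finset.sum_congr rfl fun n _ => Finset.sum_congr rfl fun m _ => by ring
  rw [h2 fun n m => u m n, h2 fun m n => u m n] at h
  simp only [tr2, map_sum, e_mul, Finset.sum_add_distrib, N2, mul_sub, Finset.sum_sub_distrib,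
    Finset.mul_sum, h]
  ring

theorem N1_tr2 (T : Fin 4 → Fin 4 → Fin 4 → SmoothM) (a c : Fin 4) :
    N1 (fun c => tr2 fun m n => T m n c) a c = tr2 fun m n => N3 T a m n c := by
  have h : ∑ d, Γ a c d * tr2 (fun m n => T m n d) = ∑ m, gi m * ∑ d, Γ a c d * T m m d := by
    simp only [tr2, Finset.mul_sum]
    rw [Finset.sum_comm]
    exact Finset.sum_congr rfl fun m _ => Finset.sum_congr rfl fun d _ => by ring
  rw [N1, e_tr2, h]
  simp only [tr2, N2, N3, mul_sub, Finset.sum_sub_distrib]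

theorem N1_tr2_right (T : Fin 4 → Fin 4 → Fin 4 → SmoothM) (a c : Fin 4) :
    N1 (fun c => tr2 (T c)) a c = tr2 (N3 T a c) := by
  refine (N1_tr2 (fun m n c => T c m n) a c).trans ?_
  congr 1
  funext m n
  simp only [N3]
  ring

theorem N2_tr2 (T : Fin 4 → Fin 4 → Fin 4 → Fin 4 → SmoothM) (a c d : Fin 4) :
    N2 (fun c d => tr2 fun m n => T m n c d) a c d = tr2 fun m n => N4 T a m n c d := by
  have h : ∀ d, ∑ p, Γ a c p * tr2 (fun m n => T m n p d)
      = ∑ m, gi m * ∑ p, Γ a c p * T m m p d := fun d => by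
    simp only [tr2, Finset.mul_sum]
    rw [Finset.sum_comm]
    exact Finset.sum_congr rfl fun m _ => Finset.sum_congr rfl fun d _ => by ring
  have h' : ∀ c, ∑ p, Γ a d p * tr2 (fun m n => T m n c p)
      = ∑ m, gi m * ∑ p, Γ a d p * T m m c p := fun c => by
    simp only [tr2, Finset.mul_sum]
    rw [Finset.sum_comm]
    exact Finset.sum_congr rfl fun m _ => Finset.sum_congr rfl fun d _ => by ring
  rw [N2, e_tr2, h, h']
  simp only [tr2, N2, N4, mul_sub, Finset.sum_sub_distrib]

theorem N2_tr2_mid (T : Fin 4 → Fin 4 → Fin 4 → Fin 4 → SmoothM) (a c d : Fin 4) :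
    N2 (fun c d => tr2 fun m n => T m c n d) a c d = tr2 fun m n => N4 T a m c n d := by
  refine (N2_tr2 (fun m n c d => T m c n d) a c d).trans ?_
  congr 1
  funext m n
  simp only [N4]
  ring

theorem sum_gi_mul_g (c : Fin 4) (X : Fin 4 → SmoothM) : ∑ m, gi m * (g m c * X m) = X c := by
  rw [Finset.sum_eq_single c]
  · rw [g_eq, if_pos rfl]
    linear_combination X c * gd_mul_gi c
  · intro m _ hm
    rw [g_eq, if_neg hm, zero_mul, mul_zero]
  · exact fun h => absurd (Finset.mem_univ c) h

theorem g_symm (a b : Fin 4) : g a b = g b a := by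
  rw [g_eq, g_eq]
  by_cases h : a = b
  · rw [h]
  · rw [if_neg h, if_neg (Ne.symm h)]

theorem sum_gi_mul_g' (c : Fin 4) (X : Fin 4 → SmoothM) : ∑ m, gi m * (g c m * X m) = X c := by
  simp only [g_symm c, sum_gi_mul_g]

theorem sum_gi_mul_g_self (X : SmoothM) : ∑ m, gi m * (g m m * X) = 4 * X := by
  have : ∀ m, gi m * (g m m * X) = X := fun m => by
    rw [g_eq, if_pos rfl]
    linear_combination X * gd_mul_gi m
  simp only [this, Finset.sum_const, Finset.card_univ, Fintype.card_fin, nsmul_eq_mul]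
  norm_num

theorem N2_g_mul (f : SmoothM) (a b c : Fin 4) :
    N2 (fun b c => g b c * f) a b c = g b c * e a f := by
  have h : ∀ (X : Fin 4 → SmoothM) c, ∑ d, X d * (g d c * f) = X c * gd c * f := fun X c => by
    rw [Finset.sum_eq_single c]
    · rw [g_eq, if_pos rfl]; ring
    · intro m _ hm
      rw [g_eq, if_neg hm, zero_mul, mul_zero]
    · exact fun h => absurd (Finset.mem_univ c) h
  unfold N2
  simp only [g_symm b _, h]
  simp only [g_symm _ b, e_mul, metric_compat]
  ring

theorem N3_g_mul_right (w : Fin 4 → SmoothM) (a b c d : Fin 4) :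
    N3 (fun b c d => g c d * w b) a b c d = g c d * N1 w a b := by
  have h := N2_g_mul (w b) a c d
  have h2 : ∑ m, Γ a b m * (g c d * w m) = g c d * ∑ m, Γ a b m * w m := by
    rw [Finset.mul_sum]
    exact Finset.sum_congr rfl fun m _ => by ring
  simp only [N2] at h
  simp only [N3, N1, h2, mul_sub]
  linear_combination h

theorem N3_g_mul_mid (w : Fin 4 → SmoothM) (a b c d : Fin 4) :
    N3 (fun b c d => g b d * w c) a b c d = g b d * N1 w a c := by
  rw [← N3_g_mul_right]
  simp only [N3]
  ring

/-! ### D'Alembertians, divergence and Lie derivative of the metric, and their commutators -/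

/-- The d'Alembertian on functions. -/
def bx0 (f : SmoothM) : SmoothM := tr2 (N1 fun c => e c f)

/-- The d'Alembertian on covector fields. -/
def bx1 (w : Fin 4 → SmoothM) (c : Fin 4) : SmoothM := tr2 fun m n => N2 (N1 w) m n c

/-- The d'Alembertian on tensors of rank two. -/
def bx2 (u : Fin 4 → Fin 4 → SmoothM) (c d : Fin 4) : SmoothM := tr2 fun m n => N3 (N2 u) m n c d

/-- The divergence of a tensor of rank two. -/
def div2 (u : Fin 4 → Fin 4 → SmoothM) (c : Fin 4) : SmoothM := tr2 fun m n => N2 u m n c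

theorem tr2_bx2 (u : Fin 4 → Fin 4 → SmoothM) : tr2 (bx2 u) = bx0 (tr2 u) := by
  have h1 : (fun c => e c (tr2 u)) = fun c => tr2 (N2 u c) := funext fun c => e_tr2 c u
  have h2 : N1 (fun c => tr2 (N2 u c)) = fun m n => tr2 (N3 (N2 u) m n) :=
    funext fun m => funext fun n => N1_tr2_right (N2 u) m n
  rw [bx0, h1, h2]
  simp only [tr2, bx2, Finset.mul_sum]
  rw [Finset.sum_comm]
  exact Finset.sum_congr rfl fun m _ => Finset.sum_congr rfl fun d _ => by ring

theorem N2_add (u v : Fin 4 → Fin 4 → SmoothM) (a b c : Fin 4) :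
    N2 (fun b c => u b c + v b c) a b c = N2 u a b c + N2 v a b c := by
  simp only [N2, map_add, mul_add, Finset.sum_add_distrib]
  ring

theorem N2_swap (u : Fin 4 → Fin 4 → SmoothM) (a b c : Fin 4) :
    N2 (fun b c => u c b) a b c = N2 u a c b := by
  simp only [N2]
  ring

theorem N3_add (u v : Fin 4 → Fin 4 → Fin 4 → SmoothM) (a b c d : Fin 4) :
    N3 (fun b c d => u b c d + v b c d) a b c d = N3 u a b c d + N3 v a b c d := by
  simp only [N3, map_add, mul_add, Finset.sum_add_distrib]
  ring

theorem N3_sub (u v : Fin 4 → Fin 4 → Fin 4 → SmoothM) (a b c d : Fin 4) :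
    N3 (fun b c d => u b c d - v b c d) a b c d = N3 u a b c d - N3 v a b c d := by
  simp only [N3, map_sub, mul_sub, Finset.sum_sub_distrib]
  ring

theorem N3_swap (u : Fin 4 → Fin 4 → Fin 4 → SmoothM) (a b c d : Fin 4) :
    N3 (fun b c d => u c b d) a b c d = N3 u a c b d := by
  simp only [N3]
  ring

theorem N3_swap_right (u : Fin 4 → Fin 4 → Fin 4 → SmoothM) (a b c d : Fin 4) :
    N3 (fun b c d => u b d c) a b c d = N3 u a b d c := by
  simp only [N3]
  ring

/-- The derivative with index `b` is moved outward past the two contracted derivatives, one Ricci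
identity for each. -/
theorem N3_N2_N1 (w : Fin 4 → SmoothM) (m b c : Fin 4) :
    N3 (N2 (N1 w)) m m b c = N3 (N2 (N1 w)) b m m c
      + 2 * (g m c * N1 w m b) - 2 * (g b c * N1 w m m) + g m m * N1 w b c - g b m * N1 w m c := by
  have h0 : N2 (N1 w) = fun n b c => N2 (N1 w) b n c + (g n c * w b - g b c * w n) := by
    funext n b c
    linear_combination N2_N1_sub w n b c
  have h1 : N3 (N2 (N1 w)) m m b c = N3 (N2 (N1 w)) m b m c + (g m c * N1 w m b - g b c * N1 w m m) := by
    conv_lhs => rw [h0]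
    rw [N3_add, N3_sub, N3_swap, N3_g_mul_mid, N3_g_mul_right]
  have h2 := N3_N2_sub (N1 w) m b m c
  linear_combination h1 + h2

theorem bx2_N1 (w : Fin 4 → SmoothM) (b c : Fin 4) :
    bx2 (N1 w) b c = N1 (bx1 w) b c + 3 * N1 w b c + 2 * N1 w c b - 2 * g b c * tr2 (N1 w) := by
  have h1 : N1 (bx1 w) b c = ∑ m, gi m * N3 (N2 (N1 w)) b m m c := N1_tr2 (N2 (N1 w)) b c
  have h2 : ∑ m, gi m * (2 * (g m c * N1 w m b)) = 2 * N1 w c b := by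
    rw [← sum_gi_mul_g c fun m => N1 w m b, Finset.mul_sum]
    exact Finset.sum_congr rfl fun m _ => by ring
  have h3 : ∑ m, gi m * (2 * (g b c * N1 w m m)) = 2 * g b c * tr2 (N1 w) := by
    rw [tr2, Finset.mul_sum]
    exact Finset.sum_congr rfl fun m _ => by ring
  rw [bx2, tr2, h1]
  simp only [N3_N2_N1, mul_add, mul_sub, Finset.sum_add_distrib, Finset.sum_sub_distrib, h2, h3,
    sum_gi_mul_g_self, sum_gi_mul_g']
  ring

/-- The Lie derivative of the metric. -/
def lie (w : Fin 4 → SmoothM) (b c : Fin 4) : SmoothM := N1 w b c + N1 w c b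

theorem tr2_transpose (u : Fin 4 → Fin 4 → SmoothM) : tr2 (fun m n => u n m) = tr2 u := rfl

theorem tr2_lie (w : Fin 4 → SmoothM) : tr2 (lie w) = 2 * tr2 (N1 w) := by
  have h : tr2 (lie w) = tr2 (N1 w) + tr2 (fun m n => N1 w n m) :=
    tr2_add (N1 w) fun m n => N1 w n m
  rw [h, tr2_transpose, two_mul]

theorem bx2_lie (w : Fin 4 → SmoothM) (b c : Fin 4) :
    bx2 (lie w) b c = lie (bx1 w) b c + 5 * lie w b c - 2 * g b c * tr2 (lie w) := by
  have h0 : N2 (lie w) = fun a b c => N2 (N1 w) a b c + N2 (N1 w) a c b := by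
    funext a b c
    unfold lie
    rw [N2_add, N2_swap (N1 w)]
  have h1 : bx2 (lie w) b c = bx2 (N1 w) b c + bx2 (N1 w) c b := by
    unfold bx2
    rw [← tr2_add, h0]
    congr 1
    funext m n
    rw [N3_add, N3_swap_right (N2 (N1 w))]
  rw [h1, bx2_N1, bx2_N1, tr2_lie, g_symm c b]
  unfold lie
  ring

/-- For a divergence-free `w` the right side is `-d1 w`, so the transversality of `lie w` is
equivalent to the wave equation for `w`. -/
theorem div2_lie (w : Fin 4 → SmoothM) (c : Fin 4) :
    div2 (lie w) c = bx1 w c + e c (tr2 (N1 w)) + 3 * w c := by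
  have h0 : ∀ m, N2 (lie w) m m c = N2 (N1 w) m m c + (N2 (N1 w) c m m + (g m m * w c - g c m * w m)) :=
    fun m => by
      unfold lie
      rw [N2_add, N2_swap (N1 w)]
      linear_combination N2_N1_sub w m c m
  rw [div2, tr2, e_tr2, bx1, tr2, tr2]
  simp only [h0, mul_add, mul_sub, Finset.sum_add_distrib, Finset.sum_sub_distrib,
    sum_gi_mul_g_self, sum_gi_mul_g']
  ring

theorem N1_div2 (u : Fin 4 → Fin 4 → SmoothM) (n b : Fin 4) :
    N1 (div2 u) n b = tr2 (fun p q => N3 (N2 u) p n q b) - 3 * u n b + g n b * tr2 u - u b n := by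
  have h0 : N1 (div2 u) n b = ∑ p, gi p * N3 (N2 u) n p p b := N1_tr2 (N2 u) n b
  have h1 : ∀ p, N3 (N2 u) n p p b = N3 (N2 u) p n p b
      + (g n p * u p b - g p p * u n b + (g n b * u p p - g p b * u p n)) := fun p => by
    linear_combination N3_N2_sub u n p p b
  have h2 : ∑ p, gi p * (g n b * u p p) = g n b * tr2 u := by
    rw [tr2, Finset.mul_sum]
    exact Finset.sum_congr rfl fun m _ => by ring
  rw [h0]
  simp only [h1, mul_add, mul_sub, Finset.sum_add_distrib, Finset.sum_sub_distrib,
    sum_gi_mul_g_self, sum_gi_mul_g', sum_gi_mul_g, h2]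
  simp only [tr2]
  ring

theorem tr2_tr2_comm (T : Fin 4 → Fin 4 → Fin 4 → Fin 4 → SmoothM) :
    tr2 (fun m n => tr2 fun p q => T m n p q) = tr2 fun p q => tr2 fun m n => T m n p q := by
  simp only [tr2, Finset.mul_sum]
  rw [Finset.sum_comm]
  exact Finset.sum_congr rfl fun m _ => Finset.sum_congr rfl fun d _ => by ring

/-- The divergence is carried through the d'Alembertian with two Ricci identities. Constant
curvature leaves only multiples of the divergence and of the gradient of the trace. -/
theorem bx1_div2 {u : Fin 4 → Fin 4 → SmoothM} (hu : ∀ a b, u a b = u b a) (b : Fin 4) :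
    bx1 (div2 u) b = div2 (bx2 u) b - 5 * div2 u b + 2 * e b (tr2 u) := by
  have hT : ∀ m n b, N2 u m n b = N2 u m b n := fun m n b => by
    rw [← N2_swap]
    congr 1
    funext b c
    exact hu c b
  have h0 : N2 (N1 (div2 u)) = fun m n b => tr2 (fun p q => N4 (N3 (N2 u)) m p n q b)
      - 4 * N2 u m n b + g n b * e m (tr2 u) := by
    funext m n b
    rw [← N2_tr2_mid, ← N2_g_mul]
    have : N1 (div2 u) = fun n b => (tr2 (fun p q => N3 (N2 u) p n q b) + g n b * tr2 u)
        + (-4 : ℂ) • u n b := by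
      funext n b
      rw [N1_div2, hu b n, Algebra.smul_def, map_neg, map_ofNat]
      ring
    rw [this, N2_add, N2_add]
    have h4 : N2 (fun n b => (-4 : ℂ) • u n b) m n b = -4 * N2 u m n b := by
      simp only [N2, map_smul, mul_smul_comm, ← Finset.smul_sum, ← smul_sub]
      rw [Algebra.smul_def, map_neg, map_ofNat]
    rw [h4]
    ring
  have h1 : ∀ m p, N4 (N3 (N2 u)) m p m p b = N4 (N3 (N2 u)) p m m p b
      + (g m m * N2 u p p b - g p m * N2 u m p b + (g m p * N2 u m p b - g p p * N2 u m m b)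
        + (g m b * N2 u m p p - g p b * N2 u m p m)) := fun m p => by
    linear_combination N4_N3_sub (N2 u) m p m p b
  have h2 : ∑ m, gi m * ∑ p, gi p * N4 (N3 (N2 u)) p m m p b = div2 (bx2 u) b := by
    have : N2 (bx2 u) = fun p q b => tr2 fun m n => N4 (N3 (N2 u)) p m n q b := by
      funext p q b
      exact N2_tr2 (N3 (N2 u)) p q b
    rw [div2, this]
    exact tr2_tr2_comm fun m n p q => N4 (N3 (N2 u)) p m n q b
  have h3 : ∑ m, gi m * ∑ p, gi p * (g m m * N2 u p p b) = 4 * div2 u b := by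
    rw [← sum_gi_mul_g_self, div2, tr2]
    refine Finset.sum_congr rfl fun m _ => ?_
    rw [Finset.mul_sum (a := g m m)]
    congr 1
    exact Finset.sum_congr rfl fun m _ => by ring
  have h4 : ∀ m, ∑ p, gi p * (g m b * N2 u m p p) = g m b * ∑ p, gi p * N2 u m p p := fun m => by
    rw [Finset.mul_sum]
    exact Finset.sum_congr rfl fun m _ => by ring
  have h5 : ∑ m, gi m * N2 u m m b = div2 u b := rfl
  have h6 : ∑ p, gi p * N2 u b p p = e b (tr2 u) := (e_tr2 b u).symm
  rw [bx1, h0, tr2]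
  simp only [tr2, h1, mul_add, mul_sub, Finset.sum_add_distrib, Finset.sum_sub_distrib,
    sum_gi_mul_g_self, sum_gi_mul_g', sum_gi_mul_g, h2, h3, h4]
  simp only [hT _ b _]
  have h7 : ∑ m, gi m * (4 * N2 u m m b) = 4 * div2 u b := by
    rw [← h5, Finset.mul_sum]
    exact Finset.sum_congr rfl fun m _ => by ring
  rw [h5, h6, h7]
  simp only [tr2]
  ring

/-! ### The operators of linearized gravity on tensors of low rank -/

/-- The operator `D_1` on covector fields. -/
def d1 (w : Fin 4 → SmoothM) (c : Fin 4) : SmoothM := -bx1 w c - 3 * w c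

/-- The operator `D_2` on tensors of rank two. -/
def d2 (u : Fin 4 → Fin 4 → SmoothM) (b c : Fin 4) : SmoothM :=
  -bx2 u b c + 2 * u c b - 2 * tr2 u * g b c

/-- The scalar one half. -/
def hf : SmoothM := algebraMap ℂ SmoothM (1 / 2)

theorem two_mul_hf : 2 * hf = 1 := by
  rw [hf, ← map_ofNat (algebraMap ℂ SmoothM) 2, ← map_mul]
  norm_num

theorem half_smul (f : SmoothM) : (1 / 2 : ℂ) • f = hf * f := Algebra.smul_def _ _

/-- The trace reversed Lie derivative of the metric. -/
def kk (w : Fin 4 → SmoothM) (b c : Fin 4) : SmoothM :=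
  hf * (lie w b c - hf * tr2 (lie w) * g b c)

theorem ten1_cur (W : Tensor 1) : ten1 (fun c => W ![c]) = W := by
  funext i
  simp only [ten1]
  congr 1
  funext j
  fin_cases j
  rfl

theorem ten2_cur (U : Tensor 2) : ten2 (fun b c => U ![b, c]) = U := by
  funext i
  simp only [ten2]
  congr 1
  funext j
  fin_cases j <;> rfl

theorem sum_gInv (X : Fin 4 → Fin 4 → SmoothM) : ∑ a, ∑ b, gInv a b * X a b = tr2 X := by
  refine Finset.sum_congr rfl fun a _ => ?_
  simp only [gInv_eq, ite_mul, zero_mul, Finset.sum_ite_eq, Finset.mem_univ, if_true]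

theorem nabla_ten1 (w : Fin 4 → SmoothM) : nabla 1 (ten1 w) = ten2 (N1 w) :=
  funext fun i => congrFun (covD_ten1 (i 0) w) (Fin.tail i)

theorem nabla_ten2 (u : Fin 4 → Fin 4 → SmoothM) : nabla 2 (ten2 u) = ten3 (N2 u) :=
  funext fun i => congrFun (covD_ten2 (i 0) u) (Fin.tail i)

theorem nabla_ten3 (u : Fin 4 → Fin 4 → Fin 4 → SmoothM) (i : Fin 4 → Fin 4) :
    nabla 3 (ten3 u) i = N3 u (i 0) (i 1) (i 2) (i 3) :=
  congrFun (covD_ten3 (i 0) u) (Fin.tail i)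

theorem contract_apply (k : ℕ) (u : Tensor (k + 2)) (i : Fin k → Fin 4) :
    contract k u i = ∑ a, ∑ b, gInv a b * u (Fin.cons a (Fin.cons b i)) := rfl

theorem box_ten1 (w : Fin 4 → SmoothM) : box 1 (ten1 w) = ten1 (bx1 w) := by
  funext i
  rw [box, LinearMap.comp_apply, LinearMap.comp_apply, nabla_ten1, nabla_ten2,
    contract_apply]
  exact sum_gInv fun m n => N2 (N1 w) m n (i 0)

theorem box_ten2 (u : Fin 4 → Fin 4 → SmoothM) : box 2 (ten2 u) = ten2 (bx2 u) := by
  funext i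
  have h : nabla (2 + 1) (ten3 (N2 u)) = fun i => N3 (N2 u) (i 0) (i 1) (i 2) (i 3) :=
    funext (nabla_ten3 (N2 u))
  rw [box, LinearMap.comp_apply, LinearMap.comp_apply, nabla_ten2, h, contract_apply]
  exact sum_gInv fun m n => N3 (N2 u) m n (i 0) (i 1)

theorem codiff_ten2 (u : Fin 4 → Fin 4 → SmoothM) :
    K21star (ten2 u) = ten1 fun c => -2 * div2 u c := by
  funext i
  rw [K21star, codiff, LinearMap.smul_apply, LinearMap.comp_apply, nabla_ten2, Pi.smul_apply]
  have h : contract 1 (ten3 (N2 u)) i = div2 u (i 0) := sum_gInv fun m n => N2 u m n (i 0)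
  rw [h, Algebra.smul_def]
  have : algebraMap ℂ SmoothM (-(((1 : ℕ) : ℂ) + 1)) = -2 := by
    rw [map_neg, Nat.cast_one, one_add_one_eq_two, map_ofNat]
  rw [this]
  rfl

theorem trace_ten2 (u : Fin 4 → Fin 4 → SmoothM) : trace gInv (ten2 u) = tr2 u := sum_gInv u

theorem symD_ten1 (w : Fin 4 → SmoothM) : symD 1 (ten1 w) = ten2 fun b c => hf * lie w b c := by
  funext i
  have h : symD 1 (ten1 w) i = (1 / (Nat.factorial (1 + 1) : ℂ)) •
    ∑ s : Equiv.Perm (Fin (1 + 1)), nabla 1 (ten1 w) (i ∘ s) := rfl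
  rw [h, nabla_ten1]
  have h2 : ∑ s : Equiv.Perm (Fin (1 + 1)), ten2 (N1 w) (i ∘ s) = lie w (i 0) (i 1) := by
    rw [show (Finset.univ : Finset (Equiv.Perm (Fin (1 + 1)))) = {1, Equiv.swap 0 1} by decide,
      Finset.sum_pair (by decide)]
    simp [ten2, lie]
  have h3 : (Nat.factorial (1 + 1) : ℂ) = 2 := by norm_num [Nat.factorial]
  rw [h2, h3, half_smul]
  rfl

theorem K21_ten1 (w : Fin 4 → SmoothM) : K21 (ten1 w) = ten2 (kk w) := by
  funext i
  rw [K21, LinearMap.comp_apply, symD_ten1]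
  have h : traceReversal g gInv (ten2 fun b c => hf * lie w b c) i
    = hf * lie w (i 0) (i 1) - (1 / 2 : ℂ) • (trace gInv (ten2 fun b c => hf * lie w b c)
      * g (i 0) (i 1)) := rfl
  have h2 : tr2 (fun b c => hf * lie w b c) = hf * tr2 (lie w) := by
    simp only [tr2, Finset.mul_sum]
    exact Finset.sum_congr rfl fun m _ => by ring
  rw [h, trace_ten2, h2, half_smul]
  simp only [ten2, kk]
  ring

theorem D1_ten1 (w : Fin 4 → SmoothM) : D1 (ten1 w) = ten1 (d1 w) := by
  funext i
  have h : ricciOne (ten1 w) i = 3 * w (i 0) := by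
    have : ricciOne (ten1 w) i = ∑ b, ∑ c, Ric (i 0) b * gInv b c * w c := rfl
    rw [this]
    simp only [Ric_eq, gInv_eq, mul_ite, ite_mul, mul_zero, zero_mul, Finset.sum_ite_eq,
      Finset.mem_univ, if_true]
    rw [← sum_gi_mul_g' (i 0) w, Finset.mul_sum]
    exact Finset.sum_congr rfl fun m _ => by ring
  have h2 : D1 (ten1 w) i = -box 1 (ten1 w) i + ricciOne (ten1 w) i - (2 * Λ) • w (i 0) := rfl
  have h3 : algebraMap ℂ SmoothM (2 * Λ) = 6 := by
    rw [Λ, show (2 * 3 : ℂ) = 6 by norm_num, map_ofNat]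
  rw [h2, h, box_ten1, Algebra.smul_def, h3]
  simp only [ten1, d1]
  ring

/-- Both Ricci terms together give `6 u`, which cancels `-2Λ u`. The Riemann term gives the
transpose of `u` minus its trace times the metric. -/
theorem D2_ten2 (u : Fin 4 → Fin 4 → SmoothM) : D2 (ten2 u) = ten2 (d2 u) := by
  funext i
  have h : ricciTwo (ten2 u) i = 6 * u (i 0) (i 1) := by
    have : ricciTwo (ten2 u) i = (∑ b, ∑ c, Ric (i 0) b * gInv b c * u c (i 1))
      + ∑ b, ∑ c, Ric c (i 1) * gInv b c * u (i 0) b := rfl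
    rw [this]
    simp only [Ric_eq, gInv_eq, mul_ite, ite_mul, mul_zero, zero_mul, Finset.sum_ite_eq,
      Finset.mem_univ, if_true]
    have h1 : ∑ b, 3 * g (i 0) b * gi b * u b (i 1) = 3 * u (i 0) (i 1) := by
      rw [← sum_gi_mul_g' (i 0) fun b => u b (i 1), Finset.mul_sum]
      exact Finset.sum_congr rfl fun m _ => by ring
    have h2 : ∑ b, 3 * g b (i 1) * gi b * u (i 0) b = 3 * u (i 0) (i 1) := by
      rw [← sum_gi_mul_g (i 1) fun b => u (i 0) b, Finset.mul_sum]
      exact Finset.sum_congr rfl fun m _ => by ring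
    rw [h1, h2]
    ring
  have h' : riemOp (ten2 u) i = u (i 1) (i 0) - tr2 u * g (i 0) (i 1) := by
    have : riemOp (ten2 u) i = ∑ c, ∑ d, (∑ c', ∑ d', ∑ m,
      gInv c c' * gInv d d' * (Riemann (i 0) c' d' m * g m (i 1))) * u c d := rfl
    rw [this]
    have h1 : ∀ c d, ∑ m, Riemann (i 0) c d m * g m (i 1)
        = g (i 0) d * g c (i 1) - g c d * g (i 0) (i 1) := fun c d => by
      simp only [Riemann_eq, sub_mul, ite_mul, zero_mul, Finset.sum_sub_distrib, Finset.sum_ite_eq,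
        Finset.mem_univ, if_true]
    have h0 : ∀ c d, (∑ c', ∑ d', ∑ m,
        gInv c c' * gInv d d' * (Riemann (i 0) c' d' m * g m (i 1)))
        = gi c * gi d * (g (i 0) d * g c (i 1) - g c d * g (i 0) (i 1)) := fun c d => by
      simp only [← Finset.mul_sum, h1, gInv_eq]
      rw [Finset.sum_eq_single c, Finset.sum_eq_single d]
      · simp only [if_true]
      · intro m _ hm
        rw [if_neg hm.symm, mul_zero, zero_mul]
      · exact fun h => absurd (Finset.mem_univ d) h
      · intro m _ hm
        simp only [if_neg hm.symm, zero_mul, Finset.sum_const_zero]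
      · exact fun h => absurd (Finset.mem_univ c) h
    simp only [h0]
    have h2 : ∑ c, ∑ d, gi c * (gi d * (g (i 0) d * g c (i 1) * u c d)) = u (i 1) (i 0) := by
      rw [← sum_gi_mul_g (i 1) fun c => u c (i 0)]
      refine Finset.sum_congr rfl fun c _ => ?_
      rw [← sum_gi_mul_g' (i 0) fun d => u c d]
      simp only [Finset.mul_sum]
      exact Finset.sum_congr rfl fun m _ => by ring
    have h3 : ∑ c, ∑ d, gi c * (gi d * (g c d * (g (i 0) (i 1) * u c d)))
        = tr2 u * g (i 0) (i 1) := by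
      rw [tr2, Finset.sum_mul]
      refine Finset.sum_congr rfl fun c _ => ?_
      rw [← Finset.mul_sum, sum_gi_mul_g' c fun d => g (i 0) (i 1) * u c d]
      ring
    rw [← h2, ← h3, ← Finset.sum_sub_distrib]
    refine Finset.sum_congr rfl fun c _ => ?_
    rw [← Finset.sum_sub_distrib]
    exact Finset.sum_congr rfl fun m _ => by ring
  have h2 : D2 (ten2 u) i = -box 2 (ten2 u) i + ricciTwo (ten2 u) i + (2 : ℂ) • riemOp (ten2 u) i
    - (2 * Λ) • u (i 0) (i 1) := rfl
  have h3 : algebraMap ℂ SmoothM (2 * Λ) = 6 := by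
    rw [Λ, show (2 * 3 : ℂ) = 6 by norm_num, map_ofNat]
  rw [h2, h, h', box_ten2, two_smulM, Algebra.smul_def, h3]
  simp only [ten2, d2]
  ring

theorem mem_symTensor_ten2 {u : Fin 4 → Fin 4 → SmoothM} :
    ten2 u ∈ symTensor 2 ↔ ∀ b c, u b c = u c b := by
  constructor
  · intro h b c
    have := h (Equiv.swap 0 1) ![c, b]
    simpa [ten2] using this
  · intro h s i
    rcases (by decide : ∀ s : Equiv.Perm (Fin 2), s = 1 ∨ s = Equiv.swap 0 1) s with rfl | rfl
    · rfl
    · simp [ten2, h (i 0)]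

theorem mem_symTensor_one (W : Tensor 1) : W ∈ symTensor 1 := fun s i => by
  rw [Subsingleton.elim s 1]
  rfl

/-! ### Intertwining relations -/

theorem tr2_g_mul (f : SmoothM) : tr2 (fun b c => f * g b c) = 4 * f := by
  rw [← sum_gi_mul_g_self, tr2]
  exact Finset.sum_congr rfl fun m _ => by ring

/-- The trace terms from `bx2_lie` and from `d2` cancel, and the remaining constants `-5 + 2` are
the `-3` of `d1`. -/
theorem d2_lie (w : Fin 4 → SmoothM) : d2 (lie w) = lie (d1 w) := by
  funext b c
  have h : ∀ b c, N1 (d1 w) b c = -N1 (bx1 w) b c - 3 * N1 w b c := fun b c => by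
    have h3 : ∀ x, e b (3 * x) = 3 * e b x := fun x => by
      rw [← map_ofNat (algebraMap ℂ SmoothM) 3, ← Algebra.smul_def, map_smul, Algebra.smul_def]
    simp only [N1, d1, map_sub, map_neg, h3, mul_sub, mul_neg, Finset.sum_sub_distrib,
      Finset.sum_neg_distrib, Finset.mul_sum]
    have : ∑ d, Γ b c d * (3 * w d) = ∑ d, 3 * (Γ b c d * w d) :=
      Finset.sum_congr rfl fun m _ => by ring
    rw [this]
    ring
  rw [d2, bx2_lie]
  unfold lie
  rw [h, h]
  ring

/-- The trace of a solution satisfies a scalar wave equation of its own, so the traceless condition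
propagates from the Cauchy surface. -/
theorem tr2_d2 (u : Fin 4 → Fin 4 → SmoothM) : tr2 (d2 u) = -bx0 (tr2 u) - 6 * tr2 u := by
  have h := tr2_g_mul (2 * tr2 u)
  rw [← tr2_bx2]
  have h2 : ∀ T, tr2 (fun b c => -bx2 u b c + 2 * u c b - 2 * T * g b c)
      = -tr2 (bx2 u) + 2 * tr2 u - tr2 (fun b c => 2 * T * g b c) := fun T => by
    simp only [tr2, Finset.mul_sum]
    rw [← Finset.sum_neg_distrib, ← Finset.sum_add_distrib, ← Finset.sum_sub_distrib]
    exact Finset.sum_congr rfl fun m _ => by ring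
  refine (h2 (tr2 u)).trans ?_
  rw [h]
  ring

theorem e_ofNat_mul (a : Fin 4) (n : ℕ) [n.AtLeastTwo] (f : SmoothM) :
    e a ((ofNat(n) : SmoothM) * f) = (ofNat(n) : SmoothM) * e a f := by
  have h := map_nsmul (e a) (OfNat.ofNat n) f
  simpa [nsmul_eq_mul] using h

theorem e_hf_mul (a : Fin 4) (f : SmoothM) : e a (hf * f) = hf * e a f := by
  rw [← half_smul, map_smul, half_smul]

theorem div2_g_mul (f : SmoothM) (c : Fin 4) : div2 (fun b c => g b c * f) c = e c f := by
  simp only [div2, tr2, N2_g_mul]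
  exact sum_gi_mul_g c fun m => e m f

theorem bx2_g_mul (f : SmoothM) (b c : Fin 4) : bx2 (fun b c => g b c * f) b c = g b c * bx0 f := by
  have h : N2 (fun b c => g b c * f) = fun a b c => g b c * e a f := by
    funext a b c
    exact N2_g_mul f a b c
  rw [bx2, h, bx0]
  simp only [N3_g_mul_right, tr2, Finset.mul_sum]
  exact Finset.sum_congr rfl fun m _ => by ring

theorem N2_smul (c : ℂ) (u : Fin 4 → Fin 4 → SmoothM) (a b d : Fin 4) :
    N2 (fun b d => c • u b d) a b d = c • N2 u a b d := by
  simp only [N2, map_smul, mul_smul_comm, ← Finset.smul_sum, ← smul_sub]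

theorem N3_smul (k : ℂ) (u : Fin 4 → Fin 4 → Fin 4 → SmoothM) (a b c d : Fin 4) :
    N3 (fun b c d => k • u b c d) a b c d = k • N3 u a b c d := by
  simp only [N3, map_smul, mul_smul_comm, ← Finset.smul_sum, ← smul_sub]

theorem N1_smul (k : ℂ) (w : Fin 4 → SmoothM) (a b : Fin 4) :
    N1 (fun b => k • w b) a b = k • N1 w a b := by
  simp only [N1, map_smul, mul_smul_comm, ← Finset.smul_sum, ← smul_sub]

theorem tr2_smul (k : ℂ) (u : Fin 4 → Fin 4 → SmoothM) :
    tr2 (fun b c => k • u b c) = k • tr2 u := by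
  simp only [tr2, mul_smul_comm, Finset.smul_sum]

theorem bx2_add (u v : Fin 4 → Fin 4 → SmoothM) (b c : Fin 4) :
    bx2 (fun b c => u b c + v b c) b c = bx2 u b c + bx2 v b c := by
  have h : N2 (fun b c => u b c + v b c) = fun a b c => N2 u a b c + N2 v a b c := by
    funext a b c
    exact N2_add u v a b c
  simp only [bx2, h, N3_add, tr2_add]

theorem bx2_smul (k : ℂ) (u : Fin 4 → Fin 4 → SmoothM) (b c : Fin 4) :
    bx2 (fun b c => k • u b c) b c = k • bx2 u b c := by
  have h : N2 (fun b c => k • u b c) = fun a b c => k • N2 u a b c := by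
    funext a b c
    exact N2_smul k u a b c
  simp only [bx2, h, N3_smul, tr2_smul]

theorem div2_add (u v : Fin 4 → Fin 4 → SmoothM) (c : Fin 4) :
    div2 (fun b c => u b c + v b c) c = div2 u c + div2 v c := by
  simp only [div2, N2_add, tr2_add]

theorem div2_smul (k : ℂ) (u : Fin 4 → Fin 4 → SmoothM) (c : Fin 4) :
    div2 (fun b c => k • u b c) c = k • div2 u c := by
  simp only [div2, N2_smul, tr2_smul]

theorem d2_add (u v : Fin 4 → Fin 4 → SmoothM) (b c : Fin 4) :
    d2 (fun b c => u b c + v b c) b c = d2 u b c + d2 v b c := by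
  simp only [d2, bx2_add, tr2_add]
  ring

theorem d2_smul (k : ℂ) (u : Fin 4 → Fin 4 → SmoothM) (b c : Fin 4) :
    d2 (fun b c => k • u b c) b c = k • d2 u b c := by
  rw [d2, bx2_smul, tr2_smul, d2, Algebra.smul_def, Algebra.smul_def, Algebra.smul_def,
    Algebra.smul_def]
  ring

theorem d2_g_mul (f : SmoothM) (b c : Fin 4) :
    d2 (fun b c => g b c * f) b c = g b c * (-bx0 f - 6 * f) := by
  have h : tr2 (fun b c => g b c * f) = 4 * f := by
    rw [← tr2_g_mul]
    simp only [mul_comm]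
  rw [d2, bx2_g_mul, h, g_symm c b]
  ring

theorem kk_eq (w : Fin 4 → SmoothM) : kk w = fun b c => (1 / 2 : ℂ) • lie w b c
    + (-(1 / 4) : ℂ) • (g b c * tr2 (lie w)) := by
  funext b c
  have : algebraMap ℂ SmoothM (-(1 / 4)) = -(hf * hf) := by
    rw [hf, ← map_mul, ← map_neg]
    norm_num
  rw [kk, half_smul, Algebra.smul_def, this]
  ring

theorem tr2_lie_d1 (w : Fin 4 → SmoothM) :
    tr2 (lie (d1 w)) = -bx0 (tr2 (lie w)) - 6 * tr2 (lie w) := by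
  rw [← d2_lie, tr2_d2]

/-- `D_2 K_21 = K_21 D_1`. -/
theorem d2_kk (w : Fin 4 → SmoothM) : d2 (kk w) = kk (d1 w) := by
  funext b c
  rw [kk_eq, kk_eq, d2_add, d2_smul, d2_smul, d2_g_mul, ← tr2_lie_d1]
  congr 2
  exact congrFun (congrFun (d2_lie w) b) c

/-- `D_1 K_21^⋆ = K_21^⋆ D_2` on symmetric tensors. -/
theorem d1_div2 {u : Fin 4 → Fin 4 → SmoothM} (hu : ∀ a b, u a b = u b a) (c : Fin 4) :
    d1 (div2 u) c = div2 (d2 u) c := by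
  have h : d2 u = fun b c => ((-1 : ℂ) • bx2 u b c + (2 : ℂ) • u b c)
      + (-2 : ℂ) • (g b c * tr2 u) := by
    funext b c
    rw [d2, hu c b, two_smulM, neg_smul, neg_smul, one_smul, two_smulM]
    ring
  rw [h, div2_add, div2_add, div2_smul, div2_smul, div2_smul, div2_g_mul, d1, bx1_div2 hu,
    two_smulM, neg_smul, neg_smul, one_smul, two_smulM]
  change _ = -div2 (bx2 u) c + 2 * div2 u c + _
  ring

/-! ### Uniqueness for the Cauchy problem -/

theorem e_mul_mem_jetIdeal {ι : Type} [Fintype ι] {w : ι → SmoothM} (a : Fin 4) (f : SmoothM)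
    (I : ι) : e a (f * w I) ∈ jetIdeal w := by
  rw [e_mul]
  exact (jetIdeal w).add_mem ((jetIdeal w).mul_mem_left _ (mem_jetIdeal w I))
    ((jetIdeal w).mul_mem_left _ (e_mem_jetIdeal w a I))

/-- The principal part acts diagonally on components. All connection terms are of first order and
belong to the ideal, which is the form required by `wave_unique`. -/
theorem bx1_sub_mem (w : Fin 4 → SmoothM) (c : Fin 4) :
    bx1 w c - ∑ m, gi m * e m (e m (w c)) ∈ jetIdeal w := by
  have hN : ∀ a b, N1 w a b ∈ jetIdeal w := fun a b =>
    (jetIdeal w).sub_mem (e_mem_jetIdeal w a b)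
      ((jetIdeal w).sum_mem fun d _ => (jetIdeal w).mul_mem_left _ (mem_jetIdeal w d))
  rw [bx1, tr2, ← Finset.sum_sub_distrib]
  refine (jetIdeal w).sum_mem fun m _ => ?_
  rw [← mul_sub]
  refine (jetIdeal w).mul_mem_left _ ?_
  have h : N2 (N1 w) m m c - e m (e m (w c)) = -(∑ d, e m (Γ m c d * w d))
      - ∑ d, Γ m m d * N1 w d c - ∑ d, Γ m c d * N1 w m d := by
    simp only [N2, N1, map_sub, map_sum]
    ring
  rw [h]
  refine (jetIdeal w).sub_mem ((jetIdeal w).sub_mem ((jetIdeal w).neg_mem ?_) ?_) ?_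
  · exact (jetIdeal w).sum_mem fun d _ => e_mul_mem_jetIdeal m _ d
  · exact (jetIdeal w).sum_mem fun d _ => (jetIdeal w).mul_mem_left _ (hN _ _)
  · exact (jetIdeal w).sum_mem fun d _ => (jetIdeal w).mul_mem_left _ (hN _ _)

theorem bx2_sub_mem (u : Fin 4 → Fin 4 → SmoothM) (b c : Fin 4) :
    bx2 u b c - ∑ m, gi m * e m (e m (u b c)) ∈ jetIdeal fun I : Fin 4 × Fin 4 => u I.1 I.2 := by
  set K := jetIdeal fun I : Fin 4 × Fin 4 => u I.1 I.2 with hK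
  have hu : ∀ b c, u b c ∈ K := fun b c => mem_jetIdeal (fun I : Fin 4 × Fin 4 => u I.1 I.2) (b, c)
  have he : ∀ a b c, e a (u b c) ∈ K := fun a b c =>
    e_mem_jetIdeal (fun I : Fin 4 × Fin 4 => u I.1 I.2) a (b, c)
  have hm : ∀ a f b c, e a (f * u b c) ∈ K := fun a f b c =>
    e_mul_mem_jetIdeal (w := fun I : Fin 4 × Fin 4 => u I.1 I.2) a f (b, c)
  have hN : ∀ a b c, N2 u a b c ∈ K := fun a b c =>
    K.sub_mem (K.sub_mem (he a b c) (K.sum_mem fun d _ => K.mul_mem_left _ (hu d c)))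
      (K.sum_mem fun d _ => K.mul_mem_left _ (hu b d))
  rw [bx2, tr2, ← Finset.sum_sub_distrib]
  refine K.sum_mem fun m _ => ?_
  rw [← mul_sub]
  refine K.mul_mem_left _ ?_
  have h : N3 (N2 u) m m b c - e m (e m (u b c)) = -(∑ d, e m (Γ m b d * u d c))
      - (∑ d, e m (Γ m c d * u b d)) - ∑ d, Γ m m d * N2 u d b c - ∑ d, Γ m b d * N2 u m d c
      - ∑ d, Γ m c d * N2 u m b d := by
    simp only [N3, N2, map_sub, map_sum]
    ring
  rw [h]
  refine K.sub_mem (K.sub_mem (K.sub_mem (K.sub_mem (K.neg_mem ?_) ?_) ?_) ?_) ?_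
  · exact K.sum_mem fun d _ => hm _ _ _ _
  · exact K.sum_mem fun d _ => hm _ _ _ _
  · exact K.sum_mem fun d _ => K.mul_mem_left _ (hN _ _ _)
  · exact K.sum_mem fun d _ => K.mul_mem_left _ (hN _ _ _)
  · exact K.sum_mem fun d _ => K.mul_mem_left _ (hN _ _ _)

theorem sum_gi_e_e (f : SmoothM) : ∑ m, gi m * e m (e m f)
    = -(e 0 (e 0 f) - gInv 1 1 * ∑ i : Fin 3, e i.succ (e i.succ f)) := by
  rw [Fin.sum_univ_succ, Finset.mul_sum, neg_sub, sub_eq_add_neg, add_comm]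
  congr 1
  exact neg_one_mul _

theorem d2_unique {u : Fin 4 → Fin 4 → SmoothM} (h : ∀ b c, d2 u b c = 0)
    (h0 : ∀ b c, restrict (u b c) = 0) (h1 : ∀ b c, restrict (e 0 (u b c)) = 0) (b c : Fin 4) :
    u b c = 0 := by
  refine wave_unique (w := fun I : Fin 4 × Fin 4 => u I.1 I.2) (fun I => ?_) (fun I => h0 _ _)
    (fun I => h1 _ _) (b, c)
  have hu : ∀ b c, u b c ∈ jetIdeal fun I : Fin 4 × Fin 4 => u I.1 I.2 := fun b c =>
    mem_jetIdeal (fun I : Fin 4 × Fin 4 => u I.1 I.2) (b, c)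
  have h2 := bx2_sub_mem u I.1 I.2
  rw [sum_gi_e_e, sub_neg_eq_add] at h2
  have h3 : bx2 u I.1 I.2 = 2 * u I.2 I.1 - ∑ m, 2 * gi m * g I.1 I.2 * u m m := by
    have h4 : ∑ m, 2 * gi m * g I.1 I.2 * u m m = 2 * tr2 u * g I.1 I.2 := by
      rw [tr2, Finset.mul_sum, Finset.sum_mul]
      exact Finset.sum_congr rfl fun m _ => by ring
    have := h I.1 I.2
    rw [d2] at this
    rw [h4]
    linear_combination -this
  refine (Submodule.add_mem_iff_right _ ?_).1 h2
  rw [h3]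
  exact Ideal.sub_mem _ (Ideal.mul_mem_left _ _ (hu _ _))
    (Ideal.sum_mem _ fun m _ => Ideal.mul_mem_left _ _ (hu _ _))

theorem d1_unique {w : Fin 4 → SmoothM} (h : ∀ c, d1 w c = 0)
    (h0 : ∀ c, restrict (w c) = 0) (h1 : ∀ c, restrict (e 0 (w c)) = 0) (c : Fin 4) :
    w c = 0 := by
  refine wave_unique (w := w) (fun I => ?_) h0 h1 c
  have h2 := bx1_sub_mem w I
  rw [sum_gi_e_e, sub_neg_eq_add] at h2
  refine (Submodule.add_mem_iff_right _ ?_).1 h2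
  have h3 : bx1 w I = -3 * w I := by
    have := h I
    rw [d1] at this
    linear_combination -this
  rw [h3]
  exact Ideal.mul_mem_left _ _ (mem_jetIdeal w I)

theorem bx0_unique {f : SmoothM} (h : bx0 f = -6 * f) (h0 : restrict f = 0)
    (h1 : restrict (e 0 f) = 0) : f = 0 := by
  refine wave_unique (w := fun _ : Unit => f) (fun I => ?_) (fun _ => h0) (fun _ => h1) ()
  have h2 : bx0 f - ∑ m, gi m * e m (e m f) ∈ jetIdeal fun _ : Unit => f := by
    rw [bx0, tr2, ← Finset.sum_sub_distrib]
    refine Ideal.sum_mem _ fun m _ => ?_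
    rw [← mul_sub, N1, sub_sub_cancel_left]
    exact Ideal.mul_mem_left _ _ (Ideal.neg_mem_iff _ |>.2 (Ideal.sum_mem _ fun d _ =>
      Ideal.mul_mem_left _ _ (e_mem_jetIdeal (fun _ : Unit => f) d ())))
  rw [sum_gi_e_e, sub_neg_eq_add] at h2
  refine (Submodule.add_mem_iff_right _ ?_).1 h2
  rw [h]
  exact Ideal.mul_mem_left _ _ (mem_jetIdeal (fun _ : Unit => f) ())

/-! ### Tensors in synchronous gauge -/

/-- The totally antisymmetric symbol. -/
def eps : Fin 3 → Fin 3 → Fin 3 → ℂ :=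
  ![![![0, 0, 0], ![0, 0, 1], ![0, -1, 0]], ![![0, 0, -1], ![0, 0, 0], ![1, 0, 0]],
    ![![0, 1, 0], ![-1, 0, 0], ![0, 0, 0]]]

theorem Γ_zero_zero (d : Fin 4) : Γ 0 0 d = 0 := by
  rw [Γ_eq]
  fin_cases d <;> rfl

theorem Γ_zero_succ_zero (i : Fin 3) : Γ 0 i.succ 0 = 0 := by
  rw [Γ_eq]
  fin_cases i <;> rfl

theorem Γ_succ_zero_zero (i : Fin 3) : Γ i.succ 0 0 = 0 := by
  rw [Γ_eq]
  fin_cases i <;> rfl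

theorem Γ_zero_succ_succ (i j : Fin 3) : Γ 0 i.succ j.succ = if i = j then hub else 0 := by
  rw [Γ_eq]
  fin_cases i <;> fin_cases j <;> rfl

theorem Γ_succ_zero_succ (i j : Fin 3) : Γ i.succ 0 j.succ = if i = j then hub else 0 := by
  rw [Γ_eq]
  fin_cases i <;> fin_cases j <;> rfl

theorem Γ_succ_succ_zero (i j : Fin 3) : Γ i.succ j.succ 0 = if i = j then hub * scl else 0 := by
  rw [Γ_eq]
  fin_cases i <;> fin_cases j <;> rfl

theorem Γ_succ_succ_succ_mul (i j k : Fin 3) (f : SmoothM) :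
    Γ i.succ j.succ k.succ * f = eps i j k • f := by
  rw [Γ_eq]
  fin_cases i <;> fin_cases j <;> fin_cases k <;> simp [Gam, eps]

theorem eps_self (i j : Fin 3) : eps i i j = 0 := by
  fin_cases i <;> fin_cases j <;> rfl

/-- The tensor with spatial components `cosh² t γ_ij` and no other components. -/
def sync (γ : Fin 3 → Fin 3 → SmoothM) (b c : Fin 4) : SmoothM :=
  Fin.cases 0 (fun i => Fin.cases 0 (fun j => scl * γ i j) c) b

@[simp] theorem sync_zero_left (γ : Fin 3 → Fin 3 → SmoothM) (c : Fin 4) : sync γ 0 c = 0 := rfl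

@[simp] theorem sync_zero_right (γ : Fin 3 → Fin 3 → SmoothM) (b : Fin 4) : sync γ b 0 = 0 := by
  refine Fin.cases rfl (fun i => rfl) b

@[simp] theorem sync_succ (γ : Fin 3 → Fin 3 → SmoothM) (i j : Fin 3) :
    sync γ i.succ j.succ = scl * γ i j := rfl

/-- The spatial covariant derivative. -/
def spD (γ : Fin 3 → Fin 3 → SmoothM) (i j k : Fin 3) : SmoothM :=
  e i.succ (γ j k) - ∑ l, eps i j l • γ l k - ∑ l, eps i k l • γ j l

/-- The spatial rough Laplacian. -/
def spLap (γ : Fin 3 → Fin 3 → SmoothM) (j k : Fin 3) : SmoothM :=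
  ∑ i, (e i.succ (spD γ i j k) - ∑ l, eps i j l • spD γ i l k - ∑ l, eps i k l • spD γ i j l)

/-- The factor `cosh² t` in `sync` absorbs the two Hubble terms of the connection, so the covariant
normal derivative acts on `γ` as the plain time derivative. -/
theorem N2_sync_zero (γ : Fin 3 → Fin 3 → SmoothM) :
    N2 (sync γ) 0 = sync fun i j => e 0 (γ i j) := by
  funext b c
  refine Fin.cases ?_ (fun i => ?_) b <;> refine Fin.cases ?_ (fun j => ?_) c <;>
    simp only [N2, Fin.sum_univ_succ (n := 3), sync_zero_left, sync_zero_right, sync_succ,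
      Γ_zero_zero, Γ_zero_succ_zero, Γ_zero_succ_succ, map_zero, mul_zero, zero_mul, sub_zero,
      Finset.sum_const_zero, add_zero, zero_add, ite_mul, Finset.sum_ite_eq, Finset.mem_univ,
      if_true, e_mul, e_zero_scl]
  ring

theorem N2_sync_zero_zero (γ : Fin 3 → Fin 3 → SmoothM) (i : Fin 3) : N2 (sync γ) i.succ 0 0 = 0 := by
  simp [N2]

theorem N2_sync_zero_succ (γ : Fin 3 → Fin 3 → SmoothM) (i k : Fin 3) :
    N2 (sync γ) i.succ 0 k.succ = -(hub * scl * γ i k) := by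
  simp only [N2, Fin.sum_univ_succ (n := 3), sync_zero_left, sync_succ,
      Γ_succ_zero_zero, Γ_succ_zero_succ, map_zero, mul_zero, zero_mul, sub_zero, zero_sub,
      Finset.sum_const_zero, add_zero, zero_add, ite_mul, Finset.sum_ite_eq, Finset.mem_univ,
      if_true]
  ring

theorem N2_sync_succ_zero (γ : Fin 3 → Fin 3 → SmoothM) (i k : Fin 3) :
    N2 (sync γ) i.succ k.succ 0 = -(hub * scl * γ k i) := by
  simp only [N2, Fin.sum_univ_succ (n := 3), sync_zero_right, sync_succ,
      Γ_succ_zero_zero, Γ_succ_zero_succ, map_zero, mul_zero, zero_mul, sub_zero, zero_sub,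
      Finset.sum_const_zero, add_zero, zero_add, ite_mul, Finset.sum_ite_eq, Finset.mem_univ,
      if_true]
  ring

theorem N2_sync_succ (γ : Fin 3 → Fin 3 → SmoothM) (i j k : Fin 3) :
    N2 (sync γ) i.succ j.succ k.succ = scl * spD γ i j k := by
  simp only [N2, Fin.sum_univ_succ (n := 3), sync_zero_left, sync_zero_right, sync_succ,
      Γ_succ_succ_succ_mul, mul_zero, zero_add, spD, e_mul, e_succ_scl, zero_mul, mul_sub,
      Finset.mul_sum, mul_smul_comm]

theorem N3_sync_zero (γ : Fin 3 → Fin 3 → SmoothM) (b c : Fin 4) :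
    N3 (N2 (sync γ)) 0 0 b c = sync (fun i j => e 0 (e 0 (γ i j))) b c := by
  have h : N3 (N2 (sync γ)) 0 0 b c = N2 (N2 (sync γ) 0) 0 b c := by
    simp only [N3, N2, Γ_zero_zero, zero_mul, Finset.sum_const_zero, sub_zero]
  rw [h, N2_sync_zero, N2_sync_zero]

theorem sum_eps_swap (γ : Fin 3 → Fin 3 → SmoothM) (hγ : ∀ i j, γ i j = γ j i) (j : Fin 3) :
    ∑ i, ∑ l, eps i j l • γ i l = 0 := by
  have h10 := hγ 1 0
  have h20 := hγ 2 0
  have h21 := hγ 2 1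
  fin_cases j <;> simp [Fin.sum_univ_three, eps, h10, h20, h21]

theorem tr2_eq (X : Fin 4 → Fin 4 → SmoothM) :
    tr2 X = -X 0 0 + sclInv * ∑ i : Fin 3, X i.succ i.succ := by
  rw [tr2, Fin.sum_univ_succ, Finset.mul_sum]
  congr 1
  exact neg_one_mul _

theorem sclInv_scl_mul (f : SmoothM) : sclInv * (scl * f) = f := by
  linear_combination f * scl_mul_sclInv

theorem tr2_sync (γ : Fin 3 → Fin 3 → SmoothM) : tr2 (sync γ) = ∑ i, γ i i := by
  rw [tr2_eq]
  simp only [sync_zero_left, sync_succ, ← Finset.mul_sum, sclInv_scl_mul, neg_zero, zero_add]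

theorem div2_sync_zero (γ : Fin 3 → Fin 3 → SmoothM) :
    div2 (sync γ) 0 = -(hub * ∑ i, γ i i) := by
  rw [div2, tr2_eq, N2_sync_zero]
  simp only [N2_sync_succ_zero, sync_zero_left, Finset.sum_neg_distrib, ← Finset.mul_sum]
  linear_combination -(hub * ∑ i, γ i i) * scl_mul_sclInv

theorem div2_sync_succ (γ : Fin 3 → Fin 3 → SmoothM) (hγ : ∀ i j, γ i j = γ j i) (k : Fin 3) :
    div2 (sync γ) k.succ = ∑ i, e i.succ (γ i k) := by
  have h := sum_eps_swap γ hγ k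
  rw [div2, tr2_eq, N2_sync_zero]
  simp only [N2_sync_succ, sync_zero_left, ← Finset.mul_sum, sclInv_scl_mul, spD, eps_self,
    zero_smul, Finset.sum_const_zero, sub_zero, Finset.sum_sub_distrib, h, neg_zero, zero_add]

theorem bx2_sync_zero_zero (γ : Fin 3 → Fin 3 → SmoothM) :
    bx2 (sync γ) 0 0 = 2 * (hub * hub) * ∑ i, γ i i := by
  have h : ∀ i : Fin 3, N3 (N2 (sync γ)) i.succ i.succ 0 0 = 2 * (hub * hub * scl) * γ i i := fun i => by
    simp only [N3, Fin.sum_univ_succ (n := 3), N2_sync_zero, N2_sync_zero_zero, N2_sync_succ_zero,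
      N2_sync_zero_succ, sync_zero_left, Γ_succ_zero_zero, Γ_succ_zero_succ, map_zero, mul_zero,
      zero_mul, sub_zero, zero_sub, Finset.sum_const_zero, add_zero, zero_add, ite_mul,
      Finset.sum_ite_eq, Finset.mem_univ, if_true]
    ring
  rw [bx2, tr2_eq, N3_sync_zero]
  simp only [h, sync_zero_left, ← Finset.mul_sum]
  linear_combination 2 * (hub * hub) * (∑ i, γ i i) * scl_mul_sclInv

theorem bx2_sync_zero_succ (γ : Fin 3 → Fin 3 → SmoothM) (hγ : ∀ i j, γ i j = γ j i) (k : Fin 3) :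
    bx2 (sync γ) 0 k.succ = -2 * hub * ∑ i, e i.succ (γ i k) := by
  have h0 := sum_eps_swap γ hγ k
  have h : ∀ i : Fin 3, N3 (N2 (sync γ)) i.succ i.succ 0 k.succ
      = hub * scl * (-2 * e i.succ (γ i k) + 2 * ∑ l, eps i k l • γ i l) := fun i => by
    simp only [N3, Fin.sum_univ_succ (n := 3), N2_sync_zero, N2_sync_zero_zero, N2_sync_succ,
      N2_sync_zero_succ, sync_zero_left, Γ_succ_zero_zero, Γ_succ_zero_succ, map_zero, mul_zero,
      zero_mul, sub_zero, zero_sub, Finset.sum_const_zero, add_zero, zero_add, ite_mul,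
      Finset.sum_ite_eq, Finset.mem_univ, if_true, Γ_succ_succ_succ_mul, eps_self, zero_smul, spD,
      map_neg, e_mul, e_succ_hub, e_succ_scl, smul_neg, Finset.sum_neg_distrib]
    have h1 : ∑ l, eps i k l • (hub * scl * γ i l) = hub * scl * ∑ l, eps i k l • γ i l := by
      simp only [Finset.mul_sum, mul_smul_comm]
    rw [h1]
    ring
  rw [bx2, tr2_eq, N3_sync_zero]
  simp only [h, sync_zero_left, ← Finset.mul_sum, Finset.sum_add_distrib, h0]
  linear_combination -2 * hub * (∑ i, e i.succ (γ i k)) * scl_mul_sclInv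

theorem bx2_sync_succ (γ : Fin 3 → Fin 3 → SmoothM) (j k : Fin 3) :
    bx2 (sync γ) j.succ k.succ = -(scl * e 0 (e 0 (γ j k))) - 3 * hub * scl * e 0 (γ j k)
      + 2 * (hub * hub) * scl * γ j k + spLap γ j k := by
  have h : ∀ i : Fin 3, N3 (N2 (sync γ)) i.succ i.succ j.succ k.succ
      = scl * (e i.succ (spD γ i j k) - ∑ l, eps i j l • spD γ i l k - ∑ l, eps i k l • spD γ i j l)
        - hub * scl * (scl * e 0 (γ j k))
        + (if i = j then hub * scl * (hub * scl * γ j k) else 0)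
        + (if i = k then hub * scl * (hub * scl * γ j k) else 0) := fun i => by
    simp only [N3, Fin.sum_univ_succ (n := 3), N2_sync_zero, N2_sync_succ_zero, N2_sync_succ,
      N2_sync_zero_succ, sync_succ, Γ_succ_succ_zero, mul_zero, Γ_succ_succ_succ_mul, eps_self,
      zero_smul, Finset.sum_const_zero, add_zero, e_mul, e_succ_scl, zero_mul, zero_add, if_true,
      mul_sub, Finset.mul_sum, mul_smul_comm]
    split_ifs with h1 h2 h2
    · subst h1; subst h2; ring
    · subst h1; ring
    · subst h2; ring
    · ring
  rw [bx2, tr2_eq, N3_sync_zero]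
  simp only [h, sync_succ, Finset.sum_add_distrib, Finset.sum_sub_distrib, ← Finset.mul_sum,
    Finset.sum_ite_eq', Finset.mem_univ, if_true, Finset.sum_const, Finset.card_univ,
    Fintype.card_fin, nsmul_eq_mul]
  rw [spLap]
  simp only [Finset.sum_sub_distrib]
  push_cast
  linear_combination ((∑ i, e i.succ (spD γ i j k)) - (∑ i, ∑ l, eps i j l • spD γ i l k)
    - (∑ i, ∑ l, eps i k l • spD γ i j l) - 3 * hub * scl * e 0 (γ j k)
    + 2 * (hub * hub) * scl * γ j k) * scl_mul_sclInv

/-- Together with the mixed components below, this shows that on transverse traceless `γ` only the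
spatial components of the field equation carry information. -/
theorem d2_sync_zero_zero (γ : Fin 3 → Fin 3 → SmoothM) :
    d2 (sync γ) 0 0 = 2 * sclInv * ∑ i, γ i i := by
  rw [d2, bx2_sync_zero_zero, tr2_sync, sync_zero_left, sclInv_eq, g_eq, if_pos rfl]
  change _ - 2 * (∑ i, γ i i) * (-1) = _
  ring

theorem d2_sync_zero_succ (γ : Fin 3 → Fin 3 → SmoothM) (hγ : ∀ i j, γ i j = γ j i) (k : Fin 3) :
    d2 (sync γ) 0 k.succ = 2 * hub * ∑ i, e i.succ (γ i k) := by
  rw [d2, bx2_sync_zero_succ γ hγ, tr2_sync, sync_zero_right, g_eq, if_neg (Fin.succ_ne_zero k).symm]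
  ring

theorem bx2_symm {u : Fin 4 → Fin 4 → SmoothM} (hu : ∀ a b, u a b = u b a) (b c : Fin 4) :
    bx2 u b c = bx2 u c b := by
  have h : N2 u = fun a b c => N2 u a c b := by
    funext a b c
    rw [← N2_swap]
    congr 1
    funext b c
    exact hu c b
  rw [bx2, bx2]
  conv_lhs => rw [h]
  congr 1
  funext m n
  exact N3_swap_right _ _ _ _ _

theorem sync_symm {γ : Fin 3 → Fin 3 → SmoothM} (hγ : ∀ i j, γ i j = γ j i) (a b : Fin 4) :
    sync γ a b = sync γ b a := by
  refine Fin.cases ?_ (fun i => ?_) a <;> refine Fin.cases ?_ (fun j => ?_) b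
  · rfl
  · rfl
  · rfl
  · rw [sync_succ, sync_succ, hγ]

theorem d2_symm {u : Fin 4 → Fin 4 → SmoothM} (hu : ∀ a b, u a b = u b a) (b c : Fin 4) :
    d2 u b c = d2 u c b := by
  rw [d2, d2, bx2_symm hu, hu b c, g_symm b c]

/-! ### Transverse traceless solutions -/

/-- The rough Laplacian of the three-sphere on symmetric tensors. -/
def lapS (p : MatS) (j k : Fin 3) : SmoothS :=
  let D : Fin 3 → MatS := fun i j k => eS i (p j k) - ∑ l, eps i j l • p l k - ∑ l, eps i k l • p j l
  ∑ i, (eS i (D i j k) - ∑ l, eps i j l • D i l k - ∑ l, eps i k l • D i j l)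

/-- A Weitzenböck formula on the unit three-sphere: the square of the curl on transverse traceless
tensors is `3` minus the Laplacian. Besides commutators, it uses one derivative of the divergence
condition and the symmetry of the curl. -/
theorem IsTT.lapS_eq {p : MatS} (hp : IsTT p) (i j : Fin 3) :
    lapS p i j = 3 * p i j - DeSitter.curlTT (DeSitter.curlTT p) i j := by
  have hc := hp.curlTT.symm
  have h10 := hp.symm 1 0
  have h20 := hp.symm 2 0
  have h21 := hp.symm 2 1
  have h22 : p 2 2 = -p 0 0 - p 1 1 := by linear_combination hp.trace
  have hd := fun m => congrArg (eS m) (hp.div j)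
  have hd' := hd i
  have hc' := hc i j
  simp only [lapS, curlTT_apply, map_sub, map_add, eS_ofNat_mul] at hd' hc' ⊢
  fin_cases i <;> fin_cases j <;>
    simp [Fin.sum_univ_three, eps, curlS_zero, curlS_one, curlS_two, curlTT_apply,
      eS_ofNat_mul, eS_one_zero, eS_two_zero, eS_two_one, h10, h20, h21, h22] at hd' hc' ⊢
  · linear_combination hd'
  · linear_combination hd' - 2 * hc'
  · linear_combination hd' - 2 * hc'
  · linear_combination hd' - 2 * hc'
  · linear_combination hd'
  · linear_combination hd' - 2 * hc'
  · linear_combination hd' - 2 * hc'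
  · linear_combination hd' - 2 * hc'
  · linear_combination hd'

/-! ### Transverse traceless solutions with prescribed amplitude -/

/-- The inverse scale factor. -/
def sec : SmoothM := ofTime (fun t => (Real.cosh t)⁻¹)
  (Real.contDiff_cosh.inv fun t => (Real.cosh_pos t).ne')

/-- The function `arctan (sinh t)` is conformal time: its derivative is `1/cosh t`, and
gravitational wave amplitudes are elementary in it. -/
theorem contDiff_gd : ContDiff ℝ ∞ fun t : ℝ => Real.arctan (Real.sinh t) :=
  Real.contDiff_arctan.comp Real.contDiff_sinh

/-- The sine of a multiple of the conformal time. -/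
def snc (c : ℝ) : SmoothM := ofTime (fun t => Real.sin (c * Real.arctan (Real.sinh t)))
  (Real.contDiff_sin.comp (contDiff_const.mul contDiff_gd))

/-- The cosine of a multiple of the conformal time. -/
def csc (c : ℝ) : SmoothM := ofTime (fun t => Real.cos (c * Real.arctan (Real.sinh t)))
  (Real.contDiff_cos.comp (contDiff_const.mul contDiff_gd))

theorem ofTime_apply (c : ℝ → ℝ) (hc : ContDiff ℝ ∞ c) (p : Spacetime) :
    (ofTime c hc).1 p = ((c p.1 : ℝ) : ℂ) := rfl

theorem sec_mul_sec : sec * sec = sclInv := by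
  ext p
  rw [SmoothM.mul_apply, sec, sclInv, ofTime_apply, ofTime_apply, ← Complex.ofReal_mul]
  congr 1
  rw [sq, mul_inv]

theorem e_zero_sec : e 0 sec = -(hub * sec) := by
  ext p
  rw [SmoothM.neg_apply, SmoothM.mul_apply, sec, hub, e_zero_ofTime, ofTime_apply, ofTime_apply,
    ← Complex.ofReal_mul, ← Complex.ofReal_neg]
  congr 1
  have h0 := (Real.cosh_pos p.1).ne'
  refine ((Real.hasDerivAt_cosh p.1).inv h0).deriv.trans ?_
  rw [Real.tanh_eq_sinh_div_cosh]
  field_simp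

theorem hasDerivAt_gd (t : ℝ) :
    HasDerivAt (fun t : ℝ => Real.arctan (Real.sinh t)) (Real.cosh t)⁻¹ t := by
  have h0 := (Real.cosh_pos t).ne'
  refine (Real.hasDerivAt_sinh t).arctan.congr_deriv ?_
  rw [← Real.cosh_sq']
  field_simp

theorem e_zero_snc (c : ℝ) : e 0 (snc c) = (c : ℂ) • (sec * csc c) := by
  ext p
  rw [SmoothM.smul_apply, SmoothM.mul_apply, sec, snc, csc, e_zero_ofTime, ofTime_apply,
    ofTime_apply, ← Complex.ofReal_mul, ← Complex.ofReal_mul]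
  congr 1
  refine ((hasDerivAt_gd p.1).const_mul c).sin.deriv.trans ?_
  ring

theorem e_zero_csc (c : ℝ) : e 0 (csc c) = -((c : ℂ) • (sec * snc c)) := by
  ext p
  rw [SmoothM.neg_apply, SmoothM.smul_apply, SmoothM.mul_apply, sec, snc, csc, e_zero_ofTime,
    ofTime_apply, ofTime_apply, ← Complex.ofReal_mul, ← Complex.ofReal_mul, ← Complex.ofReal_neg]
  congr 1
  refine ((hasDerivAt_gd p.1).const_mul c).cos.deriv.trans ?_
  ring

/-- The first amplitude of a gravitational wave. -/
def amp1 (c : ℝ) : SmoothM := hub * csc c - (c : ℂ) • (sec * snc c)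

/-- The second amplitude of a gravitational wave. -/
def amp2 (c : ℝ) : SmoothM := hub * snc c + (c : ℂ) • (sec * csc c)

/-- The derivative collapses to a single term, from which the amplitude equation follows by one
further differentiation. -/
theorem e_zero_amp1 (c : ℝ) : e 0 (amp1 c) = (1 - (c : ℂ) ^ 2) • (sclInv * csc c) := by
  have h := sclInv_eq
  simp only [amp1, map_sub, map_smul, e_mul, e_zero_hub, e_zero_sec, e_zero_snc, e_zero_csc,
    ← sec_mul_sec] at h ⊢
  simp only [Algebra.smul_def, map_sub, map_pow, map_one]
  linear_combination -csc c * h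

theorem e_zero_amp2 (c : ℝ) : e 0 (amp2 c) = (1 - (c : ℂ) ^ 2) • (sclInv * snc c) := by
  have h := sclInv_eq
  simp only [amp2, map_add, map_smul, e_mul, e_zero_hub, e_zero_sec, e_zero_snc, e_zero_csc,
    ← sec_mul_sec] at h ⊢
  simp only [Algebra.smul_def, map_sub, map_pow, map_one]
  linear_combination -snc c * h

/-- The amplitude equation of gravitational waves. -/
structure IsAmplitude (c : ℝ) (a : SmoothM) : Prop where
  space : ∀ i : Fin 3, e i.succ a = 0
  wave : e 0 (e 0 a) + 3 * hub * e 0 a + ((c : ℂ) ^ 2 - 1) • (sclInv * a) = 0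

theorem isAmplitude_amp1 (c : ℝ) : IsAmplitude c (amp1 c) := by
  refine ⟨fun i => ?_, ?_⟩
  · simp only [amp1, map_sub, map_smul, e_mul, sec, snc, csc, hub, e_succ_ofTime]
    simp
  · rw [e_zero_amp1, map_smul, e_mul, e_zero_sclInv, e_zero_csc]
    simp only [amp1, Algebra.smul_def, map_sub, map_pow, map_one]
    ring

theorem isAmplitude_amp2 (c : ℝ) : IsAmplitude c (amp2 c) := by
  refine ⟨fun i => ?_, ?_⟩
  · simp only [amp2, map_add, map_smul, e_mul, sec, snc, csc, hub, e_succ_ofTime]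
    simp
  · rw [e_zero_amp2, map_smul, e_mul, e_zero_sclInv, e_zero_snc]
    simp only [amp2, Algebra.smul_def, map_sub, map_pow, map_one]
    ring

theorem restrict_ofTime (c : ℝ → ℝ) (hc : ContDiff ℝ ∞ c) :
    restrict (ofTime c hc) = algebraMap ℂ SmoothS (c 0) := rfl

@[simp] theorem restrict_hub : restrict hub = 0 := by
  rw [hub, restrict_ofTime, Real.tanh_zero, Complex.ofReal_zero, map_zero]

@[simp] theorem restrict_scl : restrict scl = 1 := by
  rw [scl, restrict_ofTime]
  simp

@[simp] theorem restrict_sclInv : restrict sclInv = 1 := by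
  rw [sclInv, restrict_ofTime]
  simp

theorem restrict_sec : restrict sec = 1 := by
  rw [sec, restrict_ofTime]
  simp

theorem restrict_snc (c : ℝ) : restrict (snc c) = 0 := by
  rw [snc, restrict_ofTime]
  simp

theorem restrict_csc (c : ℝ) : restrict (csc c) = 1 := by
  rw [csc, restrict_ofTime]
  simp

/-- The initial data of the two amplitudes are `(0, 1 - c²)` and `(c, 0)`. The first therefore
probes the metric perturbation alone, the second its velocity alone. -/
theorem restrict_amp1 (c : ℝ) : restrict (amp1 c) = 0 := by
  rw [amp1, map_sub, map_mul, map_smul, map_mul, restrict_hub, restrict_snc]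
  simp

theorem restrict_e_amp1 (c : ℝ) : restrict (e 0 (amp1 c)) = (1 - (c : ℂ) ^ 2) • 1 := by
  rw [e_zero_amp1, map_smul, map_mul, restrict_sclInv, restrict_csc, mul_one]

theorem restrict_amp2 (c : ℝ) : restrict (amp2 c) = (c : ℂ) • 1 := by
  rw [amp2, map_add, map_mul, map_smul, map_mul, restrict_hub, restrict_sec, restrict_csc]
  simp

theorem restrict_e_amp2 (c : ℝ) : restrict (e 0 (amp2 c)) = 0 := by
  rw [e_zero_amp2, map_smul, map_mul, restrict_snc]
  simp

/-- The gravitational wave with given amplitude and polarization. -/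
def gravWave (a : SmoothM) (p : MatS) : Fin 4 → Fin 4 → SmoothM := sync fun i j => a * lift (p i j)

/-- Solutions of the linearized Einstein equations in transverse traceless gauge. -/
structure IsGW (u : Fin 4 → Fin 4 → SmoothM) : Prop where
  symm : ∀ b c, u b c = u c b
  eqn : ∀ b c, d2 u b c = 0
  div : ∀ c, div2 u c = 0
  trace : tr2 u = 0

theorem spD_wave {a : SmoothM} (ha : ∀ i : Fin 3, e i.succ a = 0) (p : MatS) (i j k : Fin 3) :
    spD (fun i j => a * lift (p i j)) i j k
      = a * lift (eS i (p j k) - ∑ l, eps i j l • p l k - ∑ l, eps i k l • p j l) := by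
  simp only [spD, e_mul, ha, e_lift, zero_mul, zero_add, map_sub, map_sum, map_smul, mul_sub,
    Finset.mul_sum, mul_smul_comm]

theorem spLap_wave {a : SmoothM} (ha : ∀ i : Fin 3, e i.succ a = 0) (p : MatS) (j k : Fin 3) :
    spLap (fun i j => a * lift (p i j)) j k = a * lift (lapS p j k) := by
  simp only [spLap, spD_wave ha, lapS]
  simp only [e_mul, ha, e_lift, zero_mul, zero_add, map_sub, map_sum, map_smul, mul_sub,
    Finset.mul_sum, mul_smul_comm]

/-- Trace and divergence vanish because those of `p` do. The Laplacian acts on `p` as `3 - c²`,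
which reduces the spatial field equation to the amplitude equation. -/
theorem isGW_gravWave {c : ℝ} {a : SmoothM} (ha : IsAmplitude c a) {p : MatS} (hp : IsTT p)
    (hc : DeSitter.curlTT p = (c : ℂ) • p) : IsGW (gravWave a p) := by
  have hs : ∀ i j, a * lift (p i j) = a * lift (p j i) := fun i j => by rw [hp.symm]
  have ht : ∑ i, a * lift (p i i) = 0 := by
    rw [← Finset.mul_sum, ← map_sum, Fin.sum_univ_three, hp.trace, map_zero, mul_zero]
  have hd : ∀ k, ∑ i : Fin 3, e i.succ (a * lift (p i k)) = 0 := fun k => by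
    simp only [e_mul, ha.space, e_lift, zero_mul, zero_add]
    rw [← Finset.mul_sum, ← map_sum, Fin.sum_univ_three, hp.div, map_zero, mul_zero]
  have hsy := sync_symm hs
  have hlap : ∀ j k, lapS p j k = (3 - (c : ℂ) ^ 2) • p j k := fun j k => by
    rw [hp.lapS_eq, hc, map_smul, hc, sub_smul, three_smul, Pi.smul_apply, Pi.smul_apply,
      Pi.smul_apply, Pi.smul_apply, smul_smul, sq]
  refine ⟨hsy, fun b c' => ?_, fun c' => ?_, ?_⟩
  · have h0 : ∀ c', d2 (gravWave a p) 0 c' = 0 := fun c' => by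
      refine Fin.cases ?_ (fun k => ?_) c'
      · rw [gravWave, d2_sync_zero_zero, ht, mul_zero]
      · rw [gravWave, d2_sync_zero_succ _ hs, hd, mul_zero]
    refine Fin.cases (h0 c') (fun j => ?_) b
    refine Fin.cases ((d2_symm hsy _ _).trans (h0 _)) (fun k => ?_) c'
    have h1 : tr2 (sync fun i j => a * lift (p i j)) = 0 := by rw [tr2_sync, ht]
    have h2 : ∀ f, e 0 (a * lift f) = e 0 a * lift f := fun f => by
      rw [e_mul, e_zero_lift, mul_zero, add_zero]
    have h3 : ∀ f, e 0 (e 0 a * lift f) = e 0 (e 0 a) * lift f := fun f => by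
      rw [e_mul, e_zero_lift, mul_zero, add_zero]
    have hw := ha.wave
    have hA := scl_mul_sclInv
    rw [gravWave, d2, bx2_sync_succ, spLap_wave ha.space, hlap, h1, sync_succ, hp.symm k j, h2, h3,
      map_smul]
    simp only [Algebra.smul_def, map_sub, map_pow, map_one, map_ofNat] at hw ⊢
    rw [sclInv_eq] at hA hw
    linear_combination scl * lift (p j k) * hw
      + (3 - (algebraMap ℂ SmoothM c) ^ 2) * a * lift (p j k) * hA
  · refine Fin.cases ?_ (fun k => ?_) c'
    · rw [gravWave, div2_sync_zero, ht, mul_zero, neg_zero]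
    · rw [gravWave, div2_sync_succ _ hs, hd]
  · rw [gravWave, tr2_sync, ht]

/-! ### The Cauchy data spaces -/

theorem rho_apply (k : ℕ) (u : Tensor k) : rho k u = (fun i => restrict (u i),
    fun i => Complex.I⁻¹ • restrict (nabla k u (Fin.cons 0 i))) := rfl

theorem rho_ten2 (u : Fin 4 → Fin 4 → SmoothM) : rho 2 (ten2 u)
    = (fun i => restrict (u (i 0) (i 1)), fun i => Complex.I⁻¹ • restrict (N2 u 0 (i 0) (i 1))) := by
  have h : ∀ i, ten3 (N2 u) (Fin.cons 0 i) = N2 u 0 (i 0) (i 1) := fun _ => rfl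
  have h2 : ∀ i, ten2 u i = u (i 0) (i 1) := fun _ => rfl
  rw [rho_apply, nabla_ten2]
  simp only [h, h2]

theorem rho_ten1 (w : Fin 4 → SmoothM) : rho 1 (ten1 w)
    = (fun i => restrict (w (i 0)), fun i => Complex.I⁻¹ • restrict (N1 w 0 (i 0))) := by
  have h : ∀ i, ten2 (N1 w) (Fin.cons 0 i) = N1 w 0 (i 0) := fun _ => rfl
  have h2 : ∀ i, ten1 w i = w (i 0) := fun _ => rfl
  rw [rho_apply, nabla_ten1]
  simp only [h, h2]

theorem smul_I_inv_eq_zero {x : SmoothS} (h : Complex.I⁻¹ • x = 0) : x = 0 :=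
  (smul_eq_zero.1 h).resolve_left (inv_ne_zero Complex.I_ne_zero)

theorem data_of_rho_ten2 {u : Fin 4 → Fin 4 → SmoothM} (h : rho 2 (ten2 u) = 0) :
    (∀ b c, restrict (u b c) = 0) ∧ ∀ b c, restrict (e 0 (u b c)) = 0 := by
  rw [rho_ten2, Prod.mk_eq_zero] at h
  have h0 : ∀ b c, restrict (u b c) = 0 := fun b c => by
    have := congrFun h.1 ![b, c]
    rwa [Pi.zero_apply] at this
  refine ⟨h0, fun b c => ?_⟩
  have h1 : restrict (N2 u 0 b c) = 0 := by
    have := congrFun h.2 ![b, c]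
    rw [Pi.zero_apply] at this
    exact smul_I_inv_eq_zero this
  simpa [N2, h0] using h1

theorem data_of_rho_ten1 {w : Fin 4 → SmoothM} (h : rho 1 (ten1 w) = 0) :
    (∀ c, restrict (w c) = 0) ∧ ∀ c, restrict (e 0 (w c)) = 0 := by
  rw [rho_ten1, Prod.mk_eq_zero] at h
  have h0 : ∀ c, restrict (w c) = 0 := fun c => by
    have := congrFun h.1 ![c]
    rwa [Pi.zero_apply] at this
  refine ⟨h0, fun c => ?_⟩
  have h1 : restrict (N1 w 0 c) = 0 := by
    have := congrFun h.2 ![c]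
    rw [Pi.zero_apply] at this
    exact smul_I_inv_eq_zero this
  simpa [N1, h0] using h1

theorem K20star_ten2 (u : Fin 4 → Fin 4 → SmoothM) :
    K20star (ten2 u) = (-2 : ℂ) • fun _ => tr2 u := by
  funext i
  have : K20star (ten2 u) i = (-2 : ℂ) • trace gInv (ten2 u) := rfl
  rw [this, trace_ten2]
  rfl

theorem data_of_rho_zero {f : SmoothM} (h : rho 0 (fun _ => f) = 0) :
    restrict f = 0 ∧ restrict (e 0 f) = 0 := by
  refine ⟨congrFun (congrArg Prod.fst h) ![], ?_⟩
  have h1 := congrFun (congrArg Prod.snd h) ![]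
  have h2 : (rho 0 fun _ => f).2 ![] = Complex.I⁻¹ • restrict (nabla 0 (fun _ => f) (Fin.cons 0 ![])) :=
    rfl
  rw [h2] at h1
  have h3 := smul_I_inv_eq_zero h1
  simpa [nabla] using h3

theorem K21star_ten2 (u : Fin 4 → Fin 4 → SmoothM) :
    K21star (ten2 u) = (-2 : ℂ) • ten1 (div2 u) := by
  rw [codiff_ten2]
  funext i
  rw [Pi.smul_apply, Algebra.smul_def, map_neg, map_ofNat]
  rfl

theorem mem_graphKer_iff {k j : ℕ} (D : Tensor k →ₗ[ℂ] Tensor k) (K : Tensor k →ₗ[ℂ] Tensor j)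
    (f : Data k) : f ∈ graphKer (cauchyGraph D K)
      ↔ ∃ U ∈ symTensor k, D U = 0 ∧ rho k U = f ∧ rho j (K U) = 0 := by
  constructor
  · rintro ⟨U, ⟨h1, h2⟩, h3⟩
    exact ⟨U, h1, h2, congrArg Prod.fst h3, congrArg Prod.snd h3⟩
  · rintro ⟨U, h1, h2, h3, h4⟩
    exact ⟨U, ⟨h1, h2⟩, Prod.ext h3 h4⟩

theorem mem_graphKer_two_iff {j : ℕ} (K : Tensor 2 →ₗ[ℂ] Tensor j) (f : Data 2) :
    f ∈ graphKer (cauchyGraph D2 K) ↔ ∃ u : Fin 4 → Fin 4 → SmoothM, (∀ b c, u b c = u c b) ∧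
      (∀ b c, d2 u b c = 0) ∧ rho 2 (ten2 u) = f ∧ rho j (K (ten2 u)) = 0 := by
  rw [mem_graphKer_iff]
  constructor
  · rintro ⟨U, h1, h2, h3, h4⟩
    rw [← ten2_cur U] at h1 h2 h3 h4
    rw [D2_ten2] at h2
    exact ⟨_, mem_symTensor_ten2.1 h1, fun b c => congrFun h2 ![b, c], h3, h4⟩
  · rintro ⟨u, h1, h2, h3, h4⟩
    refine ⟨ten2 u, mem_symTensor_ten2.2 h1, ?_, h3, h4⟩
    rw [D2_ten2]
    exact funext fun i => h2 _ _

theorem d2_sub (u v : Fin 4 → Fin 4 → SmoothM) (b c : Fin 4) :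
    d2 (fun b c => u b c - v b c) b c = d2 u b c - d2 v b c := by
  have h1 := d2_add u (fun b c => (-1 : ℂ) • v b c) b c
  rw [d2_smul] at h1
  simpa only [neg_smul, one_smul, ← sub_eq_add_neg] using h1

theorem d2_unique' {u v : Fin 4 → Fin 4 → SmoothM} (hu : ∀ b c, d2 u b c = 0)
    (hv : ∀ b c, d2 v b c = 0) (h : rho 2 (ten2 u) = rho 2 (ten2 v)) : u = v := by
  have h1 : rho 2 (ten2 fun b c => u b c - v b c) = 0 := by
    have : ten2 (fun b c => u b c - v b c) = ten2 u - ten2 v := rfl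
    rw [this, map_sub, h, sub_self]
  obtain ⟨h2, h3⟩ := data_of_rho_ten2 h1
  funext b c
  exact sub_eq_zero.1 (d2_unique (u := fun b c => u b c - v b c)
    (fun b c => by rw [d2_sub, hu, hv, sub_zero]) h2 h3 b c)

theorem div2_zero_of {u : Fin 4 → Fin 4 → SmoothM} (hu : ∀ b c, u b c = 0) (c : Fin 4) :
    div2 u c = 0 := by
  simp [div2, tr2, N2, hu]

theorem tr2_zero_of {u : Fin 4 → Fin 4 → SmoothM} (hu : ∀ b c, u b c = 0) : tr2 u = 0 := by
  simp [tr2, hu]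

/-- Divergence and trace of a solution obey homogeneous wave equations, so vanishing of their Cauchy
data is the same as their vanishing on all of spacetime. -/
theorem mem_ETT_iff (f : Data 2) : f ∈ ETT ↔ ∃ u, IsGW u ∧ rho 2 (ten2 u) = f := by
  constructor
  · rintro ⟨h1, h2⟩
    obtain ⟨u, hs, hu, hf, h3⟩ := (mem_graphKer_two_iff K21star f).1 h1
    obtain ⟨u', _, hu', hf', h4⟩ := (mem_graphKer_two_iff K20star f).1 h2
    -- The two kernels provide two solutions with the same data; uniqueness identifies them.
    rw [← d2_unique' hu hu' (hf.trans hf'.symm)] at h4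
    rw [K21star_ten2, map_smul] at h3
    rw [K20star_ten2, map_smul] at h4
    have h2 : (-2 : ℂ) ≠ 0 := by norm_num
    obtain ⟨a0, a1⟩ := data_of_rho_ten1 ((smul_eq_zero.1 h3).resolve_left h2)
    obtain ⟨b0, b1⟩ := data_of_rho_zero ((smul_eq_zero.1 h4).resolve_left h2)
    refine ⟨u, ⟨hs, hu, d1_unique (fun c => ?_) a0 a1, bx0_unique ?_ b0 b1⟩, hf⟩
    · rw [d1_div2 hs, div2_zero_of hu]
    · have := tr2_d2 u
      rw [tr2_zero_of hu] at this
      linear_combination this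
  · rintro ⟨u, hu, rfl⟩
    refine ⟨(mem_graphKer_two_iff K21star _).2 ⟨u, hu.symm, hu.eqn, rfl, ?_⟩,
      (mem_graphKer_two_iff K20star _).2 ⟨u, hu.symm, hu.eqn, rfl, ?_⟩⟩
    · rw [K21star_ten2, map_smul]
      have : ten1 (div2 u) = 0 := funext fun i => hu.div _
      rw [this, map_zero, smul_zero]
    · rw [K20star_ten2, map_smul, hu.trace]
      exact (congrArg _ (map_zero (rho 0))).trans (smul_zero _)

theorem lie_symm (w : Fin 4 → SmoothM) (b c : Fin 4) : lie w b c = lie w c b := add_comm _ _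

theorem lie_smul (k : ℂ) (w : Fin 4 → SmoothM) (b c : Fin 4) :
    lie (fun c => k • w c) b c = k • lie w b c := by
  simp only [lie, N1_smul, smul_add]

theorem bx1_smul (k : ℂ) (w : Fin 4 → SmoothM) (c : Fin 4) :
    bx1 (fun c => k • w c) c = k • bx1 w c := by
  have h : N1 (fun c => k • w c) = fun a b => k • N1 w a b := by
    funext a b
    exact N1_smul k w a b
  simp only [bx1, h, N2_smul, tr2_smul]

theorem d1_smul (k : ℂ) (w : Fin 4 → SmoothM) (c : Fin 4) :
    d1 (fun c => k • w c) c = k • d1 w c := by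
  rw [d1, bx1_smul, d1, Algebra.smul_def, Algebra.smul_def, Algebra.smul_def]
  ring

theorem tr2_kk (w : Fin 4 → SmoothM) : tr2 (kk w) = -hf * tr2 (lie w) := by
  have h := tr2_g_mul (hf * tr2 (lie w))
  have h2 : ∀ T, tr2 (fun b c => hf * (lie w b c - hf * T * g b c))
      = hf * (tr2 (lie w) - tr2 (fun b c => hf * T * g b c)) := fun T => by
    simp only [tr2, Finset.mul_sum, ← Finset.sum_sub_distrib]
    exact Finset.sum_congr rfl fun m _ => by ring
  refine (h2 (tr2 (lie w))).trans ?_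
  rw [h]
  linear_combination -2 * hf * tr2 (lie w) * two_mul_hf

/-- The trace of `kk w` is `-½ tr (lie w)` and obeys a wave equation, so trace-free data make `lie
w` trace-free everywhere. Trace reversal then does nothing, and `K21` is half the Lie derivative. -/
theorem mem_FTT_iff (f : Data 2) : f ∈ FTT ↔ ∃ w, (∀ c, d1 w c = 0) ∧ tr2 (lie w) = 0 ∧
    rho 2 (ten2 (lie w)) = f := by
  constructor
  · rintro ⟨⟨x, ⟨W, ⟨-, hW⟩, rfl⟩, hf⟩, h2⟩
    obtain ⟨u, _, hu, hf', h4⟩ := (mem_graphKer_two_iff K20star f).1 h2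
    have hW' : D1 W = 0 := hW
    have hf2 : rho 2 (K21 W) = f := hf
    rw [← ten1_cur W, D1_ten1] at hW'
    rw [← ten1_cur W, K21_ten1] at hf2
    set w : Fin 4 → SmoothM := fun c => W ![c] with hw
    have hd : ∀ c, d1 w c = 0 := fun c => congrFun hW' ![c]
    have hk : ∀ b c, d2 (kk w) b c = 0 := fun b c => by
      have h0 : d1 w = fun _ => 0 := funext hd
      rw [d2_kk, h0]
      simp [kk, lie, N1, tr2]
    rw [d2_unique' hu hk (hf'.trans hf2.symm), K20star_ten2, map_smul] at h4
    have h2 : (-2 : ℂ) ≠ 0 := by norm_num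
    obtain ⟨b0, b1⟩ := data_of_rho_zero ((smul_eq_zero.1 h4).resolve_left h2)
    have ht : tr2 (kk w) = 0 := by
      refine bx0_unique ?_ b0 b1
      have := tr2_d2 (kk w)
      rw [tr2_zero_of hk] at this
      linear_combination this
    have ht' : tr2 (lie w) = 0 := by
      rw [tr2_kk] at ht
      linear_combination -2 * ht - tr2 (lie w) * two_mul_hf
    -- The factor is the one in the symmetrized differential, which is half of `lie w`.
    refine ⟨fun c => (1 / 2 : ℂ) • w c, fun c => ?_, ?_, ?_⟩
    · rw [d1_smul, hd, smul_zero]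
    · have : lie (fun c => (1 / 2 : ℂ) • w c) = fun b c => (1 / 2 : ℂ) • lie w b c := by
        funext b c
        exact lie_smul _ w b c
      rw [this, tr2_smul, ht', smul_zero]
    · rw [← hf2]
      congr 2
      funext b c
      rw [lie_smul, half_smul, kk, ht']
      ring
  · rintro ⟨w, hd, ht, rfl⟩
    have h0 : d1 w = fun _ => 0 := funext hd
    have hk : ∀ b c, d2 (lie w) b c = 0 := fun b c => by
      rw [d2_lie, h0]
      simp [lie, N1]
    refine ⟨⟨_, ⟨(2 : ℂ) • ten1 w, ⟨mem_symTensor_one _, ?_⟩, rfl⟩, ?_⟩,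
      (mem_graphKer_two_iff K20star _).2 ⟨lie w, lie_symm w, hk, rfl, ?_⟩⟩
    · have : D1 (ten1 w) = 0 := by
        rw [D1_ten1, h0]
        rfl
      rw [SetLike.mem_coe, LinearMap.mem_ker, map_smul, this, smul_zero]
    · have : K21 ((2 : ℂ) • ten1 w) = ten2 (lie w) := by
        rw [map_smul, K21_ten1]
        funext i
        rw [Pi.smul_apply, two_smulM]
        simp only [ten2, kk, ht]
        linear_combination lie w (i 0) (i 1) * two_mul_hf
      exact congrArg (rho 2) this
    · rw [K20star_ten2, map_smul, ht]
      exact (congrArg _ (map_zero (rho 0))).trans (smul_zero _)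

theorem isGW_lie {w : Fin 4 → SmoothM} (hd : ∀ c, d1 w c = 0) (ht : tr2 (lie w) = 0) :
    IsGW (lie w) := by
  have h0 : d1 w = fun _ => 0 := funext hd
  refine ⟨lie_symm w, fun b c => ?_, fun c => ?_, ht⟩
  · rw [d2_lie, h0]
    simp [lie, N1]
  · have ht' : tr2 (N1 w) = 0 := by
      rw [tr2_lie] at ht
      linear_combination hf * ht - tr2 (N1 w) * two_mul_hf
    have := hd c
    rw [d1] at this
    rw [div2_lie, ht', map_zero]
    linear_combination -this

theorem FTT_le_ETT : FTT ≤ ETT := fun f hf => by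
  obtain ⟨w, hd, ht, rfl⟩ := (mem_FTT_iff f).1 hf
  exact (mem_ETT_iff _).2 ⟨lie w, isGW_lie hd ht, rfl⟩

/-! ### The charge of two solutions -/

/-- The contraction of a tensor of rank two with itself. -/
def ctr (F : Fin 4 → Fin 4 → SmoothM) : SmoothM := ∑ a, gi a * ∑ b, gi b * F a b

theorem ctr_add (F G : Fin 4 → Fin 4 → SmoothM) : ctr (fun a b => F a b + G a b) = ctr F + ctr G := by
  simp only [ctr, mul_add, Finset.sum_add_distrib]

theorem ctr_sub (F G : Fin 4 → Fin 4 → SmoothM) : ctr (fun a b => F a b - G a b) = ctr F - ctr G := by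
  simp only [ctr, mul_sub, Finset.sum_sub_distrib]

theorem ctr_swap (F : Fin 4 → Fin 4 → SmoothM) : ctr (fun a b => F b a) = ctr F := by
  simp only [ctr, Finset.mul_sum]
  rw [Finset.sum_comm]
  exact Finset.sum_congr rfl fun m _ => Finset.sum_congr rfl fun d _ => by ring

/-- The current of two tensor fields. -/
def cur (U v : Fin 4 → Fin 4 → SmoothM) (n : Fin 4) : SmoothM :=
  ctr fun a b => U a b * N2 v n a b - N2 U n a b * v a b

theorem sum_mul_mul_right (Γ' F : Fin 4 → SmoothM) (k : SmoothM) :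
    ∑ x, Γ' x * (F x * k) = (∑ x, Γ' x * F x) * k := by
  rw [Finset.sum_mul]
  exact Finset.sum_congr rfl fun m _ => by ring

theorem sum_mul_mul_left (Γ' F : Fin 4 → SmoothM) (k : SmoothM) :
    ∑ x, Γ' x * (k * F x) = k * ∑ x, Γ' x * F x := by
  rw [Finset.mul_sum]
  exact Finset.sum_congr rfl fun m _ => by ring

/-- The superpotential of the current of a symmetric tensor and a Lie derivative. -/
def superpot (U : Fin 4 → Fin 4 → SmoothM) (w : Fin 4 → SmoothM) (a b : Fin 4) : SmoothM :=
  tr2 fun p q => U a p * N1 w b q - N2 U b a p * w q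

theorem N2_superpot (U : Fin 4 → Fin 4 → SmoothM) (w : Fin 4 → SmoothM) (m a b : Fin 4) :
    N2 (superpot U w) m a b = ∑ p, gi p * (N2 U m a p * N1 w b p + U a p * N2 (N1 w) m b p
      - N3 (N2 U) m b a p * w p - N2 U b a p * N1 w m p) := by
  have h : N2 (superpot U w) m a b = tr2 fun p q =>
      N4 (fun p a q b => U a p * N1 w b q - N2 U b a p * w q) m p a q b :=
    N2_tr2_mid (fun p a q b => U a p * N1 w b q - N2 U b a p * w q) m a b
  rw [h]
  refine Finset.sum_congr rfl fun p _ => ?_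
  congr 1
  simp only [N4, map_sub, e_mul, mul_sub, Finset.sum_sub_distrib, sum_mul_mul_right,
    sum_mul_mul_left]
  rw [N2.eq_1 U m a p, N1.eq_1 w m p, N2.eq_1 (N1 w) m b p, N3.eq_1 (N2 U) m b a p]
  ring

/-- Integrating by parts in `U^{ab} ∇_n (lie w)_{ab}` with the field equations leaves multiples of
`U_n^p w_p` from curvature. Antisymmetrizing the superpotential makes these cancel exactly. -/
theorem cur_lie {U : Fin 4 → Fin 4 → SmoothM} (hU : IsGW U) {w : Fin 4 → SmoothM}
    (hw : ∀ c, d1 w c = 0) (n : Fin 4) :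
    cur U (lie w) n = 2 * div2 (fun a b => superpot U w a b - superpot U w b a) n := by
  have hT : ∀ m n b, N2 U m n b = N2 U m b n := fun m n b => by
    rw [← N2_swap]
    congr 1
    funext b c
    exact hU.symm c b
  have hl : N2 (lie w) = fun a b c => N2 (N1 w) a b c + N2 (N1 w) a c b := by
    funext a b c
    unfold lie
    rw [N2_add, N2_swap (N1 w)]
  have h1 : cur U (lie w) n = 2 * ctr fun a b => U a b * N2 (N1 w) n a b - N2 U n a b * N1 w a b := by
    rw [two_mul]
    nth_rw 2 [← ctr_swap]
    rw [← ctr_add, cur, hl]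
    congr 1
    funext a b
    rw [hU.symm b a, hT n b a, lie]
    ring
  have hdiv : ∀ p, ∑ m, gi m * N2 U m m p = 0 := hU.div
  have hbU : ∀ p, ∑ m, gi m * N3 (N2 U) m m n p = 2 * U n p := fun p => by
    have := hU.eqn n p
    rw [d2, hU.trace, hU.symm p n] at this
    change bx2 U n p = _
    linear_combination -this
  have hbw : ∀ p, ∑ m, gi m * N2 (N1 w) m m p = -3 * w p := fun p => by
    have := hw p
    rw [d1] at this
    change bx1 w p = _
    linear_combination -this
  -- Commuting the derivatives brings `U` to its vanishing divergence; the curvature terms are `3 +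
  -- 1 = 4` copies of `U`.
  have hcomm : ∀ p, ∑ m, gi m * N3 (N2 U) m n m p = 4 * U n p := fun p => by
    have h0 := N1_div2 U n p
    have h2 : N1 (div2 U) n p = 0 := by simp [N1, hU.div]
    rw [h2, hU.trace, hU.symm p n] at h0
    change tr2 (fun a b => N3 (N2 U) a n b p) = _
    linear_combination -h0
  have hA : ∑ m, gi m * N2 (superpot U w) m m n
      = (ctr fun a b => U a b * N2 (N1 w) a n b) - 4 * (∑ p, gi p * (U n p * w p))
        - ctr fun a b => N2 U n a b * N1 w a b := by
    have h2 : ∑ m, gi m * N2 (superpot U w) m m n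
      = ∑ p, gi p * ((∑ m, gi m * N2 U m m p) * N1 w n p) + (ctr fun a b => U a b * N2 (N1 w) a n b)
        - (∑ p, gi p * ((∑ m, gi m * N3 (N2 U) m n m p) * w p))
        - ctr fun a b => N2 U n a b * N1 w a b := by
      simp only [N2_superpot, ctr, mul_sub, mul_add, Finset.sum_add_distrib, Finset.sum_sub_distrib,
        Finset.mul_sum, Finset.sum_mul]
      congr 2
      · congr 1
        rw [Finset.sum_comm]
        exact Finset.sum_congr rfl fun m _ => Finset.sum_congr rfl fun d _ => by ring
      · rw [Finset.sum_comm]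
        exact Finset.sum_congr rfl fun m _ => Finset.sum_congr rfl fun d _ => by ring
    rw [h2]
    simp only [hdiv, hcomm, zero_mul, mul_zero, Finset.sum_const_zero, zero_add]
    rw [Finset.mul_sum]
    congr 2
    exact Finset.sum_congr rfl fun m _ => by ring
  -- The wave equations contribute `-3` from `w` and `-2` from `U`.
  have hB : ∑ m, gi m * N2 (superpot U w) m n m = -5 * ∑ p, gi p * (U n p * w p) := by
    have h2 : ∑ m, gi m * N2 (superpot U w) m n m
      = ∑ p, gi p * (U n p * ∑ m, gi m * N2 (N1 w) m m p)
        - (∑ p, gi p * ((∑ m, gi m * N3 (N2 U) m m n p) * w p)) := by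
      simp only [N2_superpot, Finset.mul_sum, Finset.sum_mul]
      rw [Finset.sum_comm, ← Finset.sum_sub_distrib]
      refine Finset.sum_congr rfl fun m _ => ?_
      rw [← Finset.sum_sub_distrib]
      exact Finset.sum_congr rfl fun d _ => by ring
    rw [h2]
    simp only [hbU, hbw]
    rw [Finset.mul_sum, ← Finset.sum_sub_distrib]
    exact Finset.sum_congr rfl fun m _ => by ring
  have hC : (ctr fun a b => U a b * N2 (N1 w) n a b)
      = (ctr fun a b => U a b * N2 (N1 w) a n b) + ∑ p, gi p * (U n p * w p) := by
    have h2 : ∀ a b, U a b * N2 (N1 w) n a b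
        = U a b * N2 (N1 w) a n b + (g n b * (U a b * w a) - g a b * (U a b * w n)) := fun a b => by
      linear_combination U a b * N2_N1_sub w n a b
    have h3 : (ctr fun a b => g n b * (U a b * w a)) = ∑ p, gi p * (U n p * w p) := by
      simp only [ctr, sum_gi_mul_g']
      exact Finset.sum_congr rfl fun m _ => by rw [hU.symm]
    have h4 : (ctr fun a b => g a b * (U a b * w n)) = 0 := by
      simp only [ctr, sum_gi_mul_g']
      have : ∑ a, gi a * (U a a * w n) = tr2 U * w n := by
        rw [tr2, Finset.sum_mul]
        exact Finset.sum_congr rfl fun m _ => by ring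
      rw [this, hU.trace, zero_mul]
    simp only [h2]
    rw [ctr_add, ctr_sub, h3, h4, sub_zero]
  have hF : div2 (fun a b => superpot U w a b - superpot U w b a) n
      = ∑ m, gi m * N2 (superpot U w) m m n - ∑ m, gi m * N2 (superpot U w) m n m := by
    have h2 : ∀ m, N2 (fun a b => superpot U w a b - superpot U w b a) m m n
        = N2 (superpot U w) m m n - N2 (superpot U w) m n m := fun m => by
      simp only [N2, map_sub, mul_sub, Finset.sum_sub_distrib]
      ring
    rw [div2, tr2]
    simp only [h2, mul_sub, Finset.sum_sub_distrib]
  rw [h1, ctr_sub, hC, hF, hA, hB]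
  ring

/-- The time derivative and the connection terms involve only diagonal entries of `F`, so the normal
component is a purely spatial divergence. -/
theorem div2_antisymm_zero {F : Fin 4 → Fin 4 → SmoothM} (hF : ∀ a, F a a = 0) :
    div2 F 0 = sclInv * ∑ i : Fin 3, e i.succ (F i.succ 0) := by
  have h : ∀ i : Fin 3, N2 F i.succ i.succ 0 = e i.succ (F i.succ 0) := fun i => by
    simp only [N2, Fin.sum_univ_succ (n := 3), hF, Γ_succ_zero_zero, Γ_succ_zero_succ, mul_zero,
      Γ_succ_succ_succ_mul, eps_self, zero_smul, ite_mul, Finset.sum_ite_eq, Finset.mem_univ,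
      if_true, zero_mul, Finset.sum_const_zero, add_zero, sub_zero]
  have h0 : N2 F 0 0 0 = 0 := by
    simp [N2, hF, Γ_zero_zero]
  rw [div2, tr2_eq, h0]
  simp only [h, neg_zero, zero_add]

theorem integralS_cur_lie {U : Fin 4 → Fin 4 → SmoothM} (hU : IsGW U) {w : Fin 4 → SmoothM}
    (hw : ∀ c, d1 w c = 0) : integralS (restrict (cur U (lie w) 0)) = 0 := by
  have h : ∀ f : Fin 3 → SmoothM, integralS (restrict (2 * (sclInv * ∑ i, e i.succ (f i)))) = 0 :=
    fun f => by
      have h2 : restrict (2 * (sclInv * ∑ i, e i.succ (f i))) = (2 : ℂ) • ∑ i, eS i (restrict (f i)) := by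
        rw [two_smul', map_mul restrict, map_mul restrict, map_ofNat, restrict_sclInv, one_mul,
          map_sum]
        exact congrArg _ (Finset.sum_congr rfl fun i _ => restrict_e i (f i))
      rw [h2, map_smul, map_sum, Finset.sum_eq_zero fun i _ => integralS_eS i _, smul_zero]
  rw [cur_lie hU hw, div2_antisymm_zero fun a => sub_self _, h]

/-! ### Reality of the geometry, and the charge as the flux of the current -/

theorem conjM_hub : conjM hub = hub := SmoothM.ext fun _ => Complex.conj_ofReal _
theorem conjM_scl : conjM scl = scl := SmoothM.ext fun _ => Complex.conj_ofReal _
theorem conjM_sclInv : conjM sclInv = sclInv := SmoothM.ext fun _ => Complex.conj_ofReal _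

theorem conjM_Γ (a b d : Fin 4) : conjM (Γ a b d) = Γ a b d := by
  rw [Γ_eq]
  fin_cases a <;> fin_cases b <;> fin_cases d <;> simp [Gam, conjM_hub, conjM_scl]

theorem conjM_gi (a : Fin 4) : conjM (gi a) = gi a := by
  fin_cases a <;> simp [gi, conjM_sclInv]

theorem conjM_g (a b : Fin 4) : conjM (g a b) = g a b := by
  fin_cases a <;> fin_cases b <;> simp [g_eq, gd, conjM_scl]

theorem N2_conjM (u : Fin 4 → Fin 4 → SmoothM) (a b c : Fin 4) :
    N2 (fun b c => conjM (u b c)) a b c = conjM (N2 u a b c) := by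
  simp only [N2, map_sub, map_sum, map_mul, conjM_Γ, e_conjM]

theorem N3_conjM (u : Fin 4 → Fin 4 → Fin 4 → SmoothM) (a b c d : Fin 4) :
    N3 (fun b c d => conjM (u b c d)) a b c d = conjM (N3 u a b c d) := by
  simp only [N3, map_sub, map_sum, map_mul, conjM_Γ, e_conjM]

theorem tr2_conjM (u : Fin 4 → Fin 4 → SmoothM) : tr2 (fun b c => conjM (u b c)) = conjM (tr2 u) := by
  simp only [tr2, map_sum, map_mul, conjM_gi]

theorem IsGW.conjM {u : Fin 4 → Fin 4 → SmoothM} (hu : IsGW u) :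
    IsGW fun b c => DeSitter.conjM (u b c) := by
  have hN : N2 (fun b c => DeSitter.conjM (u b c)) = fun a b c => DeSitter.conjM (N2 u a b c) := by
    funext a b c
    exact N2_conjM u a b c
  refine ⟨fun b c => by rw [hu.symm], fun b c => ?_, fun c => ?_, ?_⟩
  · have := congrArg DeSitter.conjM (hu.eqn b c)
    rw [d2] at this ⊢
    rw [bx2] at this ⊢
    rw [hN, tr2_conjM]
    simp only [N3_conjM, tr2_conjM]
    simpa only [map_add, map_sub, map_neg, map_mul, map_ofNat, conjM_g, map_zero] using this
  · rw [div2, hN, tr2_conjM]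
    exact (congrArg DeSitter.conjM (hu.div c)).trans (map_zero _)
  · rw [tr2_conjM, hu.trace, map_zero]

theorem fiberForm_two (u v : Fin 4 → Fin 4 → SmoothM) :
    fiberForm 2 (fun i => restrict (u (i 0) (i 1))) (fun i => restrict (v (i 0) (i 1)))
      = 2 * restrict (ctr fun a b => conjM (u a b) * v a b) := by
  have hsum : ∀ F : (Fin 2 → Fin 4) → SmoothS, ∑ i, F i = ∑ a, ∑ b, F ![a, b] := fun F => by
    rw [← (finTwoArrowEquiv (Fin 4)).symm.sum_comp, Fintype.sum_prod_type]
    rfl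
  have h2 : (Nat.factorial 2 : ℂ) = 2 := by norm_num [Nat.factorial]
  rw [fiberForm, h2, two_smul']
  congr 1
  simp only [hsum, Fin.prod_univ_two]
  simp only [Matrix.cons_val_zero, Matrix.cons_val_one, ← restrict_conjM, ← map_mul, ← map_sum]
  congr 1
  rw [ctr]
  refine Finset.sum_congr rfl fun a _ => ?_
  rw [Finset.mul_sum]
  refine Finset.sum_congr rfl fun b _ => ?_
  rw [Finset.sum_eq_single a, Finset.sum_eq_single b]
  · rw [gInv_eq, gInv_eq, if_pos rfl, if_pos rfl]
    ring
  · intro m _ hm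
    rw [gInv_eq b, if_neg hm.symm]
    ring
  · exact fun h => absurd (Finset.mem_univ b) h
  · intro m _ hm
    refine Finset.sum_eq_zero fun d _ => ?_
    rw [gInv_eq a, if_neg hm.symm]
    ring
  · exact fun h => absurd (Finset.mem_univ a) h

theorem traceReversal_of_trace_eq_zero {A : Type} [CommRing A] [Algebra ℂ A]
    {gm ginv : Fin 4 → Fin 4 → A} {u : (Fin 2 → Fin 4) → A} (h : trace ginv u = 0) :
    traceReversal gm ginv u = u := by
  funext i
  have : traceReversal gm ginv u i = u i - (1 / 2 : ℂ) • (trace ginv u * gm (i 0) (i 1)) := rfl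
  rw [this, h, zero_mul, smul_zero, sub_zero]

theorem trace_restrict (X : Fin 4 → Fin 4 → SmoothM) :
    trace (fun a b => restrict (gInv a b)) (fun i => restrict (X (i 0) (i 1)))
      = restrict (tr2 X) := by
  rw [← sum_gInv]
  simp only [map_sum, map_mul]
  rfl

theorem ISigma_rho {v : Fin 4 → Fin 4 → SmoothM} (hv : tr2 v = 0) :
    ISigma (rho 2 (ten2 v)) = rho 2 (ten2 v) := by
  have h1 : tr2 (N2 v 0) = 0 := by rw [← e_tr2, hv, map_zero]
  rw [rho_ten2]
  have h2 : trace (fun a b => restrict (gInv a b))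
      (Complex.I⁻¹ • fun i : Fin 2 → Fin 4 => restrict (N2 v 0 (i 0) (i 1))) = 0 := by
    rw [map_smul, trace_restrict (N2 v 0), h1, map_zero, smul_zero]
  have h3 : trace (fun a b => restrict (gInv a b)) (fun i => restrict (v (i 0) (i 1))) = 0 := by
    rw [trace_restrict, hv, map_zero]
  exact Prod.ext (traceReversal_of_trace_eq_zero (gm := fun a b => restrict (g a b)) h3)
    (traceReversal_of_trace_eq_zero (gm := fun a b => restrict (g a b)) h2)

/-- Trace reversal is trivial on trace-free data. The factor 2 is the `2!` of the fiber form, and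
the imaginary unit in the Cauchy data, conjugated in the left argument, turns the sum in the charge
into the difference in the current. -/
theorem physicalCharge_rho (u : Fin 4 → Fin 4 → SmoothM) {v : Fin 4 → Fin 4 → SmoothM}
    (hv : tr2 v = 0) : physicalCharge (rho 2 (ten2 u)) (rho 2 (ten2 v))
      = 2 * Complex.I⁻¹ * integralS (restrict (cur (fun a b => conjM (u a b)) v 0)) := by
  have h : physicalCharge (rho 2 (ten2 u)) (rho 2 (ten2 v))
      = charge 2 (rho 2 (ten2 u)) (ISigma (rho 2 (ten2 v))) := rfl
  rw [h, ISigma_rho hv, rho_ten2, rho_ten2]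
  have h2 : ∀ f f' : Data 2, charge 2 f f' = integralS (fiberForm 2 f.1 f'.2 + fiberForm 2 f.2 f'.1) :=
    fun _ _ => rfl
  rw [h2]
  have h3 : fiberForm 2 (fun i => restrict (u (i 0) (i 1)))
      (fun i => Complex.I⁻¹ • restrict (N2 v 0 (i 0) (i 1)))
      = Complex.I⁻¹ • (2 * restrict (ctr fun a b => conjM (u a b) * N2 v 0 a b)) := by
    rw [← fiberForm_two, ← fiberForm_smul_right]
    rfl
  have h4 : fiberForm 2 (fun i => Complex.I⁻¹ • restrict (N2 u 0 (i 0) (i 1)))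
      (fun i => restrict (v (i 0) (i 1)))
      = -(Complex.I⁻¹ • (2 * restrict (ctr fun a b => conjM (N2 u 0 a b) * v a b))) := by
    have := fiberForm_smul_left 2 Complex.I⁻¹ (fun i => restrict (N2 u 0 (i 0) (i 1)))
      (fun i => restrict (v (i 0) (i 1)))
    rw [fiberForm_two, Complex.inv_I, map_neg, Complex.conj_I, neg_neg] at this
    rw [Complex.inv_I, neg_smul, neg_neg]
    exact this
  change integralS (fiberForm 2 (fun i => restrict (u (i 0) (i 1)))
      (fun i => Complex.I⁻¹ • restrict (N2 v 0 (i 0) (i 1))) +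
      fiberForm 2 (fun i => Complex.I⁻¹ • restrict (N2 u 0 (i 0) (i 1)))
      (fun i => restrict (v (i 0) (i 1)))) = _
  have h5 : cur (fun a b => conjM (u a b)) v 0 = (ctr fun a b => conjM (u a b) * N2 v 0 a b)
      - ctr fun a b => conjM (N2 u 0 a b) * v a b := by
    rw [← ctr_sub, cur]
    simp only [N2_conjM]
  rw [h3, h4, h5, map_sub, ← sub_eq_add_neg, ← smul_sub, ← mul_sub, ← two_smul', map_smul, map_smul,
    smul_eq_mul, smul_eq_mul]
  ring

theorem ctr_conjM (F : Fin 4 → Fin 4 → SmoothM) : ctr (fun a b => conjM (F a b)) = conjM (ctr F) := by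
  simp only [ctr, map_sum, map_mul, conjM_gi]

/-- Exchange of the two solutions combined with conjugation changes the sign of the current, since
the geometry is real; the imaginary prefactor restores it. -/
theorem physicalCharge_conj {f f' : Data 2} (hf : f ∈ ETT) (hf' : f' ∈ ETT) :
    physicalCharge f' f = conj (physicalCharge f f') := by
  obtain ⟨u, hu, rfl⟩ := (mem_ETT_iff f).1 hf
  obtain ⟨v, hv, rfl⟩ := (mem_ETT_iff f').1 hf'
  rw [physicalCharge_rho v hu.trace, physicalCharge_rho u hv.trace, map_mul, map_mul,
    ← integralS_conjS, ← restrict_conjM]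
  have : cur (fun a b => conjM (v a b)) u 0 = -conjM (cur (fun a b => conjM (u a b)) v 0) := by
    rw [cur, cur, ← ctr_conjM, ← sub_eq_zero, sub_neg_eq_add, ← ctr_add]
    have h : ∀ a b, conjM (v a b) * N2 u 0 a b - N2 (fun a b => conjM (v a b)) 0 a b * u a b
        + conjM (conjM (u a b) * N2 v 0 a b - N2 (fun a b => conjM (u a b)) 0 a b * v a b) = 0 :=
      fun a b => by
        have hcc : ∀ f, conjM (conjM f) = f := fun f => SmoothM.ext fun p => Complex.conj_conj _
        rw [N2_conjM, N2_conjM, map_sub, map_mul, map_mul, hcc, hcc]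
        ring
    simp only [h, ctr, mul_zero, Finset.sum_const_zero]
  rw [this, map_neg, map_neg, Complex.inv_I, map_neg, Complex.conj_I, map_ofNat]
  ring

theorem physicalCharge_FTT {f f' : Data 2} (hf' : f' ∈ ETT) (hf : f ∈ FTT) :
    physicalCharge f' f = 0 := by
  obtain ⟨w, hd, ht, rfl⟩ := (mem_FTT_iff f).1 hf
  obtain ⟨u, hu, rfl⟩ := (mem_ETT_iff f').1 hf'
  rw [physicalCharge_rho u ht, integralS_cur_lie hu.conjM hd, mul_zero]

/-! ### Charges against gravitational waves -/

theorem conjM_sync (γ : Fin 3 → Fin 3 → SmoothM) :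
    (fun b c => conjM (sync γ b c)) = sync fun i j => conjM (γ i j) := by
  funext b c
  refine Fin.cases ?_ (fun i => ?_) b <;> refine Fin.cases ?_ (fun j => ?_) c
  · simp
  · simp
  · simp
  · rw [sync_succ, sync_succ, map_mul, conjM_scl]

theorem restrict_N2_zero_succ (u : Fin 4 → Fin 4 → SmoothM) (i j : Fin 3) :
    restrict (N2 u 0 i.succ j.succ) = restrict (e 0 (u i.succ j.succ)) := by
  simp only [N2, Fin.sum_univ_succ (n := 3), Γ_zero_succ_zero, Γ_zero_succ_succ, zero_mul, ite_mul,
    Finset.sum_ite_eq, Finset.mem_univ, if_true, map_sub, map_add, map_mul, map_zero, restrict_hub,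
    sub_zero, add_zero]

theorem restrict_cur_sync (γ : Fin 3 → Fin 3 → SmoothM) (u : Fin 4 → Fin 4 → SmoothM) :
    restrict (cur (sync γ) u 0) = ∑ i, ∑ j, (restrict (γ i j) * restrict (e 0 (u i.succ j.succ))
      - restrict (e 0 (γ i j)) * restrict (u i.succ j.succ)) := by
  have h : ∀ F : Fin 4 → Fin 4 → SmoothM, (∀ a, F a 0 = 0) → (∀ a, F 0 a = 0) →
      restrict (ctr F) = ∑ i : Fin 3, ∑ j : Fin 3, restrict (F i.succ j.succ) := fun F h1 h2 => by
    have h3 : ∀ i : Fin 3, restrict (gi i.succ) = 1 := fun i => by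
      fin_cases i <;> exact restrict_sclInv
    simp only [ctr, Fin.sum_univ_succ (n := 3), h1, h2, map_add, map_mul, map_sum, h3, one_mul,
      mul_zero, map_zero, zero_add, Finset.sum_const_zero]
  rw [cur, h]
  · simp only [N2_sync_zero, sync_succ, map_sub, map_mul, restrict_scl, one_mul,
      restrict_N2_zero_succ]
  · intro a
    simp [N2_sync_zero]
  · intro a
    simp [N2_sync_zero]

/-- On the slice the Hubble function vanishes and the scale factor is one, so the current reduces to
`L²` pairings of `p` with the spatial data of `u`, weighted by the data of the amplitude. -/
theorem integralS_cur_gravWave {a : SmoothM} {α β : ℂ} (hα : restrict a = α • (1 : SmoothS))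
    (hβ : restrict (e 0 a) = β • (1 : SmoothS)) (p : MatS) (u : Fin 4 → Fin 4 → SmoothM) :
    integralS (restrict (cur (fun b c => conjM (gravWave a p b c)) u 0))
      = conj α * ipMat p (fun i j => restrict (e 0 (u i.succ j.succ)))
        - conj β * ipMat p (fun i j => restrict (u i.succ j.succ)) := by
  have hc : ∀ (k : ℂ) (x : SmoothS), conjS (k • 1 * x) = conj k • conjS x :=
    fun k x => by rw [smul_one_mul, conjS_smul]
  have h0 : ∀ i j, restrict (e 0 (conjM (a * lift (p i j)))) = conj β • conjS (p i j) := fun i j => by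
    rw [e_conjM, restrict_conjM, e_mul, e_zero_lift, mul_zero, add_zero, map_mul, restrict_lift,
      hβ, hc]
  have h1 : ∀ i j, restrict (conjM (a * lift (p i j))) = conj α • conjS (p i j) := fun i j => by
    rw [restrict_conjM, map_mul, restrict_lift, hα, hc]
  simp only [gravWave, conjM_sync]
  rw [restrict_cur_sync]
  simp only [h0, h1, smul_mul_assoc, map_sum, map_sub, map_smul, smul_eq_mul, ipMat, ipS,
    Finset.mul_sum, Finset.sum_sub_distrib]

/-- Integration by parts moves the derivatives onto `p`, where the divergence appears. -/
theorem ipMat_symm_eS {p : MatS} (hp : IsTT p) (x : Fin 3 → SmoothS) :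
    ipMat p (fun i j => eS i (x j) + eS j (x i)) = 0 := by
  have h : ∀ j, ipS (eS 0 (p 0 j)) (x j) + ipS (eS 1 (p 1 j)) (x j) + ipS (eS 2 (p 2 j)) (x j) = 0 :=
    fun j => by rw [← ipS_add_left, ← ipS_add_left, hp.div, ipS_zero_left]
  have h0 := h 0
  have h1 := h 1
  have h2 := h 2
  simp only [ipMat, Fin.sum_univ_three, ipS_add_right, ipS_eS]
  rw [hp.symm 1 0, hp.symm 2 0] at h0
  rw [hp.symm 2 1] at h1
  rw [hp.symm 1 0, hp.symm 2 0, hp.symm 2 1]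
  linear_combination -2 * h0 - 2 * h1 - 2 * h2

/-- The charge of `u` against every transverse traceless solution vanishes. -/
def IsNull (u : Fin 4 → Fin 4 → SmoothM) : Prop :=
  ∀ f' ∈ ETT, physicalCharge f' (rho 2 (ten2 u)) = 0

theorem IsNull.integralS_cur {u : Fin 4 → Fin 4 → SmoothM} (h : IsNull u) (ht : tr2 u = 0)
    {c : ℝ} {a : SmoothM} (ha : IsAmplitude c a) {p : MatS} (hp : IsTT p)
    (hc : curlTT p = (c : ℂ) • p) :
    integralS (restrict (cur (fun b c => conjM (gravWave a p b c)) u 0)) = 0 := by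
  have h1 := h _ ((mem_ETT_iff _).2 ⟨_, isGW_gravWave ha hp hc, rfl⟩)
  rw [physicalCharge_rho _ ht] at h1
  exact (mul_eq_zero.1 h1).resolve_left
    (mul_ne_zero two_ne_zero (inv_ne_zero Complex.I_ne_zero))

/-- The first amplitude vanishes on the slice, leaving only the term with the metric perturbation.
The factor `c² - 1` is kept, since it is what `exists_killing_potential` asks for. -/
theorem IsNull.ipMat_metric {u : Fin 4 → Fin 4 → SmoothM} (h : IsNull u) (ht : tr2 u = 0)
    {c : ℝ} {p : MatS} (hp : IsTT p) (hc : curlTT p = (c : ℂ) • p) :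
    ((c : ℂ) ^ 2 - 1) * ipMat p (fun i j => restrict (u i.succ j.succ)) = 0 := by
  have h1 := h.integralS_cur ht (isAmplitude_amp1 c) hp hc
  rw [integralS_cur_gravWave (α := 0) (by rw [restrict_amp1, zero_smul]) (restrict_e_amp1 c)] at h1
  simp only [map_zero, map_sub, map_one, map_pow, Complex.conj_ofReal] at h1
  linear_combination h1

/-- The second fundamental form of the perturbation on the Cauchy surface, up to a factor. -/
def sff (u : Fin 4 → Fin 4 → SmoothM) : MatS := fun i j => restrict (e 0 (u i.succ j.succ))
  - (eS i (restrict (u 0 j.succ)) + eS j (restrict (u 0 i.succ)))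

/-- The second amplitude has zero velocity on the slice. The shift terms in `sff` are a symmetrized
gradient and do not pair with `p`. -/
theorem IsNull.ipMat_sff {u : Fin 4 → Fin 4 → SmoothM} (h : IsNull u) (ht : tr2 u = 0)
    {c : ℝ} {p : MatS} (hp : IsTT p) (hc : curlTT p = (c : ℂ) • p) :
    (c : ℂ) * ipMat p (sff u) = 0 := by
  have h1 := h.integralS_cur ht (isAmplitude_amp2 c) hp hc
  rw [integralS_cur_gravWave (β := 0) (restrict_amp2 c) (by rw [restrict_e_amp2, zero_smul])] at h1
  have h2 := ipMat_symm_eS hp fun j => restrict (u 0 j.succ)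
  have h3 : sff u = (fun i j => restrict (e 0 (u i.succ j.succ))) - fun i j =>
    eS i (restrict (u 0 j.succ)) + eS j (restrict (u 0 i.succ)) := rfl
  rw [h3, ipMat_sub_right, h2]
  simp only [map_zero, Complex.conj_ofReal] at h1
  linear_combination h1

/-! ### Synchronous gauge -/

theorem lie_zero_zero (w : Fin 4 → SmoothM) : lie w 0 0 = 2 * e 0 (w 0) := by
  simp only [lie, N1, Γ_zero_zero, zero_mul, Finset.sum_const_zero, sub_zero]
  ring

theorem N1_zero_succ (w : Fin 4 → SmoothM) (i : Fin 3) :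
    N1 w 0 i.succ = e 0 (w i.succ) - hub * w i.succ := by
  simp only [N1, Fin.sum_univ_succ (n := 3), Γ_zero_succ_zero, Γ_zero_succ_succ, zero_mul, ite_mul,
    Finset.sum_ite_eq, Finset.mem_univ, if_true, zero_add]

theorem N1_succ_zero (w : Fin 4 → SmoothM) (i : Fin 3) :
    N1 w i.succ 0 = e i.succ (w 0) - hub * w i.succ := by
  simp only [N1, Fin.sum_univ_succ (n := 3), Γ_succ_zero_zero, Γ_succ_zero_succ, zero_mul, ite_mul,
    Finset.sum_ite_eq, Finset.mem_univ, if_true, zero_add]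

theorem N1_succ_succ (w : Fin 4 → SmoothM) (i j : Fin 3) : N1 w i.succ j.succ
    = e i.succ (w j.succ) - (if i = j then hub * scl * w 0 else 0) - ∑ k, eps i j k • w k.succ := by
  simp only [N1, Fin.sum_univ_succ (n := 3), Γ_succ_succ_zero, Γ_succ_succ_succ_mul, zero_mul,
    ite_mul, sub_sub]

theorem lie_zero_succ (w : Fin 4 → SmoothM) (i : Fin 3) :
    lie w 0 i.succ = e 0 (w i.succ) + e i.succ (w 0) - 2 * hub * w i.succ := by
  rw [lie, N1_zero_succ, N1_succ_zero]
  ring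

theorem lie_succ_succ (w : Fin 4 → SmoothM) (i j : Fin 3) : lie w i.succ j.succ
    = e i.succ (w j.succ) + e j.succ (w i.succ) - if i = j then 2 * hub * scl * w 0 else 0 := by
  have h : (∑ k, eps i j k • w k.succ) + ∑ k, eps j i k • w k.succ = 0 := by
    rw [← Finset.sum_add_distrib]
    refine Finset.sum_eq_zero fun k _ => ?_
    rw [← add_smul]
    have : eps i j k + eps j i k = 0 := by
      fin_cases i <;> fin_cases j <;> fin_cases k <;> simp [eps]
    rw [this, zero_smul]
  rw [lie, N1_succ_succ, N1_succ_succ]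
  by_cases hij : i = j
  · subst hij
    simp only [if_true] at h ⊢
    linear_combination -h
  · rw [if_neg hij, if_neg (Ne.symm hij), if_neg hij]
    linear_combination -h

theorem tr2_N1 (w : Fin 4 → SmoothM) :
    tr2 (N1 w) = -e 0 (w 0) - 3 * hub * w 0 + sclInv * ∑ i : Fin 3, e i.succ (w i.succ) := by
  rw [tr2_eq]
  have h0 : N1 w 0 0 = e 0 (w 0) := by
    simp only [N1, Γ_zero_zero, zero_mul, Finset.sum_const_zero, sub_zero]
  simp only [h0, N1_succ_succ, eps_self, zero_smul, Finset.sum_const_zero, sub_zero, if_true,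
    Finset.sum_sub_distrib, Finset.sum_const, Finset.card_univ, Fintype.card_fin, nsmul_eq_mul]
  push_cast
  linear_combination -3 * hub * w 0 * scl_mul_sclInv

/-- The time component of the gauge field bringing `u` into synchronous gauge. -/
def gaugeTime (η : SmoothS) (u : Fin 4 → Fin 4 → SmoothM) : SmoothM :=
  lift η + hf * tint (u 0 0)

/-- The space components of the gauge vector bringing `u` into synchronous gauge. -/
def gaugeSpace (η : SmoothS) (ξ : Fin 3 → SmoothS) (u : Fin 4 → Fin 4 → SmoothM) (i : Fin 3) :
    SmoothM := lift (ξ i) + tint (sclInv * (u 0 i.succ - e i.succ (gaugeTime η u)))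

/-- The gauge field bringing `u` into synchronous gauge. -/
def gauge (η : SmoothS) (ξ : Fin 3 → SmoothS) (u : Fin 4 → Fin 4 → SmoothM) (c : Fin 4) : SmoothM :=
  Fin.cases (gaugeTime η u) (fun i => scl * gaugeSpace η ξ u i) c

/-- The spatial components of `u` in synchronous gauge. -/
def syncPart (η : SmoothS) (ξ : Fin 3 → SmoothS) (u : Fin 4 → Fin 4 → SmoothM) (i j : Fin 3) :
    SmoothM := sclInv * u i.succ j.succ - e i.succ (gaugeSpace η ξ u j) -
      e j.succ (gaugeSpace η ξ u i) + if i = j then 2 * hub * gaugeTime η u else 0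

section

variable (η : SmoothS) (ξ : Fin 3 → SmoothS) (u : Fin 4 → Fin 4 → SmoothM)

theorem e_zero_gaugeTime : e 0 (gaugeTime η u) = hf * u 0 0 := by
  rw [gaugeTime, map_add, e_zero_lift, e_hf_mul, e_zero_tint, zero_add]

theorem e_zero_gaugeSpace (i : Fin 3) : e 0 (gaugeSpace η ξ u i)
    = sclInv * (u 0 i.succ - e i.succ (gaugeTime η u)) := by
  rw [gaugeSpace, map_add, e_zero_lift, e_zero_tint, zero_add]

theorem restrict_gaugeTime : restrict (gaugeTime η u) = η := by
  rw [gaugeTime, map_add, restrict_lift, map_mul, restrict_tint, mul_zero, add_zero]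

theorem restrict_gaugeSpace (i : Fin 3) : restrict (gaugeSpace η ξ u i) = ξ i := by
  rw [gaugeSpace, map_add, restrict_lift, restrict_tint, add_zero]

/-- The `00` equation is an ordinary differential equation in time for the time component of the
gauge field, and the `0i` equations then determine its rescaled space components. Both are solved by
`tint`, with free initial values `η` and `ξ`. -/
theorem sub_lie_gauge (hu : ∀ b c, u b c = u c b) (b c : Fin 4) :
    u b c - lie (gauge η ξ u) b c = sync (syncPart η ξ u) b c := by
  have h0 : u 0 0 - lie (gauge η ξ u) 0 0 = 0 := by
    rw [lie_zero_zero]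
    change u 0 0 - 2 * e 0 (gaugeTime η u) = 0
    rw [e_zero_gaugeTime]
    linear_combination -u 0 0 * two_mul_hf
  have h1 : ∀ i : Fin 3, u 0 i.succ - lie (gauge η ξ u) 0 i.succ = 0 := fun i => by
    rw [lie_zero_succ]
    change u 0 i.succ - (e 0 (scl * gaugeSpace η ξ u i) + e i.succ (gaugeTime η u)
      - 2 * hub * (scl * gaugeSpace η ξ u i)) = 0
    rw [e_mul, e_zero_gaugeSpace, e_zero_scl]
    linear_combination -(u 0 i.succ - e i.succ (gaugeTime η u)) * scl_mul_sclInv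
  refine Fin.cases ?_ (fun i => ?_) b <;> refine Fin.cases ?_ (fun j => ?_) c
  · exact h0
  · exact h1 j
  · rw [hu, lie_symm]
    exact h1 i
  · rw [lie_succ_succ, sync_succ, syncPart]
    change u i.succ j.succ - (e i.succ (scl * gaugeSpace η ξ u j) + e j.succ (scl * gaugeSpace η ξ u i)
      - if i = j then 2 * hub * scl * gaugeTime η u else 0) = _
    rw [e_mul, e_mul, e_succ_scl, e_succ_scl]
    split_ifs
    · linear_combination -u i.succ j.succ * scl_mul_sclInv
    · linear_combination -u i.succ j.succ * scl_mul_sclInv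

theorem syncPart_symm (hu : ∀ b c, u b c = u c b) (i j : Fin 3) :
    syncPart η ξ u i j = syncPart η ξ u j i := by
  rw [syncPart, syncPart, hu i.succ]
  simp only [eq_comm (a := i)]
  ring

/-- The freedom in `ξ` changes the initial metric by a symmetrized gradient, the form delivered by
`exists_killing_potential`. -/
theorem restrict_syncPart (i j : Fin 3) : restrict (syncPart η ξ u i j)
    = restrict (u i.succ j.succ) - (eS i (ξ j) + eS j (ξ i)) := by
  have h : restrict (if i = j then 2 * hub * gaugeTime η u else 0) = 0 := by
    split_ifs
    · rw [map_mul, map_mul, restrict_hub, mul_zero, zero_mul]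
    · exact map_zero _
  rw [syncPart, map_add, h, map_sub, map_sub, map_mul, restrict_sclInv, restrict_e, restrict_e,
    restrict_gaugeSpace, restrict_gaugeSpace]
  ring

/-- The freedom in `η` changes the initial velocity by `2 (Hess η + η g)`, the form delivered by
`exists_hessian`. The multiple of the metric comes from the derivative of the Hubble function, which
is one on the slice. -/
theorem restrict_e_zero_syncPart (i j : Fin 3) : restrict (e 0 (syncPart η ξ u i j))
    = sff u i j + (eS i (eS j η) + eS j (eS i η)) + 2 * diagS η i j := by
  have h : restrict (e 0 (if i = j then 2 * hub * gaugeTime η u else 0)) = 2 * diagS η i j := by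
    rw [diagS]
    split_ifs
    · rw [mul_assoc, e_ofNat_mul, e_mul, e_zero_hub, map_mul, map_add, map_mul, map_mul, map_sub,
        map_mul, restrict_hub, restrict_gaugeTime, map_one, map_ofNat]
      ring
    · rw [map_zero, map_zero, mul_zero]
  have h1 : ∀ i j : Fin 3, restrict (e 0 (e i.succ (gaugeSpace η ξ u j)))
      = eS i (restrict (u 0 j.succ)) - eS i (eS j η) := fun i j => by
    rw [e_zero_e_succ, e_zero_gaugeSpace, restrict_e, map_mul, restrict_sclInv, one_mul, map_sub,
      restrict_e, restrict_gaugeTime, map_sub]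
  have h2 : restrict (e 0 (sclInv * u i.succ j.succ)) = restrict (e 0 (u i.succ j.succ)) := by
    rw [e_mul, e_zero_sclInv, map_add, map_mul, map_mul, map_mul, map_mul, restrict_hub,
      restrict_sclInv]
    ring
  rw [syncPart, map_add, map_add, h, map_sub, map_sub, map_sub, map_sub, h1, h1, h2, sff]
  ring

end

/-! ### Solutions which are pure gauge up to a synchronous remainder -/

/-- A transverse traceless solution which is the sum of a Lie derivative and a tensor in
synchronous gauge. -/
structure IsSyncGauge (u : Fin 4 → Fin 4 → SmoothM) (w : Fin 4 → SmoothM)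
    (γ : Fin 3 → Fin 3 → SmoothM) : Prop where
  sol : IsGW u
  symm : ∀ i j, γ i j = γ j i
  decomp : ∀ b c, u b c - lie w b c = sync γ b c

namespace IsSyncGauge

variable {u : Fin 4 → Fin 4 → SmoothM} {w : Fin 4 → SmoothM} {γ : Fin 3 → Fin 3 → SmoothM}
  (h : IsSyncGauge u w γ)

include h

theorem tr : (∑ i, γ i i) = -2 * tr2 (N1 w) := by
  have h1 := tr2_add (sync γ) (lie w)
  have h2 : (fun m n => sync γ m n + lie w m n) = u := by
    funext m n
    rw [← h.decomp]
    ring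
  rw [h2, h.sol.trace, tr2_lie, tr2_sync] at h1
  linear_combination -h1

/-- The gauge field is not assumed to satisfy its wave equation. Transversality of `u` expresses the
failure through `γ`, and this turns the field equation into equations for `γ` alone. -/
theorem two_mul_d1 (c : Fin 4) :
    2 * d1 w c = 2 * div2 (sync γ) c - e c (∑ i, γ i i) := by
  have h1 := div2_add (sync γ) (lie w) c
  have h2 : (fun m n => sync γ m n + lie w m n) = u := by
    funext m n
    rw [← h.decomp]
    ring
  rw [h2, h.sol.div, div2_lie] at h1
  have h3 := congrArg (e c) h.tr
  have h4 : e c (-2 * tr2 (N1 w)) = -2 * e c (tr2 (N1 w)) := by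
    rw [neg_mul, map_neg, e_ofNat_mul, neg_mul]
  rw [h4] at h3
  rw [d1]
  linear_combination 2 * h1 + h3

theorem two_mul_d1_zero :
    2 * d1 w 0 = -(2 * (hub * ∑ i, γ i i)) - e 0 (∑ i, γ i i) := by
  rw [h.two_mul_d1, div2_sync_zero]
  ring

theorem two_mul_d1_succ (j : Fin 3) :
    2 * d1 w j.succ = 2 * (∑ i, e i.succ (γ i j)) - e j.succ (∑ i, γ i i) := by
  rw [h.two_mul_d1, div2_sync_succ γ h.symm]

theorem d2_sync (b c : Fin 4) : d2 (sync γ) b c = -lie (d1 w) b c := by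
  have h2 : sync γ = fun m n => u m n - lie w m n := by
    funext m n
    rw [← h.decomp]
  rw [h2, d2_sub, h.sol.eqn, d2_lie, zero_sub]

/-- The `00` component of the field equation, with `d1 w` eliminated: the terms without derivatives
cancel because `1/cosh² = 1 - tanh²`. -/
theorem e_zero_e_zero_tr :
    e 0 (e 0 (∑ i, γ i i)) + 2 * hub * e 0 (∑ i, γ i i) = 0 := by
  have h1 := h.d2_sync 0 0
  have h2 := congrArg (e 0) h.two_mul_d1_zero
  rw [d2_sync_zero_zero, lie_zero_zero] at h1
  rw [e_ofNat_mul, map_sub, map_neg, e_ofNat_mul, e_mul, e_zero_hub] at h2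
  rw [sclInv_eq] at h1
  linear_combination h2 - h1

/-- The linearized momentum constraint, from the `0j` components. -/
theorem e_zero_div (j : Fin 3) :
    e 0 (∑ i, e i.succ (γ i j)) = e j.succ (e 0 (∑ i, γ i i)) := by
  have h1 := h.d2_sync 0 j.succ
  rw [d2_sync_zero_succ γ h.symm, lie_zero_succ] at h1
  have h2 := congrArg (e 0) (h.two_mul_d1_succ j)
  have h3 := congrArg (e j.succ) h.two_mul_d1_zero
  have h4 := h.two_mul_d1_succ j
  rw [e_ofNat_mul, map_sub, e_ofNat_mul, e_zero_e_succ] at h2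
  rw [e_ofNat_mul, map_sub, map_neg, e_ofNat_mul, e_mul, e_succ_hub, zero_mul] at h3
  linear_combination hf * (2 * h1 - h2 - h3 + 2 * hub * h4)
    + (-e 0 (∑ i, e i.succ (γ i j)) + e j.succ (e 0 (∑ i, γ i i))) * two_mul_hf

/-- The linearized Hamiltonian constraint, from the trace of the field equation combined with its
`00` component. On the slice the left side drops out, because the Hubble function vanishes there. -/
theorem hamiltonian : 2 * hub * e 0 (∑ i, γ i i) = sclInv *
    ((∑ i : Fin 3, e i.succ (e i.succ (∑ i, γ i i)))
      - (∑ j : Fin 3, e j.succ (∑ i, e i.succ (γ i j))) + 2 * ∑ i, γ i i) := by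
  have h1 : tr2 (d2 (sync γ)) = -2 * tr2 (N1 (d1 w)) := by
    have h2 : d2 (sync γ) = fun b c => (-1 : ℂ) • lie (d1 w) b c := by
      funext b c
      rw [h.d2_sync, neg_smul, one_smul]
    rw [h2, tr2_smul, tr2_lie, neg_smul, one_smul, neg_mul]
  rw [tr2_d2, tr2_sync, bx0, tr2_N1, tr2_N1] at h1
  have h00 := congrArg (e 0) h.two_mul_d1_zero
  rw [e_ofNat_mul, map_sub, map_neg, e_ofNat_mul, e_mul, e_zero_hub] at h00
  have hjj : 2 * ∑ j : Fin 3, e j.succ (d1 w j.succ)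
      = 2 * (∑ j : Fin 3, e j.succ (∑ i, e i.succ (γ i j)))
        - ∑ i : Fin 3, e i.succ (e i.succ (∑ i, γ i i)) := by
    rw [Finset.mul_sum, Finset.mul_sum, ← Finset.sum_sub_distrib]
    refine Finset.sum_congr rfl fun j _ => ?_
    have := congrArg (e j.succ) (h.two_mul_d1_succ j)
    rwa [e_ofNat_mul, map_sub, e_ofNat_mul] at this
  have h0 := h.two_mul_d1_zero
  have ht := h.e_zero_e_zero_tr
  have hs := sclInv_eq
  set T := ∑ i, γ i i
  set G := 2 * hub * e 0 T - sclInv * ((∑ i : Fin 3, e i.succ (e i.succ T))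
    - (∑ j : Fin 3, e j.succ (∑ i, e i.succ (γ i j))) + 2 * T) with hG
  rw [← sub_eq_zero, ← hG]
  linear_combination hf * (h1 + h00 + 3 * hub * h0 - sclInv * hjj - 2 * ht - 4 * T * hs + 2 * hG)
    - G * two_mul_hf

theorem restrict_momentum (j : Fin 3) :
    ∑ i, eS i (restrict (e 0 (γ i j))) = eS j (∑ i, restrict (e 0 (γ i i))) := by
  have h1 := congrArg restrict (h.e_zero_div j)
  rw [map_sum, map_sum, restrict_e, map_sum, map_sum] at h1
  rw [← h1]
  exact Finset.sum_congr rfl fun i _ => by rw [e_zero_e_succ, restrict_e]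

theorem restrict_hamiltonian :
    (∑ i, eS i (eS i (∑ i, restrict (γ i i)))) - (∑ i, ∑ j, eS i (eS j (restrict (γ i j))))
      + 2 * ∑ i, restrict (γ i i) = 0 := by
  have h1 := congrArg restrict h.hamiltonian
  have h2 : ∀ i : Fin 3, restrict (e i.succ (e i.succ (∑ i, γ i i)))
      = eS i (eS i (∑ i, restrict (γ i i))) := fun i => by
    rw [restrict_e, restrict_e, map_sum]
  have h3 : ∀ j : Fin 3, restrict (e j.succ (∑ i, e i.succ (γ i j)))
      = ∑ i, eS j (eS i (restrict (γ j i))) := fun j => by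
    rw [restrict_e, map_sum, map_sum]
    exact Finset.sum_congr rfl fun i _ => by rw [restrict_e, h.symm]
  rw [map_mul, map_mul, restrict_hub, mul_zero, zero_mul, map_mul, restrict_sclInv, one_mul,
    map_add, map_sub, map_sum, map_sum, map_mul, map_ofNat, map_sum] at h1
  simp only [h2, h3] at h1
  exact h1.symm

/-- The trace and divergence of `γ` obey ordinary differential equations in time and vanish with
their data. Then `d1 w = 0`, so the synchronous remainder solves the wave equation with zero data.
-/
theorem eq_lie (h0 : ∀ i j, restrict (γ i j) = 0) (h1 : ∀ i j, restrict (e 0 (γ i j)) = 0) :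
    u = lie w ∧ ∀ c, d1 w c = 0 := by
  have hsT : restrict (e 0 (∑ i, γ i i)) = 0 := by
    rw [map_sum, map_sum]
    exact Finset.sum_eq_zero fun i _ => h1 i i
  have hT' : e 0 (∑ i, γ i i) = 0 := by
    -- The integrating factor `cosh² t` makes the velocity of the trace a conserved quantity.
    have h2 : scl * e 0 (∑ i, γ i i) = 0 := by
      refine eq_zero_of_e_zero ?_ ?_
      · rw [e_mul, e_zero_scl]
        linear_combination scl * h.e_zero_e_zero_tr
      · rw [map_mul, hsT, mul_zero]
    linear_combination sclInv * h2 - e 0 (∑ i, γ i i) * scl_mul_sclInv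
  have hT : ∑ i, γ i i = 0 := by
    refine eq_zero_of_e_zero hT' ?_
    rw [map_sum]
    exact Finset.sum_eq_zero fun i _ => h0 i i
  have hD : ∀ j, ∑ i, e i.succ (γ i j) = 0 := fun j => by
    refine eq_zero_of_e_zero ?_ ?_
    · rw [h.e_zero_div, hT', map_zero]
    · rw [map_sum]
      exact Finset.sum_eq_zero fun i _ => by rw [restrict_e, h0, map_zero]
  have hq : ∀ c, d1 w c = 0 := fun c => by
    have h2 : 2 * d1 w c = 0 := by
      refine Fin.cases ?_ (fun j => ?_) c
      · rw [h.two_mul_d1_zero, hT, map_zero]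
        ring
      · rw [h.two_mul_d1_succ, hD, hT, map_zero]
        ring
    linear_combination hf * h2 - d1 w c * two_mul_hf
  refine ⟨?_, hq⟩
  have hl : ∀ b c, lie (d1 w) b c = 0 := fun b c => by
    have : d1 w = fun _ => 0 := funext hq
    rw [this]
    simp [lie, N1]
  have hv : ∀ b c, sync γ b c = 0 := by
    refine d2_unique (fun b c => by rw [h.d2_sync, hl, neg_zero]) (fun b c => ?_) fun b c => ?_
    · refine Fin.cases ?_ (fun i => ?_) b <;> refine Fin.cases ?_ (fun j => ?_) c
      · exact map_zero _
      · exact map_zero _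
      · exact map_zero _
      · rw [sync_succ, map_mul, h0, mul_zero]
    · refine Fin.cases ?_ (fun i => ?_) b <;> refine Fin.cases ?_ (fun j => ?_) c
      · simp
      · simp
      · simp
      · rw [sync_succ, e_mul, map_add, map_mul, map_mul, h0, h1, mul_zero, mul_zero, add_zero]
  funext b c
  rw [← sub_eq_zero, h.decomp, hv]

end IsSyncGauge

theorem isSyncGauge_gauge {u : Fin 4 → Fin 4 → SmoothM} (hu : IsGW u) (η : SmoothS)
    (ξ : Fin 3 → SmoothS) : IsSyncGauge u (gauge η ξ u) (syncPart η ξ u) :=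
  ⟨hu, syncPart_symm η ξ u hu.symm, sub_lie_gauge η ξ u hu.symm⟩

/-- Nullity removes the wave degrees of freedom of the initial data and the constraints remove the
rest, so the data are those of a Lie derivative. -/
theorem exists_lie_of_isNull {u : Fin 4 → Fin 4 → SmoothM} (hu : IsGW u) (hn : IsNull u) :
    ∃ w, (∀ c, d1 w c = 0) ∧ u = lie w := by
  -- With zero initial values, the synchronous data are the induced metric and `sff u`; this gauge
  -- serves only to read off the constraints.
  have h := isSyncGauge_gauge hu 0 fun _ => 0
  have hh : ∀ i j, restrict (syncPart 0 (fun _ => 0) u i j) = restrict (u i.succ j.succ) :=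
    fun i j => by rw [restrict_syncPart, map_zero, map_zero, add_zero, sub_zero]
  have hk : ∀ i j, restrict (e 0 (syncPart 0 (fun _ => 0) u i j)) = sff u i j := fun i j => by
    have hd : diagS 0 i j = 0 := by simp [diagS]
    rw [restrict_e_zero_syncPart, hd]
    simp
  have ham := h.restrict_hamiltonian
  have hmom := h.restrict_momentum
  simp only [hh] at ham
  simp only [hk] at hmom
  obtain ⟨x, hx⟩ := exists_killing_potential (h := fun i j => restrict (u i.succ j.succ))
    (fun i j => by rw [hu.symm])
    (by
      have ht : trS (fun i j => restrict (u i.succ j.succ)) = ∑ i : Fin 3, restrict (u i.succ i.succ) := by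
        rw [Fin.sum_univ_three]; rfl
      rw [ht]
      exact ham)
    fun p c hp hc => hn.ipMat_metric hu.trace hp hc
  obtain ⟨f, hf⟩ := exists_hessian (K := sff u)
    (fun i j => by rw [sff, sff, hu.symm i.succ]; ring)
    (fun j => by
      have := hmom j
      rw [Fin.sum_univ_three, Fin.sum_univ_three] at this
      exact this)
    fun p c hp hc => hn.ipMat_sff hu.trace hp hc
  have half : ∀ a : SmoothS, (1 / 2 : ℂ) • (2 * a) = a := fun a => by
    rw [← two_smul', smul_smul]
    norm_num
  -- The initial values `-f/2` and `x/2` cancel the velocity and the metric of the remainder; the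
  -- halves compensate the factors 2 in the two potential lemmas.
  have h' := isSyncGauge_gauge hu (-((1 / 2 : ℂ) • f)) fun i => (1 / 2 : ℂ) • x i
  obtain ⟨h1, h2⟩ := h'.eq_lie
    (fun i j => by
      rw [restrict_syncPart, map_smul, map_smul, ← smul_add, hx, half, sub_self])
    (fun i j => by
      have h3 := hf i j
      have h4 : 2 * diagS (-((1 / 2 : ℂ) • f)) i j = -diagS f i j := by
        simp only [diagS]
        split_ifs
        · rw [mul_neg, mul_smul_comm, half]
        · simp
      rw [restrict_e_zero_syncPart, h4, map_neg, map_neg, map_neg, map_neg, map_smul, map_smul,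
        map_smul, map_smul, ← neg_add, ← smul_add, h3, ← mul_sub, half]
      ring)
  exact ⟨_, h2, h1⟩

/-- The kernel of the physical charge on transverse traceless data is pure gauge. -/
theorem kerRestrict_physicalCharge : kerRestrict physicalCharge ETT = FTT := by
  ext f
  constructor
  · rintro ⟨hf, hn⟩
    obtain ⟨u, hu, rfl⟩ := (mem_ETT_iff f).1 hf
    obtain ⟨w, hd, rfl⟩ := exists_lie_of_isNull hu hn
    exact (mem_FTT_iff _).2 ⟨w, hd, hu.trace, rfl⟩
  · exact fun hf => ⟨FTT_le_ETT hf, fun f' hf' => physicalCharge_FTT hf' hf⟩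

/-! ### The physical phase space -/

section

variable {X : Type} [AddCommGroup X] [Module ℂ X]

/-- A sesquilinear form is Hermitian on a subspace. -/
def IsHermitianOn (q : X →ₗ⋆[ℂ] X →ₗ[ℂ] ℂ) (E : Submodule ℂ X) : Prop :=
  ∀ f ∈ E, ∀ f' ∈ E, q f' f = conj (q f f')

/-- A sesquilinear form, restricted to a subspace and modulo a null subspace. -/
def quotForm (q : X →ₗ⋆[ℂ] X →ₗ[ℂ] ℂ) (E F : Submodule ℂ X)
    (hr : ∀ f' ∈ E, ∀ f ∈ F, q f' f = 0) (hl : ∀ f ∈ F, ∀ f' ∈ E, q f f' = 0) :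
    (E ⧸ F.submoduleOf E) →ₗ⋆[ℂ] (E ⧸ F.submoduleOf E) →ₗ[ℂ] ℂ :=
  (F.submoduleOf E).liftQ
    { toFun := fun f => (F.submoduleOf E).liftQ ((q f).comp E.subtype)
        fun x hx => hr f f.2 x hx
      map_add' := fun f f' => by
        refine LinearMap.ext fun x => ?_
        obtain ⟨x, rfl⟩ := Submodule.Quotient.mk_surjective _ x
        exact LinearMap.map_add₂ q (f : X) (f' : X) (x : X)
      map_smul' := fun c f => by
        refine LinearMap.ext fun x => ?_
        obtain ⟨x, rfl⟩ := Submodule.Quotient.mk_surjective _ x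
        exact LinearMap.map_smulₛₗ₂ q c (f : X) (x : X) }
    fun f hf => by
      refine LinearMap.ext fun x => ?_
      obtain ⟨x, rfl⟩ := Submodule.Quotient.mk_surjective _ x
      exact hl f hf x x.2

theorem quotForm_mk (q : X →ₗ⋆[ℂ] X →ₗ[ℂ] ℂ) (E F : Submodule ℂ X)
    (hr : ∀ f' ∈ E, ∀ f ∈ F, q f' f = 0) (hl : ∀ f ∈ F, ∀ f' ∈ E, q f f' = 0) (f f' : E) :
    quotForm q E F hr hl (Submodule.Quotient.mk f) (Submodule.Quotient.mk f')
      = q (f : X) (f' : X) := rfl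

theorem quotForm_conj (q : X →ₗ⋆[ℂ] X →ₗ[ℂ] ℂ) (E F : Submodule ℂ X)
    (hr : ∀ f' ∈ E, ∀ f ∈ F, q f' f = 0) (hl : ∀ f ∈ F, ∀ f' ∈ E, q f f' = 0)
    (hc : IsHermitianOn q E) (x x' : E ⧸ F.submoduleOf E) :
    quotForm q E F hr hl x' x = conj (quotForm q E F hr hl x x') := by
  obtain ⟨x, rfl⟩ := Submodule.Quotient.mk_surjective _ x
  obtain ⟨x', rfl⟩ := Submodule.Quotient.mk_surjective _ x'
  exact hc x x.2 x' x'.2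

theorem quotForm_nondegenerate (q : X →ₗ⋆[ℂ] X →ₗ[ℂ] ℂ) (E F : Submodule ℂ X)
    (hr : ∀ f' ∈ E, ∀ f ∈ F, q f' f = 0) (hl : ∀ f ∈ F, ∀ f' ∈ E, q f f' = 0)
    (hc : IsHermitianOn q E) (hk : kerRestrict q E ≤ F) :
    (quotForm q E F hr hl).Nondegenerate := by
  have h : (quotForm q E F hr hl).SeparatingRight := fun x hx => by
    obtain ⟨x, rfl⟩ := Submodule.Quotient.mk_surjective _ x
    exact (Submodule.Quotient.mk_eq_zero _).2
      (hk ⟨x.2, fun f' hf' => hx (Submodule.Quotient.mk ⟨f', hf'⟩)⟩ : (x : X) ∈ F)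
  exact ⟨fun x hx => h x fun y => by rw [quotForm_conj q E F hr hl hc, hx, map_zero], h⟩

end

/-- The kernel is taken in the right argument only. Hermiticity transfers it to the left, which
makes the quotient form well defined and nondegenerate on both sides. -/
theorem exists_quotForm {k : ℕ} (q : Data k →ₗ⋆[ℂ] Data k →ₗ[ℂ] ℂ)
    (E F : Submodule ℂ (Data k)) (hF : F ≤ E)
    (hc : IsHermitianOn q E) (hk : kerRestrict q E = F) :
    ∃ Q : (E ⧸ F.submoduleOf E) →ₗ⋆[ℂ] (E ⧸ F.submoduleOf E) →ₗ[ℂ] ℂ,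
      (∀ f f' : E, Q (Submodule.Quotient.mk f) (Submodule.Quotient.mk f')
        = q (f : Data k) (f' : Data k)) ∧
      (∀ x x', Q x' x = conj (Q x x')) ∧ Q.Nondegenerate := by
  have hr : ∀ f' ∈ E, ∀ f ∈ F, q f' f = 0 := fun f' hf' f hf => by
    rw [← hk] at hf
    exact hf.2 f' hf'
  have hl : ∀ f ∈ F, ∀ f' ∈ E, q f f' = 0 := fun f hf f' hf' => by
    have := hc f' hf' f (hF hf)
    rw [hr f' hf' f hf, map_zero] at this
    exact this
  exact ⟨quotForm q E F hr hl, quotForm_mk q E F hr hl, quotForm_conj q E F hr hl hc,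
    quotForm_nondegenerate q E F hr hl hc hk.le⟩

theorem isHermitianOn_physicalCharge : IsHermitianOn physicalCharge ETT := by
  intro f hf f' hf'
  exact physicalCharge_conj hf hf'

end DeSitter

end

theorem mainTheorem4 :
    DeSitter.kerRestrict DeSitter.physicalCharge DeSitter.ETT = DeSitter.FTT ∧
    ∃ Q : (DeSitter.ETT ⧸ DeSitter.FTT.submoduleOf DeSitter.ETT) →ₗ⋆[ℂ]
        (DeSitter.ETT ⧸ DeSitter.FTT.submoduleOf DeSitter.ETT) →ₗ[ℂ] ℂ,
      (∀ f f' : DeSitter.ETT,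
        Q (Submodule.Quotient.mk f) (Submodule.Quotient.mk f')
          = DeSitter.physicalCharge (f : DeSitter.Data 2) (f' : DeSitter.Data 2)) ∧
      (∀ x x', Q x' x = (starRingEnd ℂ) (Q x x')) ∧
      Q.Nondegenerate := by
  exact ⟨DeSitter.kerRestrict_physicalCharge, DeSitter.exists_quotForm DeSitter.physicalCharge
    DeSitter.ETT DeSitter.FTT DeSitter.FTT_le_ETT
    DeSitter.isHermitianOn_physicalCharge DeSitter.kerRestrict_physicalCharge⟩
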